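/- **Setting.** Let $\xi$ be a random variable with law $\mathbb{P}$, let $\mathbf{F}(x,\xi)\in\mathbb{R}^q$ ($x\in\mathbb{R}^p$) be a random vector function with expectation $F(x)=\mathbb{E}_\xi[\mathbf{F}(x,\xi)]$, let $K\in\mathbb{R}^{q\times n}$, and let $\psi:\mathbb{R}^n\to\mathbb{R}\cup\{+\infty\}$ and $\mathcal{R}:\mathbb{R}^p\to\mathbb{R}\cup\{+\infty\}$ be proper, closed and convex. Put $\phi_0(u)=\max_{y}\{\langle K^\top u,y\rangle-\psi(y)\}$, $\Phi_0(x)=\phi_0(F(x))$, $\Psi_0=\Phi_0+\mathcal{R}$, and assume $\Psi_0^\star=\inf_x\Psi_0(x)>-\infty$. For $\eta>0$ let $\mathcal{G}_\eta(x)=\frac1\eta\big(x-\mathrm{prox}_{\eta\mathcal{R}}(x-\eta\nabla\Phi_0(x))\big)$. Below, $\|\cdot\|$ is the Euclidean norm of vectors and the operator norm of matrices, and $\|\cdot\|_F$ is the Frobenius norm. **Assumptions.** The Jacobians $\mathbf{F}'(x,\xi)$ of $\mathbf{F}(\cdot,\xi)$ and $F'(x)$ of $F$ exist for $x\in\mathrm{dom}\,\Psi_0$,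 and there are constants $L_F,\sigma_F,\sigma_J,M_F\in(0,\infty)$ such that for all $x,y\in\mathrm{dom}\,\Psi_0$ $$\mathbb{E}_\xi\|\mathbf{F}'(x,\xi)-\mathbf{F}'(y,\xi)\|_F^2\le L_F^2\|x-y\|^2,\quad \mathbb{E}_\xi\|\mathbf{F}(x,\xi)-F(x)\|^2\le\sigma_F^2,\quad \mathbb{E}_\xi\|\mathbf{F}'(x,\xi)-F'(x)\|_F^2\le\sigma_J^2,\quad \mathbb{E}_\xi\|\mathbf{F}'(x,\xi)\|^2\le M_F^2 .$$ Moreover $\|y\|\le M_\psi$ for all $y\in\mathrm{dom}\,\psi$, where $M_\psi\in(0,\infty)$, and $\psi$ is $1$-strongly convex. **Algorithm.** Let $b,\hat b_0\ge1$ be integers and $c_0>0$ be such that $c_0b$ and $c_0\hat b_0$ are integers. Initial mini-batches $\mathcal{B}^0,\hat{\mathcal{B}}^0$ have sizes $c_0\hat b_0$ and $\hat b_0$; for $t\ge1$ the mini-batches $\mathcal{B}^1_t,\mathcal{B}^2_t$ have size $c_0b$ and $\hat{\mathcal{B}}^1_t,\hat{\mathcal{B}}^2_t$ have size $b$. Each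 mini-batch consists of i.i.d. copies of $\xi$, and the four mini-batches of iteration $t$ are jointly independent of all earlier ones, but mini-batches of the same iteration (and the two initial ones) may be dependent. Let $\kappa=1$ if $\mathcal{B}^1_t$ and $\mathcal{B}^2_t$ are independent for all $t\ge1$ and $\kappa=2$ otherwise, and define $\hat\kappa$ likewise with $\hat{\mathcal{B}}^1_t,\hat{\mathcal{B}}^2_t$. Put $$L=L_FM_\psi\|K\|+M_F^2\|K\|^2,\qquad P=\frac{\sqrt{26}\,\|K\|}{3\sqrt{c_0}}\sqrt{\kappa M_F^4\|K\|^2+c_0\hat\kappa L_F^2M_\psi^2},$$ $$Q=\frac{26}{9c_0}\|K\|^2\big(\kappa M_F^2\|K\|^2\sigma_F^2+c_0\hat\kappa M_\psi^2\sigma_J^2\big),$$ $$\beta_t=1-\frac1{(t+2)^{2/3}},\qquad \theta_t=\frac{L\sqrt b}{P(t+2)^{1/3}},\qquad \eta_t=\frac{2}{L(3+\theta_t)},$$ and suppose that $\theta_0\in(0,1]$. Given $x_0\in\mathrm{dom}\,\Psi_0$, let $\tilde F_0$ and $\tilde J_0$ be the averages of $\mathbf{F}(x_0,\cdot)$ over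 $\mathcal{B}^0$ and of $\mathbf{F}'(x_0,\cdot)$ over $\hat{\mathcal{B}}^0$, and for $t\ge1$ $$\tilde F_t=\beta_{t-1}\tilde F_{t-1}+\frac{\beta_{t-1}}{c_0b}\sum_{\xi_i\in\mathcal{B}^1_t}\big[\mathbf{F}(x_t,\xi_i)-\mathbf{F}(x_{t-1},\xi_i)\big]+\frac{1-\beta_{t-1}}{c_0b}\sum_{\zeta_i\in\mathcal{B}^2_t}\mathbf{F}(x_t,\zeta_i),$$ $$\tilde J_t=\beta_{t-1}\tilde J_{t-1}+\frac{\beta_{t-1}}{b}\sum_{\xi_i\in\hat{\mathcal{B}}^1_t}\big[\mathbf{F}'(x_t,\xi_i)-\mathbf{F}'(x_{t-1},\xi_i)\big]+\frac{1-\beta_{t-1}}{b}\sum_{\zeta_i\in\hat{\mathcal{B}}^2_t}\mathbf{F}'(x_t,\zeta_i).$$ For $t\ge0$ let $y_t$ be the maximizer of $y\mapsto\langle K^\top\tilde F_t,y\rangle-\psi(y)$, $v_t=\tilde J_t^\top Ky_t$, $\hat x_{t+1}=\mathrm{prox}_{\eta_t\mathcal{R}}(x_t-\eta_tv_t)$ and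 $x_{t+1}=(1-\theta_t)x_t+\theta_t\hat x_{t+1}$. **Theorem.** For every $T\ge0$, if $(\bar x_T,\bar\eta_T)=(x_\tau,\eta_\tau)$ with a random index $\tau\in\{0,\dots,T\}$ that is independent of the mini-batches used up to iteration $T$ and satisfies $\mathrm{Prob}\{\tau=t\}=\theta_t/\sum_{s=0}^T\theta_s$, then $\|\mathcal{G}_{\bar\eta_T}(\bar x_T)\|^2$ is integrable and $$\mathbb{E}\|\mathcal{G}_{\bar\eta_T}(\bar x_T)\|^2\le\frac{32P\,[\Psi_0(x_0)-\Psi_0^\star]}{3\sqrt b\,\big[(T+3)^{2/3}-2^{2/3}\big]}+\frac{32Q}{3\big[(T+3)^{2/3}-2^{2/3}\big]}\left[\frac{2^{1/3}}{\hat b_0}+\frac{2(1+\log(T+1))}{b}\right].$$ This is of order $(1+\log T)/T^{2/3}$ for arbitrary fixed $b$ and $\hat b_0$ (for example $b=\hat b_0=1$, when admissible), so no large initial batch is required. -/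

import Mathlib

open MeasureTheory ProbabilityTheory

namespace HybridSGD

noncomputable section

/-- The Euclidean space of dimension `d`. -/
abbrev Euc (d : ℕ) : Type := EuclideanSpace ℝ (Fin d)

/-! ### Convex analysis with values in the extended reals -/

section Convex

variable {d : ℕ}

/-- The effective domain of an extended-real-valued function. -/
def dom (f : Euc d → EReal) : Set (Euc d) := {x | f x < ⊤}

/-- Proper, closed (lower semicontinuous) and convex functions with values in `ℝ ∪ {+∞}`. -/
structure IsProperClosedConvex (f : Euc d → EReal) : Prop where
  ne_bot : ∀ x, f x ≠ ⊥
  proper : (dom f).Nonempty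
  closed : LowerSemicontinuous f
  convex : ConvexOn ℝ (dom f) (fun x => (f x).toReal)

/-- The Fenchel conjugate. -/
def conjugate (f : Euc d → EReal) (z : Euc d) : EReal :=
  ⨆ y, (((inner ℝ z y : ℝ) : EReal) - f y)

/-- `y` is a maximizer of `y ↦ ⟪z, y⟫ - f y`. -/
def IsDualSolution (f : Euc d → EReal) (z y : Euc d) : Prop :=
  ∀ y', ((inner ℝ z y' : ℝ) : EReal) - f y' ≤ ((inner ℝ z y : ℝ) : EReal) - f y

/-- `u` is a minimizer of `u ↦ f u + ‖u - z‖² / (2 η)`. -/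
def IsProxPoint (f : Euc d → EReal) (η : ℝ) (z u : Euc d) : Prop :=
  ∀ u', f u + ((‖u - z‖ ^ 2 / (2 * η) : ℝ) : EReal)
    ≤ f u' + ((‖u' - z‖ ^ 2 / (2 * η) : ℝ) : EReal)

/-- The proximal operator of `η f` (for `η > 0` and `f` proper, closed and convex, the minimizer
exists and is unique). -/
def prox (f : Euc d → EReal) (η : ℝ) (z : Euc d) : Euc d :=
  Classical.epsilon (IsProxPoint f η z)

end Convex

/-- The squared Euclidean (Frobenius) norm of a linear map, that is, the sum of the squares of the
entries of its matrix. -/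
def frobSq {p q : ℕ} (A : Euc p →L[ℝ] Euc q) : ℝ :=
  ∑ i : Fin p, ‖A (EuclideanSpace.single i 1)‖ ^ 2

/-! ### The minimax problem -/

/-- The data of the problem
`min_x max_y  R x + 𝔼_ξ ⟪K y, F(x, ξ)⟫ - ψ y`, where `ξ` has law `P`. -/
structure Problem (p q n : ℕ) (S : Type*) [MeasurableSpace S] where
  P : Measure S
  F : Euc p → S → Euc q
  K : Euc n →L[ℝ] Euc q
  ψ : Euc n → EReal
  R : Euc p → EReal

namespace Problem

variable {p q n : ℕ} {S : Type*} [MeasurableSpace S] (M : Problem p q n S)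

/-- The expectation function `F(x) = 𝔼_ξ F(x, ξ)`. -/
def mean (x : Euc p) : Euc q := ∫ ξ, M.F x ξ ∂M.P

/-- The Jacobian `F'(x, ξ)` of `F(·, ξ)`. -/
def jac (x : Euc p) (ξ : S) : Euc p →L[ℝ] Euc q := fderiv ℝ (fun z => M.F z ξ) x

/-- The Jacobian `F'(x)` of the expectation function. -/
def meanJac (x : Euc p) : Euc p →L[ℝ] Euc q := fderiv ℝ M.mean x

/-- `φ₀(u) = max_y ⟪Kᵀ u, y⟫ - ψ y = ψ^*(Kᵀ u)`. -/
def phi (u : Euc q) : EReal := conjugate M.ψ (M.K.adjoint u)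

/-- The smooth part `Φ₀(x) = φ₀(F(x))` of the objective, as a real number. -/
def Phi (x : Euc p) : ℝ := (M.phi (M.mean x)).toReal

/-- The objective `Ψ₀(x) = φ₀(F(x)) + R(x)`. -/
def Psi (x : Euc p) : EReal := M.phi (M.mean x) + M.R x

/-- The optimal value `Ψ₀^⋆ = inf_x Ψ₀(x)`. -/
def PsiStar : EReal := ⨅ x, M.Psi x

/-- The gradient mapping
`𝒢_η(x) = (x - prox_{η R}(x - η ∇Φ₀(x))) / η`. -/
def gradMap (η : ℝ) (x : Euc p) : Euc p :=
  η⁻¹ • (x - prox M.R η (x - η • gradient M.Phi x))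

/-- What is taken for granted throughout: `ξ` is a random variable, `F` is a random vector function
with a well-defined expectation, the Jacobians `F'(x, ξ)` and `F'(x)` exist on `dom Ψ₀`, `R` is
proper, closed and convex, and the optimal value is not `-∞`. -/
structure Standing : Prop where
  isProb : IsProbabilityMeasure M.P
  measurable_F : Measurable (fun z : Euc p × S => M.F z.1 z.2)
  integrable_F : ∀ x, Integrable (M.F x) M.P
  differentiable_F : ∀ ξ, ∀ x ∈ dom M.Psi, DifferentiableAt ℝ (fun z => M.F z ξ) x
  differentiable_mean : ∀ x ∈ dom M.Psi, DifferentiableAt ℝ M.mean x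
  R_convex : IsProperClosedConvex M.R
  bounded_below : ⊥ < M.PsiStar

/-- Average smoothness, bounded variance and average Lipschitz continuity of `F`. -/
structure SmoothBoundedVariance (LF σF σJ MF : ℝ) : Prop where
  LF_pos : 0 < LF
  σF_pos : 0 < σF
  σJ_pos : 0 < σJ
  MF_pos : 0 < MF
  smooth : ∀ x ∈ dom M.Psi, ∀ y ∈ dom M.Psi,
    Integrable (fun ξ => frobSq (M.jac x ξ - M.jac y ξ)) M.P ∧
      ∫ ξ, frobSq (M.jac x ξ - M.jac y ξ) ∂M.P ≤ LF ^ 2 * ‖x - y‖ ^ 2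
  variance_F : ∀ x ∈ dom M.Psi,
    Integrable (fun ξ => ‖M.F x ξ - M.mean x‖ ^ 2) M.P ∧
      ∫ ξ, ‖M.F x ξ - M.mean x‖ ^ 2 ∂M.P ≤ σF ^ 2
  variance_jac : ∀ x ∈ dom M.Psi,
    Integrable (fun ξ => frobSq (M.jac x ξ - M.meanJac x)) M.P ∧
      ∫ ξ, frobSq (M.jac x ξ - M.meanJac x) ∂M.P ≤ σJ ^ 2
  lipschitz : ∀ x ∈ dom M.Psi,
    Integrable (fun ξ => ‖M.jac x ξ‖ ^ 2) M.P ∧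
      ∫ ξ, ‖M.jac x ξ‖ ^ 2 ∂M.P ≤ MF ^ 2

/-- `ψ` is proper, closed and convex, and its domain is bounded by `Mψ`. -/
structure BoundedDualDomain (Mψ : ℝ) : Prop where
  Mψ_pos : 0 < Mψ
  ψ_convex : IsProperClosedConvex M.ψ
  bounded : ∀ y ∈ dom M.ψ, ‖y‖ ≤ Mψ

end Problem

/-! ### Mini-batches -/

/-- The mini-batches of the algorithm: `F0`, `J0` are the two initial batches (sizes `b₀`, `b₀'`),
and, for `t ≥ 1`, `F1 t`, `F2 t` (sizes `b₁`, `b₂`) are used for the function values and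
`J1 t`, `J2 t` (sizes `b₁'`, `b₂'`) for the Jacobians. The values at `t = 0` of the last four are
never used. -/
structure Batches (Ω S : Type*) (b₀ b₀' b₁ b₂ b₁' b₂' : ℕ) where
  F0 : Ω → Fin b₀ → S
  J0 : Ω → Fin b₀' → S
  F1 : ℕ → Ω → Fin b₁ → S
  F2 : ℕ → Ω → Fin b₂ → S
  J1 : ℕ → Ω → Fin b₁' → S
  J2 : ℕ → Ω → Fin b₂' → S

namespace Batches

variable {Ω S : Type*} [MeasurableSpace S]
  {b₀ b₀' b₁ b₂ b₁' b₂' : ℕ} (B : Batches Ω S b₀ b₀' b₁ b₂ b₁' b₂')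

/-- The σ-field generated by the four mini-batches of iteration `t`. -/
abbrev round (t : ℕ) : MeasurableSpace Ω :=
  MeasurableSpace.comap (B.F1 t) inferInstance ⊔ MeasurableSpace.comap (B.F2 t) inferInstance ⊔
    MeasurableSpace.comap (B.J1 t) inferInstance ⊔ MeasurableSpace.comap (B.J2 t) inferInstance

/-- The σ-field `ℱ_t` generated by the algorithm up to iteration `t`. -/
abbrev history (t : ℕ) : MeasurableSpace Ω :=
  MeasurableSpace.comap B.F0 inferInstance ⊔ MeasurableSpace.comap B.J0 inferInstance ⊔
    ⨆ s ∈ Set.Icc 1 t, B.round s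

/-- Each mini-batch consists of independent samples of law `P`, and the mini-batches of an iteration
are drawn independently of the past. Mini-batches of one iteration (or the two initial ones)
may depend on each other in an arbitrary way. -/
structure IsSampling [MeasurableSpace Ω] (P : Measure S) (μ : Measure Ω) : Prop where
  measurable_F0 : Measurable B.F0
  measurable_J0 : Measurable B.J0
  measurable_F1 : ∀ t, 1 ≤ t → Measurable (B.F1 t)
  measurable_F2 : ∀ t, 1 ≤ t → Measurable (B.F2 t)
  measurable_J1 : ∀ t, 1 ≤ t → Measurable (B.J1 t)
  measurable_J2 : ∀ t, 1 ≤ t → Measurable (B.J2 t)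
  law_F0 : μ.map B.F0 = Measure.pi (fun _ => P)
  law_J0 : μ.map B.J0 = Measure.pi (fun _ => P)
  law_F1 : ∀ t, 1 ≤ t → μ.map (B.F1 t) = Measure.pi (fun _ => P)
  law_F2 : ∀ t, 1 ≤ t → μ.map (B.F2 t) = Measure.pi (fun _ => P)
  law_J1 : ∀ t, 1 ≤ t → μ.map (B.J1 t) = Measure.pi (fun _ => P)
  law_J2 : ∀ t, 1 ≤ t → μ.map (B.J2 t) = Measure.pi (fun _ => P)
  fresh : ∀ t, Indep (B.round (t + 1)) (B.history t) μ

open Classical in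
/-- `κ = 1` if the batches `F1 t` and `F2 t` are independent (at every iteration), and `κ = 2`
otherwise. -/
def kappaF [MeasurableSpace Ω] (μ : Measure Ω) : ℝ :=
  if ∀ t, 1 ≤ t → IndepFun (B.F1 t) (B.F2 t) μ then 1 else 2

open Classical in
/-- `κ̂ = 1` if the batches `J1 t` and `J2 t` are independent (at every iteration), and `κ̂ = 2`
otherwise. -/
def kappaJ [MeasurableSpace Ω] (μ : Measure Ω) : ℝ :=
  if ∀ t, 1 ≤ t → IndepFun (B.J1 t) (B.J2 t) μ then 1 else 2

end Batches

/-! ### The algorithm -/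

/-- `(x, x̂, F̃, J̃, y)` are generated by the hybrid variance-reduced method without smoothing
(`γ_t = 0`), with weights `β_t` (function values) and `βJ_t` (Jacobians), step-sizes `θ_t` and
`η_t`, and starting point `x₀`. Here `v_t = J̃_tᵀ K y_t`. -/
structure IsRun {p q n : ℕ} {S : Type*} [MeasurableSpace S] (M : Problem p q n S)
    {Ω : Type*} {b₀ b₀' b₁ b₂ b₁' b₂' : ℕ} (B : Batches Ω S b₀ b₀' b₁ b₂ b₁' b₂')
    (β βJ θ η : ℕ → ℝ) (x₀ : Euc p)
    (x xhat : ℕ → Ω → Euc p) (Ft : ℕ → Ω → Euc q) (Jt : ℕ → Ω → Euc p →L[ℝ] Euc q)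
    (y : ℕ → Ω → Euc n) : Prop where
  x_zero : ∀ ω, x 0 ω = x₀
  Ft_zero : ∀ ω, Ft 0 ω = (1 / (b₀ : ℝ)) • ∑ i, M.F (x 0 ω) (B.F0 ω i)
  Jt_zero : ∀ ω, Jt 0 ω = (1 / (b₀' : ℝ)) • ∑ i, M.jac (x 0 ω) (B.J0 ω i)
  Ft_succ : ∀ t ω, Ft (t + 1) ω = β t • Ft t ω
    + (β t / (b₁ : ℝ)) •
        ∑ i, (M.F (x (t + 1) ω) (B.F1 (t + 1) ω i) - M.F (x t ω) (B.F1 (t + 1) ω i))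
    + ((1 - β t) / (b₂ : ℝ)) • ∑ i, M.F (x (t + 1) ω) (B.F2 (t + 1) ω i)
  Jt_succ : ∀ t ω, Jt (t + 1) ω = βJ t • Jt t ω
    + (βJ t / (b₁' : ℝ)) •
        ∑ i, (M.jac (x (t + 1) ω) (B.J1 (t + 1) ω i) - M.jac (x t ω) (B.J1 (t + 1) ω i))
    + ((1 - βJ t) / (b₂' : ℝ)) • ∑ i, M.jac (x (t + 1) ω) (B.J2 (t + 1) ω i)
  dual : ∀ t ω, IsDualSolution M.ψ (M.K.adjoint (Ft t ω)) (y t ω)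
  xhat_succ : ∀ t ω, xhat (t + 1) ω =
    prox M.R (η t) (x t ω - η t • (Jt t ω).adjoint (M.K (y t ω)))
  x_succ : ∀ t ω, x (t + 1) ω = (1 - θ t) • x t ω + θ t • xhat (t + 1) ω

/-! ### Constants and parameters -/

/-- The constant `P`; `k` stands for `‖K‖`. -/
def constP (k κ κJ c₀ LF MF Mψ : ℝ) : ℝ :=
  Real.sqrt 26 * k / (3 * Real.sqrt c₀) *
    Real.sqrt (κ * MF ^ 4 * k ^ 2 + c₀ * κJ * LF ^ 2 * Mψ ^ 2)

/-- The constant `Q`; `k` stands for `‖K‖`. -/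
def constQ (k κ κJ c₀ MF Mψ σF σJ : ℝ) : ℝ :=
  26 / (9 * c₀) * k ^ 2 * (κ * MF ^ 2 * k ^ 2 * σF ^ 2 + c₀ * κJ * Mψ ^ 2 * σJ ^ 2)

/-- The smoothness constant `L_{Φ₀}`; `k` stands for `‖K‖`. -/
def constL (k LF MF Mψ : ℝ) : ℝ := LF * Mψ * k + MF ^ 2 * k ^ 2

/-- The weights `β_t = 1 - (t + 2)^{-2/3}`. -/
def weight (t : ℕ) : ℝ := 1 - 1 / ((t : ℝ) + 2) ^ (2 / 3 : ℝ)

/-- The step-sizes `θ_t = L √b / (P (t + 2)^{1/3})`. -/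
def stepTheta (L P b : ℝ) (t : ℕ) : ℝ :=
  L * Real.sqrt b / (P * ((t : ℝ) + 2) ^ (1 / 3 : ℝ))

/-- The step-sizes `η_t = 2 / (L (3 + θ_t))`. -/
def stepEta (L : ℝ) (θ : ℕ → ℝ) (t : ℕ) : ℝ := 2 / (L * (3 + θ t))

end

end HybridSGD

open HybridSGD

/-! The method is an inexact proximal gradient scheme whose gradient error is controlled by a
Lyapunov argument. Let `D_t` be the expected squared length of `x̂_{t+1} - x_t`, and `E_t` the
expectation of `errBound`, a weighted sum of the squared errors of the two estimates that dominates
the squared error of `v_t`.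

Three inequalities carry the proof. Strong convexity of `ψ` makes its conjugate differentiable with
a 1-Lipschitz gradient, so `Φ₀` is `L`-smooth on the domain. One step then decreases `Ψ₀` by
`θ_t/(16L)` times the squared gradient mapping plus `Lθ_t/2` times the squared step, up to
`5θ_t/(8L)` times the squared gradient error (`Psi_step_le`). With the past frozen, the new error of
a hybrid estimate is `β_t` times the old one plus centered mini-batch noise, so `E_{t+1}` is at most
`β_t² E_t + (9/13)(β_t² P² θ_t² D_t / b + (1-β_t)² Q / b)` (`lintegral_hybridUpdate_le`,
`error_recursion_arith`). Finally, `s_t = (t+2)^{1/3}` satisfies `s_{t+1} β_t² + 1/s_t ≤ s_t`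
(`cbrtShift_lyapunov`).

In the potential `𝔼Ψ₀(x_t) - Ψ₀^⋆ + (√b/P)(5/8) s_t E_t` the gain `1/s_t` pays for the error term of
the descent inequality and `Lθ_t/2 · D_t` pays for the movement term of the recursion; only noise of
order `1/(t+1)` remains (`lyapunov_step`). Summing gives a logarithm, and dividing by `∑ θ_t`, of
order `T^{2/3}`, gives the rate. The starting error enters with the bounded weight `s_0`, so it
needs no large batch.

The assumptions hold only on `dom Ψ₀`, which may have empty interior. There the mean of the sampled
Jacobians is identified with `F'(x)` only along the direction space `tangent` of the affine hull.
This is enough: differences of iterates and of prox points are tangent, so gradient errors are only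
tested against tangent vectors and Jacobians are compared after `restrictVec`. -/

namespace HybridSGD

/-! ### Minimizers, quadratic growth and the proximal operator. -/

section ConvexAnalysis

open Filter Topology

variable {d : ℕ} {f : Euc d → EReal}

lemma IsProperClosedConvex.coe_toReal (hf : IsProperClosedConvex f) {x : Euc d} (hx : x ∈ dom f) :
    ((f x).toReal : EReal) = f x :=
  EReal.coe_toReal (ne_of_lt hx) (hf.ne_bot x)

lemma eq_top_of_notMem_dom {x : Euc d} (hx : x ∉ dom f) : f x = ⊤ :=
  not_lt_top_iff.1 hx

/-- The sum stays lower semicontinuous because `f` never takes the value `⊥` and `g` is finite, so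
addition in `EReal` is continuous at every pair that occurs; compactness does the rest. -/
lemma IsProperClosedConvex.exists_isMinOn_add (hf : IsProperClosedConvex f) {g : Euc d → ℝ}
    (hg : Continuous g) {C : Set (Euc d)} (hC : IsCompact C) (hne : C.Nonempty) :
    ∃ u ∈ C, ∀ u' ∈ C, f u + (g u : EReal) ≤ f u' + (g u' : EReal) := by
  have hlsc : LowerSemicontinuous (fun u => f u + (g u : EReal)) :=
    LowerSemicontinuous.add' hf.closed
      (continuous_coe_real_ereal.comp hg).lowerSemicontinuous
      (fun x => EReal.continuousAt_add (Or.inr (EReal.coe_ne_bot _)) (Or.inl (hf.ne_bot x)))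
  obtain ⟨u, hu, h⟩ := (hlsc.lowerSemicontinuousOn C).exists_isMinOn hne hC
  exact ⟨u, hu, fun u' hu' => h hu'⟩

/-- A strongly convex function grows quadratically away from its minimizer. -/
lemma StrongConvexOn.add_sq_le {E : Type*} [NormedAddCommGroup E] [NormedSpace ℝ E] {s : Set E}
    {m : ℝ} {g : E → ℝ} (hg : StrongConvexOn s m g) {u : E} (hu : u ∈ s)
    (hmin : ∀ w ∈ s, g u ≤ g w) {w : E} (hw : w ∈ s) :
    g u + m / 2 * ‖u - w‖ ^ 2 ≤ g w := by
  -- Compare the minimizer with the point at parameter `a` on the segment to `w`, divide by `a`, and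
  -- let `a` tend to zero.
  have key : ∀ a ∈ Set.Ioo (0 : ℝ) 1, g u + (1 - a) * (m / 2 * ‖u - w‖ ^ 2) ≤ g w := by
    intro a ha
    have h1 := hg.2 hu hw (sub_nonneg.2 ha.2.le) ha.1.le (by ring : (1 - a) + a = 1)
    have h2 := hmin _ (hg.1 hu hw (sub_nonneg.2 ha.2.le) ha.1.le (by ring : (1 - a) + a = 1))
    simp only [smul_eq_mul] at h1
    have h3 : a * (g u + (1 - a) * (m / 2 * ‖u - w‖ ^ 2)) ≤ a * g w := by nlinarith
    exact le_of_mul_le_mul_left h3 ha.1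
  have hlim : Tendsto (fun a : ℝ => g u + (1 - a) * (m / 2 * ‖u - w‖ ^ 2)) (𝓝[>] 0)
      (𝓝 (g u + (1 - 0) * (m / 2 * ‖u - w‖ ^ 2))) := by
    apply Tendsto.mono_left _ nhdsWithin_le_nhds
    exact Continuous.tendsto (by fun_prop) 0
  have := le_of_tendsto hlim (Filter.eventually_of_mem (Ioo_mem_nhdsGT one_pos) key)
  simpa using this

/-- The squared distance satisfies the strong convexity inequality with equality, so the quadratic
contributes its modulus exactly. -/
lemma convexOn_add_sq_strongConvexOn {s : Set (Euc d)} {g : Euc d → ℝ} (hg : ConvexOn ℝ s g)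
    (c : ℝ) (z : Euc d) :
    StrongConvexOn s c (fun u => g u + c / 2 * ‖u - z‖ ^ 2) := by
  refine ⟨hg.1, fun u hu w hw a b ha hb hab => ?_⟩
  have h1 := hg.2 hu hw ha hb hab
  have h2 : ‖a • u + b • w - z‖ ^ 2 =
      a * ‖u - z‖ ^ 2 + b * ‖w - z‖ ^ 2 - a * b * ‖u - w‖ ^ 2 := by
    have e1 : a • u + b • w - z = a • (u - z) + b • (w - z) := by
      rw [smul_sub, smul_sub]
      have : z = a • z + b • z := by rw [← add_smul, hab, one_smul]
      nth_rewrite 1 [this]; abel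
    have e2 : u - w = (u - z) - (w - z) := by abel
    rw [e1, e2]
    generalize u - z = s
    generalize w - z = t
    rw [norm_add_sq_real, norm_sub_sq_real, norm_smul, norm_smul, mul_pow, mul_pow,
      inner_smul_left, inner_smul_right, Real.norm_eq_abs, Real.norm_eq_abs, sq_abs, sq_abs]
    obtain rfl : b = 1 - a := by linarith
    simp
    ring
  simp only [smul_eq_mul] at h1 ⊢
  rw [h2]
  nlinarith

/-- A proper, closed, convex function decreases at most linearly. -/
lemma IsProperClosedConvex.exists_linear_lower_bound (hf : IsProperClosedConvex f) {x₀ : Euc d}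
    (hx₀ : x₀ ∈ dom f) : ∃ c : ℝ, 0 ≤ c ∧ ∀ u ∈ dom f, -(c * (1 + ‖u - x₀‖)) ≤ (f u).toReal := by
  obtain ⟨w, hwB, hw⟩ := hf.exists_isMinOn_add (g := fun _ => 0) continuous_const
    (isCompact_closedBall x₀ 1) ⟨x₀, by simp⟩
  simp only [EReal.coe_zero, add_zero] at hw
  have hwd : w ∈ dom f := lt_of_le_of_lt (hw x₀ (by simp)) hx₀
  have hm : ∀ u ∈ dom f, ‖u - x₀‖ ≤ 1 → (f w).toReal ≤ (f u).toReal := fun u hu h =>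
    EReal.toReal_le_toReal (hw u (by simpa [dist_eq_norm] using h)) (hf.ne_bot w) (ne_of_lt hu)
  refine ⟨|(f w).toReal| + |(f x₀).toReal|, by positivity, fun u hu => ?_⟩
  have a1 := neg_abs_le (f w).toReal
  have a2 := le_abs_self (f x₀).toReal
  have a3 := abs_nonneg (f w).toReal
  have a4 := abs_nonneg (f x₀).toReal
  have a5 := norm_nonneg (u - x₀)
  rcases le_or_gt ‖u - x₀‖ 1 with h | h
  · have := hm u hu h
    nlinarith [mul_nonneg (add_nonneg a3 a4) a5]
  -- Outside the unit ball, the point of the segment from `x₀` to `u` at distance one from `x₀` has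
  -- value at least `f w`; convexity turns this into `f u ≥ r f w - (r - 1) f x₀`.
  · set r := ‖u - x₀‖ with hr
    have hr0 : 0 < r := by linarith
    have hri : r⁻¹ ≤ 1 := inv_le_one_of_one_le₀ h.le
    have hc := hf.convex.2 hx₀ hu (sub_nonneg.2 hri) (inv_nonneg.2 hr0.le)
      (by ring : (1 - r⁻¹) + r⁻¹ = 1)
    have hv := hf.convex.1 hx₀ hu (sub_nonneg.2 hri) (inv_nonneg.2 hr0.le)
      (by ring : (1 - r⁻¹) + r⁻¹ = 1)
    have hd : ‖(1 - r⁻¹) • x₀ + r⁻¹ • u - x₀‖ ≤ 1 := by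
      have : (1 - r⁻¹) • x₀ + r⁻¹ • u - x₀ = r⁻¹ • (u - x₀) := by module
      rw [this, norm_smul, Real.norm_eq_abs, abs_of_pos (inv_pos.2 hr0), ← hr,
        inv_mul_cancel₀ hr0.ne']
    have h1 := (hm _ hv hd).trans hc
    simp only [smul_eq_mul] at h1
    have h2 := mul_le_mul_of_nonneg_left h1 hr0.le
    have h3 : r * ((1 - r⁻¹) * (f x₀).toReal + r⁻¹ * (f u).toReal) =
        (r - 1) * (f x₀).toReal + (f u).toReal := by field_simp
    rw [h3] at h2
    nlinarith

/-- The quadratic beats the linear lower bound on `f`, so it suffices to minimize over a large ball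
around a point of the domain. -/
lemma IsProperClosedConvex.exists_isProxPoint (hf : IsProperClosedConvex f) {η : ℝ} (hη : 0 < η)
    (z : Euc d) : ∃ u, IsProxPoint f η z u := by
  obtain ⟨x₀, hx₀⟩ := hf.proper
  obtain ⟨c, hc, hlow⟩ := hf.exists_linear_lower_bound hx₀
  set s := ‖x₀ - z‖ with hs
  set D := c + s ^ 2 / (2 * η) + |(f x₀).toReal| + s ^ 2 / (2 * η) with hD
  -- For `r > ρ` the first summand gives `r²/(4η) ≥ r(c + 1)`: the part `rc` absorbs the linear
  -- decrease of `f`, and the remaining `r > D` absorbs all constants.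
  set ρ := 4 * η * (c + 1) + D with hρ
  have hD0 : 0 ≤ D := by positivity
  have hρ0 : 0 ≤ ρ := by positivity
  have hcont : Continuous (fun u : Euc d => ‖u - z‖ ^ 2 / (2 * η)) := by fun_prop
  obtain ⟨u, hu, hmin⟩ := hf.exists_isMinOn_add hcont (isCompact_closedBall x₀ ρ) ⟨x₀, by simpa⟩
  refine ⟨u, fun u' => ?_⟩
  by_cases hu' : u' ∈ Metric.closedBall x₀ ρ
  · exact hmin u' hu'
  refine (hmin x₀ (by simpa)).trans ?_
  by_cases hud : u' ∈ dom f
  · rw [← hf.coe_toReal hud, ← hf.coe_toReal hx₀, ← EReal.coe_add, ← EReal.coe_add,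
      EReal.coe_le_coe_iff]
    have h1 := hlow u' hud
    set r := ‖u' - x₀‖ with hr
    have hrρ : ρ < r := by simpa [dist_eq_norm] using hu'
    have h2 : r ≤ ‖u' - z‖ + s := by
      have := norm_sub_le (u' - z) (x₀ - z)
      simpa [hr, hs] using this
    have h3 : r ^ 2 / 2 - s ^ 2 ≤ ‖u' - z‖ ^ 2 := by
      nlinarith [norm_nonneg (u' - z), norm_nonneg (x₀ - z), sq_nonneg (‖u' - z‖ - s)]
    have h4 : r * (c + 1) ≤ r ^ 2 / (4 * η) := by
      rw [le_div_iff₀ (by positivity)]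
      nlinarith
    have h5 : r ^ 2 / (4 * η) - s ^ 2 / (2 * η) ≤ ‖u' - z‖ ^ 2 / (2 * η) := by
      have := div_le_div_of_nonneg_right h3 (by positivity : 0 ≤ 2 * η)
      refine le_trans (le_of_eq ?_) this
      field_simp
      ring
    have h6 := le_abs_self (f x₀).toReal
    have h7 : 0 ≤ 4 * η * (c + 1) := by positivity
    nlinarith
  · rw [eq_top_of_notMem_dom hud, EReal.top_add_coe]
    exact le_top

lemma IsProperClosedConvex.isProxPoint_prox (hf : IsProperClosedConvex f) {η : ℝ} (hη : 0 < η)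
    (z : Euc d) : IsProxPoint f η z (prox f η z) :=
  Classical.epsilon_spec (hf.exists_isProxPoint hη z)

lemma IsProperClosedConvex.prox_mem_dom (hf : IsProperClosedConvex f) {η : ℝ} (hη : 0 < η)
    (z : Euc d) : prox f η z ∈ dom f := by
  obtain ⟨x₀, hx₀⟩ := hf.proper
  by_contra h
  have h1 := hf.isProxPoint_prox hη z x₀
  rw [eq_top_of_notMem_dom h, EReal.top_add_coe, ← hf.coe_toReal hx₀, ← EReal.coe_add,
    top_le_iff] at h1
  exact EReal.coe_ne_top _ h1

/-- The prox objective is `η⁻¹`-strongly convex, so quadratic growth at its minimizer supplies the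
third term on the left. -/
lemma IsProperClosedConvex.prox_le (hf : IsProperClosedConvex f) {η : ℝ} (hη : 0 < η)
    (z : Euc d) {w : Euc d} (hw : w ∈ dom f) :
    (f (prox f η z)).toReal + ‖prox f η z - z‖ ^ 2 / (2 * η) + ‖prox f η z - w‖ ^ 2 / (2 * η)
      ≤ (f w).toReal + ‖w - z‖ ^ 2 / (2 * η) := by
  have h := StrongConvexOn.add_sq_le (convexOn_add_sq_strongConvexOn hf.convex η⁻¹ z)
    (hf.prox_mem_dom hη z) (fun v hv => ?_) hw
  · convert h using 1
    · field_simp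
    · field_simp
  · have h1 := hf.isProxPoint_prox hη z v
    rw [← hf.coe_toReal hv, ← hf.coe_toReal (hf.prox_mem_dom hη z), ← EReal.coe_add,
      ← EReal.coe_add, EReal.coe_le_coe_iff] at h1
    convert h1 using 1
    · field_simp
    · field_simp

/-- The proximal operator is firmly nonexpansive. -/
lemma IsProperClosedConvex.norm_prox_sub_sq_le (hf : IsProperClosedConvex f) {η : ℝ} (hη : 0 < η)
    (z z' : Euc d) :
    ‖prox f η z - prox f η z'‖ ^ 2 ≤ inner ℝ (prox f η z - prox f η z') (z - z') := by
  have h1 := hf.prox_le hη z (hf.prox_mem_dom hη z')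
  have h2 := hf.prox_le hη z' (hf.prox_mem_dom hη z)
  set u := prox f η z
  set u' := prox f η z'
  -- Adding the two prox inequalities, each tested at the other prox point, cancels the values of
  -- `f`.
  have h3 : ‖u - z‖ ^ 2 + ‖u - u'‖ ^ 2 + ‖u' - z'‖ ^ 2 + ‖u' - u‖ ^ 2 ≤
      ‖u' - z‖ ^ 2 + ‖u - z'‖ ^ 2 := by
    have : (‖u - z‖ ^ 2 + ‖u - u'‖ ^ 2 + ‖u' - z'‖ ^ 2 + ‖u' - u‖ ^ 2) / (2 * η) ≤
        (‖u' - z‖ ^ 2 + ‖u - z'‖ ^ 2) / (2 * η) := by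
      simp only [add_div]
      linarith
    exact (div_le_div_iff_of_pos_right (by positivity)).1 this
  simp only [norm_sub_sq_real, inner_sub_left, inner_sub_right, real_inner_comm u u'] at h3 ⊢
  linarith [real_inner_comm u u']

lemma IsProperClosedConvex.continuous_prox (hf : IsProperClosedConvex f) {η : ℝ} (hη : 0 < η) :
    Continuous (prox f η) := by
  have : LipschitzWith 1 (prox f η) := LipschitzWith.of_dist_le_mul fun z z' => by
    rw [dist_eq_norm, dist_eq_norm, NNReal.coe_one, one_mul]
    have h1 := hf.norm_prox_sub_sq_le hη z z'
    have h2 := real_inner_le_norm (prox f η z - prox f η z') (z - z')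
    by_contra! h
    nlinarith [norm_nonneg (z - z')]
  exact this.continuous

end ConvexAnalysis

/-! ### The conjugate of a strongly convex function with bounded domain. -/

section Conjugate

open Filter Topology

variable {d : ℕ} {f : Euc d → EReal}

/-- A maximizer of `y ↦ ⟪z, y⟫ - f y`. -/
noncomputable def dualPoint (f : Euc d → EReal) (z : Euc d) : Euc d :=
  Classical.epsilon (IsDualSolution f z)

lemma IsDualSolution.mem_dom (hf : IsProperClosedConvex f) {z y : Euc d}
    (hy : IsDualSolution f z y) : y ∈ dom f := by
  obtain ⟨x₀, hx₀⟩ := hf.proper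
  by_contra h
  have h1 := hy x₀
  rw [eq_top_of_notMem_dom h, EReal.sub_top, ← hf.coe_toReal hx₀, ← EReal.coe_sub,
    le_bot_iff] at h1
  exact EReal.coe_ne_bot _ h1

lemma IsProperClosedConvex.exists_isDualSolution (hf : IsProperClosedConvex f) {D : ℝ}
    (hD : ∀ y ∈ dom f, ‖y‖ ≤ D) (z : Euc d) : ∃ y, IsDualSolution f z y := by
  obtain ⟨x₀, hx₀⟩ := hf.proper
  obtain ⟨u, hu, hmin⟩ := hf.exists_isMinOn_add (g := fun u => -inner ℝ z u) (by fun_prop)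
    (isCompact_closedBall 0 D) ⟨x₀, by simpa using hD x₀ hx₀⟩
  have hmin' := hmin x₀ (by simpa using hD x₀ hx₀)
  have hud : u ∈ dom f := by
    by_contra h
    rw [eq_top_of_notMem_dom h, EReal.top_add_coe, ← hf.coe_toReal hx₀, ← EReal.coe_add,
      top_le_iff] at hmin'
    exact EReal.coe_ne_top _ hmin'
  refine ⟨u, fun w => ?_⟩
  by_cases hw : w ∈ dom f
  · have h := hmin w (by simpa using hD w hw)
    rw [← hf.coe_toReal hw, ← hf.coe_toReal hud, ← EReal.coe_add, ← EReal.coe_add,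
      EReal.coe_le_coe_iff] at h
    rw [← hf.coe_toReal hw, ← hf.coe_toReal hud, ← EReal.coe_sub, ← EReal.coe_sub,
      EReal.coe_le_coe_iff]
    linarith
  · rw [eq_top_of_notMem_dom hw, EReal.sub_top]
    exact bot_le

lemma IsDualSolution.le_real (hf : IsProperClosedConvex f) {z y : Euc d}
    (hy : IsDualSolution f z y) {w : Euc d} (hw : w ∈ dom f) :
    inner ℝ z w - (f w).toReal ≤ inner ℝ z y - (f y).toReal := by
  have h := hy w
  rwa [← hf.coe_toReal hw, ← hf.coe_toReal (hy.mem_dom hf), ← EReal.coe_sub, ← EReal.coe_sub,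
      EReal.coe_le_coe_iff] at h

/-- A linear term does not change the modulus of strong convexity, so this is quadratic growth for
`f - ⟪z, ·⟫`. -/
lemma IsDualSolution.add_sq_le (hf : IsProperClosedConvex f)
    (hs : StrongConvexOn (dom f) 1 (fun y => (f y).toReal)) {z y : Euc d}
    (hy : IsDualSolution f z y) {w : Euc d} (hw : w ∈ dom f) :
    inner ℝ z w - (f w).toReal + 1 / 2 * ‖y - w‖ ^ 2 ≤ inner ℝ z y - (f y).toReal := by
  have h1 : StrongConvexOn (dom f) 1 (fun y => (f y).toReal - inner ℝ z y) := by
    refine ⟨hs.1, fun u hu v hv a b ha hb hab => ?_⟩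
    have := hs.2 hu hv ha hb hab
    simp only [smul_eq_mul, inner_add_right, inner_smul_right] at this ⊢
    linarith
  have := StrongConvexOn.add_sq_le h1 (hy.mem_dom hf)
    (fun v hv => by linarith [hy.le_real hf hv]) hw
  linarith

/-- Adding the two growth inequalities gives `‖y - y'‖² ≤ ⟪z - z', y - y'⟫`. -/
lemma IsDualSolution.norm_sub_le (hf : IsProperClosedConvex f)
    (hs : StrongConvexOn (dom f) 1 (fun y => (f y).toReal)) {z y z' y' : Euc d}
    (hy : IsDualSolution f z y) (hy' : IsDualSolution f z' y') : ‖y - y'‖ ≤ ‖z - z'‖ := by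
  have h1 := hy.add_sq_le hf hs (hy'.mem_dom hf)
  have h2 := hy'.add_sq_le hf hs (hy.mem_dom hf)
  have h3 : inner ℝ (z - z') (y - y') = inner ℝ z y - inner ℝ z y' - inner ℝ z' y +
    (inner ℝ z' y' : ℝ) := by simp only [inner_sub_left, inner_sub_right]; ring
  have h4 := real_inner_le_norm (z - z') (y - y')
  rw [norm_sub_rev y' y] at h2
  by_contra! h
  nlinarith [norm_nonneg (z - z')]

lemma IsDualSolution.conjugate_eq (hf : IsProperClosedConvex f) {z y : Euc d}
    (hy : IsDualSolution f z y) :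
    conjugate f z = ((inner ℝ z y - (f y).toReal : ℝ) : EReal) := by
  rw [EReal.coe_sub, hf.coe_toReal (hy.mem_dom hf)]
  exact le_antisymm (iSup_le hy) (le_iSup (fun y => ((inner ℝ z y : ℝ) : EReal) - f y) y)

variable {D : ℝ}

lemma IsProperClosedConvex.isDualSolution_dualPoint (hf : IsProperClosedConvex f)
    (hD : ∀ y ∈ dom f, ‖y‖ ≤ D) (z : Euc d) : IsDualSolution f z (dualPoint f z) :=
  Classical.epsilon_spec (hf.exists_isDualSolution hD z)

/-- The maximizers `y t` of a run carry no measurability assumption; uniqueness makes them values of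
the continuous function `dualPoint f`. -/
lemma IsDualSolution.eq_dualPoint (hf : IsProperClosedConvex f)
    (hs : StrongConvexOn (dom f) 1 (fun y => (f y).toReal))
    (hD : ∀ y ∈ dom f, ‖y‖ ≤ D) {z y : Euc d} (hy : IsDualSolution f z y) :
    y = dualPoint f z := by
  have := hy.norm_sub_le hf hs (hf.isDualSolution_dualPoint hD z)
  rw [sub_self, norm_zero] at this
  exact sub_eq_zero.1 (norm_le_zero_iff.1 this)

lemma IsProperClosedConvex.norm_dualPoint_sub_le (hf : IsProperClosedConvex f)
    (hs : StrongConvexOn (dom f) 1 (fun y => (f y).toReal))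
    (hD : ∀ y ∈ dom f, ‖y‖ ≤ D) (z z' : Euc d) :
    ‖dualPoint f z - dualPoint f z'‖ ≤ ‖z - z'‖ :=
  (hf.isDualSolution_dualPoint hD z).norm_sub_le hf hs (hf.isDualSolution_dualPoint hD z')

lemma IsProperClosedConvex.continuous_dualPoint (hf : IsProperClosedConvex f)
    (hs : StrongConvexOn (dom f) 1 (fun y => (f y).toReal))
    (hD : ∀ y ∈ dom f, ‖y‖ ≤ D) : Continuous (dualPoint f) := by
  have : LipschitzWith 1 (dualPoint f) := LipschitzWith.of_dist_le_mul fun z z' => by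
    simpa [dist_eq_norm] using hf.norm_dualPoint_sub_le hs hD z z'
  exact this.continuous

/-- The conjugate of a strongly convex function is differentiable. -/
lemma IsProperClosedConvex.hasFDerivAt_conjugate (hf : IsProperClosedConvex f)
    (hs : StrongConvexOn (dom f) 1 (fun y => (f y).toReal))
    (hD : ∀ y ∈ dom f, ‖y‖ ≤ D) (z : Euc d) :
    HasFDerivAt (fun z => (conjugate f z).toReal) (innerSL ℝ (dualPoint f z)) z := by
  have hval : ∀ z, (conjugate f z).toReal =
      inner ℝ z (dualPoint f z) - (f (dualPoint f z)).toReal := fun z => by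
    rw [(hf.isDualSolution_dualPoint hD z).conjugate_eq hf, EReal.toReal_coe]
  refine HasFDerivAt.of_isLittleO ?_
  -- Each maximizer competes in the other's problem, so the remainder lies between zero and `⟪y' -
  -- y, z' - z⟫`, which is at most `‖z' - z‖²`.
  have hO : (fun z' => (conjugate f z').toReal - (conjugate f z).toReal -
      (innerSL ℝ (dualPoint f z)) (z' - z)) =O[𝓝 z] fun z' => ‖z' - z‖ ^ 2 := by
    refine Asymptotics.IsBigO.of_bound 1 (Filter.Eventually.of_forall fun z' => ?_)
    have hy := hf.isDualSolution_dualPoint hD z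
    have hy' := hf.isDualSolution_dualPoint hD z'
    have h1 := hy.le_real hf (hy'.mem_dom hf)
    have h2 := hy'.le_real hf (hy.mem_dom hf)
    have h3 := hf.norm_dualPoint_sub_le hs hD z' z
    have h4 := real_inner_le_norm (dualPoint f z' - dualPoint f z) (z' - z)
    rw [hval, hval, innerSL_apply_apply]
    simp only [one_mul, Real.norm_eq_abs, abs_pow, abs_norm]
    simp only [inner_sub_left, inner_sub_right] at h4 ⊢
    simp only [real_inner_comm z, real_inner_comm z'] at *
    rw [abs_of_nonneg]
    · nlinarith [norm_nonneg (z' - z)]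
    · linarith
  refine hO.trans_isLittleO ?_
  have := (Asymptotics.isLittleO_pow_id (𝕜 := ℝ) (n := 2) one_lt_two).comp_tendsto
    (tendsto_norm_sub_self z)
  exact this.trans_isBigO (Asymptotics.isBigO_norm_left.2 (Asymptotics.isBigO_refl _ _))

end Conjugate

end HybridSGD

namespace HybridSGD

/-! ### Measurability of derivatives and mean-square estimates. -/

section Generic

open Filter Topology

/-- Directional derivatives of a jointly measurable function are jointly measurable on the set where
the function is differentiable. -/
lemma measurable_indicator_fderiv_apply {p : ℕ} {S E : Type*} [MeasurableSpace S]
    [NormedAddCommGroup E] [NormedSpace ℝ E] [MeasurableSpace E] [BorelSpace E]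
    [SecondCountableTopology E] {F : Euc p → S → E}
    (hF : Measurable (fun z : Euc p × S => F z.1 z.2)) {s : Set (Euc p)} (hs : MeasurableSet s)
    (hd : ∀ ξ, ∀ x ∈ s, DifferentiableAt ℝ (fun z => F z ξ) x) (v : Euc p) :
    Measurable ((Prod.fst ⁻¹' s).indicator
      (fun z : Euc p × S => fderiv ℝ (fun w => F w z.2) z.1 v)) := by
  have hs' : MeasurableSet (Prod.fst ⁻¹' s : Set (Euc p × S)) := measurable_fst hs
  -- Difference quotients with increment `1/(n+1)`. The shifted point may leave `s`, which is
  -- harmless because `F` is measurable everywhere; the indicator is needed only for convergence.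
  refine measurable_of_tendsto_metrizable (f := fun (n : ℕ) => (Prod.fst ⁻¹' s).indicator
    (fun z : Euc p × S => ((n : ℝ) + 1) • (F (z.1 + ((n : ℝ) + 1)⁻¹ • v) z.2 - F z.1 z.2)))
    (fun n => Measurable.indicator ?_ hs') (tendsto_pi_nhds.2 fun z => ?_)
  · refine Measurable.const_smul (Measurable.sub ?_ hF) _
    exact hF.comp ((measurable_fst.add_const _).prodMk measurable_snd)
  · by_cases hz : z ∈ (Prod.fst ⁻¹' s : Set (Euc p × S))
    · simp only [Set.indicator_of_mem hz]
      refine (hd z.2 z.1 hz).hasFDerivAt.lim v ?_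
      refine tendsto_norm_atTop_atTop.comp ?_
      exact tendsto_atTop_add_const_right _ _ tendsto_natCast_atTop_atTop
    · simp only [Set.indicator_of_notMem hz]
      exact tendsto_const_nhds

lemma enorm_sq_eq_ofReal {E : Type*} [SeminormedAddCommGroup E] (a : E) :
    ‖a‖ₑ ^ 2 = ENNReal.ofReal (‖a‖ ^ 2) := by
  rw [ENNReal.ofReal_pow (norm_nonneg _), ofReal_norm]

lemma lintegral_enorm_sq_le_of_integral_le {Ω E : Type*} [MeasurableSpace Ω]
    [SeminormedAddCommGroup E] {μ : Measure Ω} {X : Ω → E} {g : Ω → ℝ} {c : ℝ}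
    (hg : Integrable g μ) (hXg : ∀ ω, ‖X ω‖ ^ 2 ≤ g ω) (hc : ∫ ω, g ω ∂μ ≤ c) :
    ∫⁻ ω, ‖X ω‖ₑ ^ 2 ∂μ ≤ ENNReal.ofReal c := by
  calc ∫⁻ ω, ‖X ω‖ₑ ^ 2 ∂μ ≤ ∫⁻ ω, ENNReal.ofReal (g ω) ∂μ :=
        lintegral_mono fun ω => by
          rw [enorm_sq_eq_ofReal]; exact ENNReal.ofReal_le_ofReal (hXg ω)
    _ = ENNReal.ofReal (∫ ω, g ω ∂μ) := (ofReal_integral_eq_lintegral_ofReal hg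
        (ae_of_all _ fun ω => (sq_nonneg _).trans (hXg ω))).symm
    _ ≤ _ := ENNReal.ofReal_le_ofReal hc

lemma sq_lintegral_enorm_le {Ω E : Type*} [MeasurableSpace Ω] [NormedAddCommGroup E]
    {μ : Measure Ω} [IsProbabilityMeasure μ] {X : Ω → E} (hX : AEStronglyMeasurable X μ) :
    (∫⁻ ω, ‖X ω‖ₑ ∂μ) ^ 2 ≤ ∫⁻ ω, ‖X ω‖ₑ ^ 2 ∂μ := by
  have h := eLpNorm_le_eLpNorm_of_exponent_le (p := 1) (q := 2) one_le_two hX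
  have h2 := eLpNorm_nnreal_pow_eq_lintegral (f := X) (μ := μ) (p := 2) two_ne_zero
  rw [eLpNorm_one_eq_lintegral_enorm] at h
  have h3 := pow_le_pow_left' h 2
  refine h3.trans (le_of_eq ?_)
  simpa using h2

lemma memLp_two_of_lintegral_le {Ω E : Type*} [MeasurableSpace Ω] [NormedAddCommGroup E]
    {μ : Measure Ω} {X : Ω → E} (hX : AEStronglyMeasurable X μ) {c : ℝ}
    (hc : ∫⁻ ω, ‖X ω‖ₑ ^ 2 ∂μ ≤ ENNReal.ofReal c) : MemLp X 2 μ := by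
  refine ⟨hX, ?_⟩
  have h2 := eLpNorm_nnreal_pow_eq_lintegral (f := X) (μ := μ) (p := 2) two_ne_zero
  simp only [NNReal.coe_ofNat, ENNReal.rpow_ofNat, ENNReal.coe_ofNat] at h2
  have h3 : eLpNorm X 2 μ ^ 2 < ⊤ := by
    rw [h2]; exact hc.trans_lt ENNReal.ofReal_lt_top
  by_contra h
  rw [not_lt_top_iff] at h
  simp [h] at h3

lemma norm_integral_le_of_lintegral_sq_le {Ω E : Type*} [MeasurableSpace Ω]
    [NormedAddCommGroup E] [NormedSpace ℝ E]
    {μ : Measure Ω} [IsProbabilityMeasure μ] {X : Ω → E} (hX : AEStronglyMeasurable X μ) {c : ℝ}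
    (h0 : 0 ≤ c) (hc : ∫⁻ ω, ‖X ω‖ₑ ^ 2 ∂μ ≤ ENNReal.ofReal (c ^ 2)) : ‖∫ ω, X ω ∂μ‖ ≤ c := by
  have h1 : ‖∫ ω, X ω ∂μ‖ₑ ^ 2 ≤ ENNReal.ofReal (c ^ 2) :=
    (pow_le_pow_left' (enorm_integral_le_lintegral_enorm X) 2).trans
      ((sq_lintegral_enorm_le hX).trans hc)
  rw [enorm_sq_eq_ofReal, ENNReal.ofReal_le_ofReal_iff (by positivity)] at h1
  exact (sq_le_sq₀ (norm_nonneg _) h0).1 h1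

/-- Fundamental theorem of calculus, then Cauchy–Schwarz on the unit interval. If the right side is
finite, `g'` is square integrable, so no continuity of the derivative is needed. -/
lemma enorm_sub_sq_le_lintegral {E : Type*} [NormedAddCommGroup E] [NormedSpace ℝ E]
    [CompleteSpace E] [SecondCountableTopology E] {g g' : ℝ → E}
    (hg : ∀ s ∈ Set.Icc (0 : ℝ) 1, HasDerivAt g (g' s) s) :
    ‖g 1 - g 0‖ₑ ^ 2 ≤ ∫⁻ s in Set.Icc (0 : ℝ) 1, ‖g' s‖ₑ ^ 2 := by
  borelize E
  have : IsProbabilityMeasure (volume.restrict (Set.Icc (0 : ℝ) 1)) := ⟨by simp⟩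
  have hm : AEStronglyMeasurable g' (volume.restrict (Set.Icc (0 : ℝ) 1)) :=
    (stronglyMeasurable_deriv g).aestronglyMeasurable.congr
      ((ae_restrict_mem measurableSet_Icc).mono fun s hs => (hg s hs).deriv)
  rcases eq_or_ne (∫⁻ s in Set.Icc (0 : ℝ) 1, ‖g' s‖ₑ ^ 2) ⊤ with h | h
  · rw [h]; exact le_top
  have hL : MemLp g' 2 (volume.restrict (Set.Icc (0 : ℝ) 1)) :=
    memLp_two_of_lintegral_le hm (ENNReal.ofReal_toReal h).symm.le
  have hint : IntervalIntegrable g' volume 0 1 :=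
    (intervalIntegrable_iff_integrableOn_Icc_of_le zero_le_one).2 (hL.integrable one_le_two)
  have hftc := intervalIntegral.integral_eq_sub_of_hasDerivAt (a := 0) (b := 1) (f := g) (f' := g')
    (by simpa using hg) hint
  rw [← hftc, intervalIntegral.integral_of_le zero_le_one, ← integral_Icc_eq_integral_Ioc]
  exact (pow_le_pow_left' (enorm_integral_le_lintegral_enorm _) 2).trans
      (sq_lintegral_enorm_le hm)

/-- A mean value inequality in mean square: the one-dimensional bound for each `ξ`, followed by
Tonelli, so that the derivative has to be controlled only on average at each fixed `s`. -/
lemma lintegral_enorm_sub_sq_le {S E : Type*} [MeasurableSpace S] {P : Measure S} [SFinite P]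
    [NormedAddCommGroup E] [NormedSpace ℝ E] [CompleteSpace E] [SecondCountableTopology E]
    [MeasurableSpace E] [BorelSpace E] {g g' : ℝ → S → E}
    (hg : ∀ ξ, ∀ s ∈ Set.Icc (0 : ℝ) 1, HasDerivAt (fun s => g s ξ) (g' s ξ) s)
    (hm : Measurable ((Prod.fst ⁻¹' Set.Icc (0 : ℝ) 1).indicator (fun z : ℝ × S => g' z.1 z.2)))
    {C : ENNReal} (hC : ∀ s ∈ Set.Icc (0 : ℝ) 1, ∫⁻ ξ, ‖g' s ξ‖ₑ ^ 2 ∂P ≤ C) :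
    ∫⁻ ξ, ‖g 1 ξ - g 0 ξ‖ₑ ^ 2 ∂P ≤ C := by
  set G : ℝ → S → E := fun s ξ =>
    (Prod.fst ⁻¹' Set.Icc (0 : ℝ) 1).indicator (fun z : ℝ × S => g' z.1 z.2) (s, ξ) with hG
  have hGg : ∀ s ∈ Set.Icc (0 : ℝ) 1, ∀ ξ, G s ξ = g' s ξ := fun s hs ξ =>
    Set.indicator_of_mem (show (s, ξ) ∈ (Prod.fst ⁻¹' Set.Icc (0 : ℝ) 1 : Set (ℝ × S)) from hs) _
  calc ∫⁻ ξ, ‖g 1 ξ - g 0 ξ‖ₑ ^ 2 ∂P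
      ≤ ∫⁻ ξ, (∫⁻ s in Set.Icc (0 : ℝ) 1, ‖G s ξ‖ₑ ^ 2) ∂P :=
        lintegral_mono fun ξ => enorm_sub_sq_le_lintegral (g := fun s => g s ξ)
          (g' := fun s => G s ξ) fun s hs => by
          rw [hGg s hs]; exact hg ξ s hs
    _ = ∫⁻ s in Set.Icc (0 : ℝ) 1, ∫⁻ ξ, ‖G s ξ‖ₑ ^ 2 ∂P := by
        refine lintegral_lintegral_swap ?_
        have : Measurable (fun z : S × ℝ => ‖G z.2 z.1‖ₑ ^ 2) :=
          ((hm.comp measurable_swap).enorm).pow_const 2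
        exact this.aemeasurable
    _ ≤ ∫⁻ s in Set.Icc (0 : ℝ) 1, C :=
        setLIntegral_mono measurable_const fun s hs => by
          simp only [hGg s hs]; exact hC s hs
    _ = C := by simp

end Generic

/-! ### Restricting linear maps to a subspace. -/

section Tangent

variable {p q : ℕ} (V : Submodule ℝ (Euc p))

/-- The entries of the matrix of the restriction of a linear map to a subspace, in an orthonormal
basis of the subspace. -/
noncomputable def restrictVec :
    (Euc p →L[ℝ] Euc q) →ₗ[ℝ] EuclideanSpace ℝ (Fin (Module.finrank ℝ V) × Fin q) where
  toFun A := WithLp.toLp 2 fun kj => A (stdOrthonormalBasis ℝ V kj.1 : Euc p) kj.2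
  map_add' A B := by ext; simp
  map_smul' c A := by ext; simp

lemma restrictVec_apply (A : Euc p →L[ℝ] Euc q) (kj) :
    restrictVec V A kj = A (stdOrthonormalBasis ℝ V kj.1 : Euc p) kj.2 := rfl

lemma norm_restrictVec_sq (A : Euc p →L[ℝ] Euc q) :
    ‖restrictVec V A‖ ^ 2 = ∑ k, ‖A (stdOrthonormalBasis ℝ V k : Euc p)‖ ^ 2 := by
  rw [EuclideanSpace.norm_sq_eq, Fintype.sum_prod_type]
  refine Finset.sum_congr rfl fun k _ => ?_
  rw [EuclideanSpace.norm_sq_eq]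
  rfl

/-- Written through the rows `A* e_j`, this is Bessel's inequality for an orthonormal basis of `V`
against Parseval's identity in the whole space. -/
lemma norm_restrictVec_sq_le_frobSq (A : Euc p →L[ℝ] Euc q) :
    ‖restrictVec V A‖ ^ 2 ≤ frobSq A := by
  have h1 : ∀ (ι : Type) [Fintype ι] (u : ι → Euc p), ∑ k, ‖A (u k)‖ ^ 2 =
      ∑ j : Fin q, ∑ k, ‖inner ℝ (u k) (A.adjoint (EuclideanSpace.single j 1))‖ ^ 2 := by
    intro ι _ u
    rw [Finset.sum_comm]
    refine Finset.sum_congr rfl fun k _ => ?_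
    rw [EuclideanSpace.norm_sq_eq]
    refine Finset.sum_congr rfl fun j _ => ?_
    rw [ContinuousLinearMap.adjoint_inner_right]
    simp [EuclideanSpace.inner_single_right]
  rw [norm_restrictVec_sq, frobSq, h1, h1]
  refine Finset.sum_le_sum fun j _ => ?_
  have hon : Orthonormal ℝ (fun k => (stdOrthonormalBasis ℝ V k : Euc p)) :=
    (stdOrthonormalBasis ℝ V).orthonormal.comp_linearIsometry V.subtypeₗᵢ
  have h2 := hon.sum_inner_products_le (s := Finset.univ)
    (A.adjoint (EuclideanSpace.single j 1))
  refine h2.trans (le_of_eq ?_)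
  have := (EuclideanSpace.basisFun (Fin p) ℝ).sum_sq_norm_inner_right
    (A.adjoint (EuclideanSpace.single j (1 : ℝ)))
  simpa using this.symm

/-- Expand `w` in the orthonormal basis of `V` and apply Cauchy–Schwarz. Only the restriction of `A`
to `V` matters, so errors off `V` may be ignored. -/
lemma norm_apply_le_restrictVec (A : Euc p →L[ℝ] Euc q) {w : Euc p} (hw : w ∈ V) :
    ‖A w‖ ≤ ‖restrictVec V A‖ * ‖w‖ := by
  set e := stdOrthonormalBasis ℝ V with he
  set w' : V := ⟨w, hw⟩ with hw'
  have h1 : w = ∑ k, (inner ℝ (e k) w' : ℝ) • (e k : Euc p) := by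
    have := congrArg (Subtype.val) (e.sum_repr' w')
    simpa using this.symm
  have h2 : ‖w‖ ^ 2 = ∑ k, (inner ℝ (e k) w' : ℝ) ^ 2 := by
    have := e.sum_sq_norm_inner_right w'
    simpa using this.symm
  have h3 : ‖A w‖ ≤ ∑ k, |(inner ℝ (e k) w' : ℝ)| * ‖A (e k)‖ := by
    nth_rewrite 1 [h1]
    rw [map_sum]
    refine (norm_sum_le _ _).trans (Finset.sum_le_sum fun k _ => ?_)
    rw [map_smul, norm_smul, Real.norm_eq_abs]
  have h4 := Finset.sum_mul_sq_le_sq_mul_sq Finset.univ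
    (fun k => |(inner ℝ (e k) w' : ℝ)|) (fun k => ‖A (e k)‖)
  simp only [sq_abs] at h4
  rw [← h2, ← norm_restrictVec_sq] at h4
  refine h3.trans (abs_le_of_sq_le_sq' ?_ (by positivity)).2
  rw [mul_pow]
  linarith

end Tangent

end HybridSGD

namespace HybridSGD

/-! ### The expectation map and its Jacobian on the domain. -/

namespace Problem

open Filter Topology

variable {p q n : ℕ} {S : Type*} [MeasurableSpace S] {M : Problem p q n S}
  {LF σF σJ MF Mψ : ℝ}

lemma phi_eq (hψ : M.BoundedDualDomain Mψ) (u : Euc q) : M.phi u = ((M.phi u).toReal : EReal) := by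
  rw [phi, (hψ.ψ_convex.isDualSolution_dualPoint hψ.bounded _).conjugate_eq hψ.ψ_convex,
    EReal.toReal_coe]

/-- Bounded `dom ψ` makes `φ₀` finite everywhere, so only `R` restricts the domain. Hence the domain
is convex and Borel, and it contains every prox point of `R`. -/
lemma dom_Psi (hψ : M.BoundedDualDomain Mψ) : dom M.Psi = dom M.R := by
  ext x
  simp only [dom, Psi, Set.mem_ofPred_eq]
  rw [phi_eq hψ]
  constructor
  · intro h
    by_contra h'
    rw [not_lt_top_iff.1 h', EReal.coe_add_top] at h
    exact lt_irrefl _ h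
  · exact fun h => EReal.add_lt_top (EReal.coe_ne_top _) h.ne

lemma Psi_eq (hM : M.Standing) (hψ : M.BoundedDualDomain Mψ) {x : Euc p} (hx : x ∈ dom M.Psi) :
    M.Psi x = ((M.Phi x + (M.R x).toReal : ℝ) : EReal) := by
  rw [dom_Psi hψ] at hx
  rw [EReal.coe_add, hM.R_convex.coe_toReal hx, Phi, ← phi_eq hψ, Psi]

lemma Psi_toReal (hM : M.Standing) (hψ : M.BoundedDualDomain Mψ) {x : Euc p}
    (hx : x ∈ dom M.Psi) : (M.Psi x).toReal = M.Phi x + (M.R x).toReal := by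
  rw [Psi_eq hM hψ hx, EReal.toReal_coe]

lemma PsiStar_toReal_le (hM : M.Standing) {x : Euc p}
    (hx : x ∈ dom M.Psi) : M.PsiStar.toReal ≤ (M.Psi x).toReal :=
  EReal.toReal_le_toReal (iInf_le _ x) hM.bounded_below.ne' (ne_of_lt hx)

lemma convex_dom (hM : M.Standing) (hψ : M.BoundedDualDomain Mψ) : Convex ℝ (dom M.Psi) := by
  rw [dom_Psi hψ]; exact hM.R_convex.convex.1

lemma measurableSet_dom (hM : M.Standing) (hψ : M.BoundedDualDomain Mψ) :
    MeasurableSet (dom M.Psi) := by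
  rw [dom_Psi hψ]
  exact hM.R_convex.closed.measurable measurableSet_Iio

variable (M) in
/-- The direction of the affine hull of the domain of the objective. -/
noncomputable def tangent : Submodule ℝ (Euc p) := vectorSpan ℝ (dom M.Psi)

lemma sub_mem_tangent {x y : Euc p} (hx : x ∈ dom M.Psi) (hy : y ∈ dom M.Psi) :
    x - y ∈ M.tangent :=
  vsub_mem_vectorSpan ℝ hx hy

lemma measurable_jac_apply (hM : M.Standing) (hψ : M.BoundedDualDomain Mψ) (v : Euc p) :
    Measurable ((Prod.fst ⁻¹' dom M.Psi).indicator (fun z : Euc p × S => M.jac z.1 z.2 v)) :=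
  measurable_indicator_fderiv_apply hM.measurable_F (measurableSet_dom hM hψ)
    hM.differentiable_F v

lemma measurable_jac_apply_of_mem (hM : M.Standing) (hψ : M.BoundedDualDomain Mψ) {x : Euc p}
    (hx : x ∈ dom M.Psi) (v : Euc p) : Measurable (fun ξ => M.jac x ξ v) := by
  have h := (measurable_jac_apply hM hψ v).comp (measurable_prodMk_left (x := x))
  convert h using 2 with ξ
  simp [hx]

lemma measurable_F_of (hM : M.Standing) (x : Euc p) : Measurable (M.F x) :=
  hM.measurable_F.comp (measurable_prodMk_left (x := x))

lemma hasDerivAt_F_segment (hM : M.Standing) {x : Euc p} (h : Euc p) (ξ : S) {s : ℝ}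
    (hs : x + s • h ∈ dom M.Psi) :
    HasDerivAt (fun s : ℝ => M.F (x + s • h) ξ) (M.jac (x + s • h) ξ h) s := by
  have h1 : HasDerivAt (fun s : ℝ => x + s • h) h s := by
    simpa using ((hasDerivAt_id s).smul_const h).const_add x
  exact (hM.differentiable_F ξ _ hs).hasFDerivAt.comp_hasDerivAt s h1

lemma segment_mem (hM : M.Standing) (hψ : M.BoundedDualDomain Mψ) {x y : Euc p}
    (hx : x ∈ dom M.Psi) (hy : y ∈ dom M.Psi) {s : ℝ} (hs : s ∈ Set.Icc (0 : ℝ) 1) :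
    x + s • (y - x) ∈ dom M.Psi :=
  (convex_dom hM hψ).add_smul_sub_mem hx hy hs

lemma measurable_jac_segment (hM : M.Standing) (hψ : M.BoundedDualDomain Mψ) {x y : Euc p}
    (hx : x ∈ dom M.Psi) (hy : y ∈ dom M.Psi) (v : Euc p) :
    Measurable ((Prod.fst ⁻¹' Set.Icc (0 : ℝ) 1).indicator
      (fun z : ℝ × S => M.jac (x + z.1 • (y - x)) z.2 v)) := by
  have h1 : Measurable (fun z : ℝ × S => (x + z.1 • (y - x), z.2)) := by fun_prop
  have h2 := ((measurable_jac_apply hM hψ v).comp h1).indicator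
    (measurable_fst measurableSet_Icc : MeasurableSet (Prod.fst ⁻¹' Set.Icc (0 : ℝ) 1))
  convert h2 using 1
  refine Set.indicator_congr fun z hz => ?_
  have : x + z.1 • (y - x) ∈ dom M.Psi := segment_mem hM hψ hx hy hz
  simp [this]

lemma lintegral_F_sub_sq_le (hM : M.Standing) (hF : M.SmoothBoundedVariance LF σF σJ MF)
    (hψ : M.BoundedDualDomain Mψ) {x y : Euc p} (hx : x ∈ dom M.Psi) (hy : y ∈ dom M.Psi) :
    ∫⁻ ξ, ‖M.F y ξ - M.F x ξ‖ₑ ^ 2 ∂M.P ≤ ENNReal.ofReal (MF ^ 2 * ‖y - x‖ ^ 2) := by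
  have := hM.isProb
  have h := lintegral_enorm_sub_sq_le (P := M.P) (g := fun s ξ => M.F (x + s • (y - x)) ξ)
    (g' := fun s ξ => M.jac (x + s • (y - x)) ξ (y - x))
    (fun ξ s hs => hasDerivAt_F_segment hM _ ξ (segment_mem hM hψ hx hy hs))
    (measurable_jac_segment hM hψ hx hy _) (C := ENNReal.ofReal (MF ^ 2 * ‖y - x‖ ^ 2))
    (fun s hs => by
      obtain ⟨h1, h2⟩ := hF.lipschitz _ (segment_mem hM hψ hx hy hs)
      refine lintegral_enorm_sq_le_of_integral_le (h1.mul_const (‖y - x‖ ^ 2)) (fun ξ => ?_) ?_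
      · rw [← mul_pow]
        exact pow_le_pow_left₀ (norm_nonneg _) (ContinuousLinearMap.le_opNorm _ _) 2
      · rw [integral_mul_const]
        gcongr)
  simpa using h

lemma lintegral_restrictVec_jac_sub_sq_le (hF : M.SmoothBoundedVariance LF σF σJ MF)
    (V : Submodule ℝ (Euc p)) {x y : Euc p} (hx : x ∈ dom M.Psi) (hy : y ∈ dom M.Psi) :
    ∫⁻ ξ, ‖restrictVec V (M.jac x ξ) - restrictVec V (M.jac y ξ)‖ₑ ^ 2 ∂M.P
      ≤ ENNReal.ofReal (LF ^ 2 * ‖x - y‖ ^ 2) := by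
  obtain ⟨h1, h2⟩ := hF.smooth x hx y hy
  refine lintegral_enorm_sq_le_of_integral_le h1 (fun ξ => ?_) h2
  rw [← map_sub]
  exact norm_restrictVec_sq_le_frobSq _ _

lemma lintegral_jac_sub_apply_sq_le (hF : M.SmoothBoundedVariance LF σF σJ MF) {x y : Euc p}
    (hx : x ∈ dom M.Psi) (hy : y ∈ dom M.Psi) {w : Euc p} (hw : w ∈ M.tangent) :
    ∫⁻ ξ, ‖M.jac x ξ w - M.jac y ξ w‖ₑ ^ 2 ∂M.P
      ≤ ENNReal.ofReal ((LF * ‖x - y‖ * ‖w‖) ^ 2) := by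
  obtain ⟨h1, h2⟩ := hF.smooth x hx y hy
  refine lintegral_enorm_sq_le_of_integral_le (h1.mul_const (‖w‖ ^ 2)) (fun ξ => ?_) ?_
  · rw [← sub_apply]
    refine (pow_le_pow_left₀ (norm_nonneg _) (norm_apply_le_restrictVec M.tangent _ hw) 2).trans ?_
    rw [mul_pow]
    gcongr
    exact norm_restrictVec_sq_le_frobSq _ _
  · rw [integral_mul_const, mul_pow, mul_pow]
    gcongr

/-- Apply the mean value inequality to `F(x + s h) - s F'(x) h`, whose derivative is a difference of
Jacobians. The constant is not sharp; only the quadratic order in `h` is used. -/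
lemma lintegral_remainder_sq_le (hM : M.Standing) (hF : M.SmoothBoundedVariance LF σF σJ MF)
    (hψ : M.BoundedDualDomain Mψ) {x y : Euc p} (hx : x ∈ dom M.Psi) (hy : y ∈ dom M.Psi) :
    ∫⁻ ξ, ‖M.F y ξ - M.F x ξ - M.jac x ξ (y - x)‖ₑ ^ 2 ∂M.P
      ≤ ENNReal.ofReal ((LF * ‖y - x‖ ^ 2) ^ 2) := by
  have := hM.isProb
  have hm : Measurable ((Prod.fst ⁻¹' Set.Icc (0 : ℝ) 1).indicator (fun z : ℝ × S =>
      M.jac (x + z.1 • (y - x)) z.2 (y - x) - M.jac x z.2 (y - x))) := by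
    have h2 : Measurable (fun z : ℝ × S => M.jac x z.2 (y - x)) :=
      (measurable_jac_apply_of_mem hM hψ hx (y - x)).comp measurable_snd
    rw [Set.indicator_sub]
    exact (measurable_jac_segment hM hψ hx hy _).sub (h2.indicator (measurable_fst measurableSet_Icc))
  have h := lintegral_enorm_sub_sq_le (P := M.P)
    (g := fun s ξ => M.F (x + s • (y - x)) ξ - s • M.jac x ξ (y - x))
    (g' := fun s ξ => M.jac (x + s • (y - x)) ξ (y - x) - M.jac x ξ (y - x))
    (fun ξ s hs => (hasDerivAt_F_segment hM _ ξ (segment_mem hM hψ hx hy hs)).sub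
      (by simpa using (hasDerivAt_id s).smul_const (M.jac x ξ (y - x))))
    hm (C := ENNReal.ofReal ((LF * ‖y - x‖ ^ 2) ^ 2))
    (fun s hs => by
      refine (lintegral_jac_sub_apply_sq_le hF (segment_mem hM hψ hx hy hs) hx
        (sub_mem_tangent hy hx)).trans (ENNReal.ofReal_le_ofReal ?_)
      have hLF := hF.LF_pos
      rw [add_sub_cancel_left, norm_smul, Real.norm_eq_abs, abs_of_nonneg hs.1]
      have h0 := norm_nonneg (y - x)
      refine pow_le_pow_left₀ (by have := hs.1; positivity) ?_ 2
      have : s * ‖y - x‖ ≤ ‖y - x‖ := mul_le_of_le_one_left h0 hs.2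
      calc LF * (s * ‖y - x‖) * ‖y - x‖ ≤ LF * ‖y - x‖ * ‖y - x‖ := by gcongr
        _ = _ := by ring)
  refine le_of_eq_of_le (lintegral_congr fun ξ => ?_) h
  congr 2
  simp only [one_smul, zero_smul, add_zero, sub_zero, add_sub_cancel]
  abel

lemma integrable_jac_apply (hM : M.Standing) (hF : M.SmoothBoundedVariance LF σF σJ MF)
    (hψ : M.BoundedDualDomain Mψ) {x : Euc p} (hx : x ∈ dom M.Psi) (w : Euc p) :
    MemLp (fun ξ => M.jac x ξ w) 2 M.P ∧
      ∫⁻ ξ, ‖M.jac x ξ w‖ₑ ^ 2 ∂M.P ≤ ENNReal.ofReal ((MF * ‖w‖) ^ 2) := by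
  obtain ⟨h1, h2⟩ := hF.lipschitz x hx
  have h3 : ∫⁻ ξ, ‖M.jac x ξ w‖ₑ ^ 2 ∂M.P ≤ ENNReal.ofReal ((MF * ‖w‖) ^ 2) := by
    refine lintegral_enorm_sq_le_of_integral_le (h1.mul_const (‖w‖ ^ 2)) (fun ξ => ?_) ?_
    · rw [← mul_pow]
      exact pow_le_pow_left₀ (norm_nonneg _) (ContinuousLinearMap.le_opNorm _ _) 2
    · rw [integral_mul_const, mul_pow]
      gcongr
  exact ⟨memLp_two_of_lintegral_le
    (measurable_jac_apply_of_mem hM hψ hx w).aestronglyMeasurable h3, h3⟩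

lemma norm_mean_sub_le (hM : M.Standing) (hF : M.SmoothBoundedVariance LF σF σJ MF)
    (hψ : M.BoundedDualDomain Mψ) {x y : Euc p} (hx : x ∈ dom M.Psi) (hy : y ∈ dom M.Psi) :
    ‖M.mean y - M.mean x‖ ≤ MF * ‖y - x‖ := by
  have := hM.isProb
  rw [mean, mean, ← integral_sub (hM.integrable_F y) (hM.integrable_F x)]
  refine norm_integral_le_of_lintegral_sq_le
    ((measurable_F_of hM y).sub (measurable_F_of hM x)).aestronglyMeasurable
    (by have := hF.MF_pos; positivity) ?_
  rw [mul_pow]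
  exact lintegral_F_sub_sq_le hM hF hψ hx hy

/-- Along the tangent directions of the domain, the Jacobian of the expectation is the expectation
of the Jacobian. -/
lemma integral_jac_apply (hM : M.Standing) (hF : M.SmoothBoundedVariance LF σF σJ MF)
    (hψ : M.BoundedDualDomain Mψ) {x : Euc p} (hx : x ∈ dom M.Psi) {w : Euc p}
    (hw : w ∈ M.tangent) : ∫ ξ, M.jac x ξ w ∂M.P = M.meanJac x w := by
  have := hM.isProb
  have hI : ∀ w, Integrable (fun ξ => M.jac x ξ w) M.P := fun w =>
    (integrable_jac_apply hM hF hψ hx w).1.integrable one_le_two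
  -- Both sides are linear in `w`, so it is enough to treat the generators `y - x` with `y` in the
  -- domain.
  rw [tangent, vectorSpan_eq_span_vsub_set_right ℝ hx] at hw
  induction hw using Submodule.span_induction with
  | zero => simp
  | add u v _ _ hu hv =>
    simp only [map_add]
    rw [integral_add (hI u) (hI v), hu, hv]
  | smul a u _ hu =>
    simp only [map_smul]
    rw [integral_smul, hu]
  | mem w hw =>
    obtain ⟨y, hy, rfl⟩ := hw
    simp only [vsub_eq_sub]
    set h := y - x with hh
    -- The points `x + h/(k+1)` stay on the segment to `y`. By the quadratic remainder bound the
    -- difference quotients of the mean approach the expected directional derivative with error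
    -- `O(1/(k+1))`, so both limits agree.
    have hc : Tendsto (fun k : ℕ => (k : ℝ) + 1) atTop atTop :=
      tendsto_atTop_add_const_right _ _ tendsto_natCast_atTop_atTop
    have hlim := (hM.differentiable_mean x hx).hasFDerivAt.lim h
      (c := fun k : ℕ => (k : ℝ) + 1) (l := atTop) (tendsto_norm_atTop_atTop.comp hc)
    refine tendsto_nhds_unique ?_ hlim
    rw [tendsto_iff_norm_sub_tendsto_zero]
    refine squeeze_zero (g := fun k : ℕ => LF * ‖h‖ ^ 2 * ((k : ℝ) + 1)⁻¹)
      (fun _ => norm_nonneg _) (fun k => ?_) ?_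
    · set c : ℝ := (k : ℝ) + 1 with hcdef
      have hc0 : 0 < c := by positivity
      have hc1 : c⁻¹ ≤ 1 := inv_le_one_of_one_le₀ (by simp [hcdef])
      have hz : x + c⁻¹ • h ∈ dom M.Psi := segment_mem hM hψ hx hy ⟨by positivity, hc1⟩
      have h1 := lintegral_remainder_sq_le hM hF hψ hx hz
      rw [add_sub_cancel_left] at h1
      have h2 : ‖∫ ξ, (M.F (x + c⁻¹ • h) ξ - M.F x ξ - M.jac x ξ (c⁻¹ • h)) ∂M.P‖ ≤
          LF * ‖c⁻¹ • h‖ ^ 2 :=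
        norm_integral_le_of_lintegral_sq_le
          (((measurable_F_of hM _).sub (measurable_F_of hM x)).sub
            (measurable_jac_apply_of_mem hM hψ hx _)).aestronglyMeasurable
          (by have := hF.LF_pos; positivity) h1
      rw [integral_sub (f := fun ξ => M.F (x + c⁻¹ • h) ξ - M.F x ξ)
        ((hM.integrable_F _).sub (hM.integrable_F x)) (hI _),
        integral_sub (hM.integrable_F _) (hM.integrable_F x)] at h2
      simp only [map_smul] at h2
      rw [integral_smul, norm_smul, Real.norm_eq_abs, abs_of_pos (inv_pos.2 hc0)] at h2
      have h3 : c • (M.mean (x + c⁻¹ • h) - M.mean x) - ∫ ξ, M.jac x ξ h ∂M.P =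
          c • (M.mean (x + c⁻¹ • h) - M.mean x - c⁻¹ • ∫ ξ, M.jac x ξ h ∂M.P) := by
        rw [smul_sub c (_ - _), smul_smul, mul_inv_cancel₀ hc0.ne', one_smul]
      rw [h3, norm_smul, Real.norm_eq_abs, abs_of_pos hc0]
      refine (mul_le_mul_of_nonneg_left h2 hc0.le).trans (le_of_eq ?_)
      field_simp
    · simpa using (tendsto_inv_atTop_zero.comp hc).const_mul (LF * ‖h‖ ^ 2)

lemma norm_meanJac_apply_le (hM : M.Standing) (hF : M.SmoothBoundedVariance LF σF σJ MF)
    (hψ : M.BoundedDualDomain Mψ) {x : Euc p} (hx : x ∈ dom M.Psi) {w : Euc p}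
    (hw : w ∈ M.tangent) : ‖M.meanJac x w‖ ≤ MF * ‖w‖ := by
  have := hM.isProb
  rw [← integral_jac_apply hM hF hψ hx hw]
  obtain ⟨h1, h2⟩ := integrable_jac_apply hM hF hψ hx w
  exact norm_integral_le_of_lintegral_sq_le h1.1 (by have := hF.MF_pos; positivity) h2

lemma norm_meanJac_sub_apply_le (hM : M.Standing) (hF : M.SmoothBoundedVariance LF σF σJ MF)
    (hψ : M.BoundedDualDomain Mψ) {x y : Euc p} (hx : x ∈ dom M.Psi) (hy : y ∈ dom M.Psi)
    {w : Euc p} (hw : w ∈ M.tangent) :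
    ‖M.meanJac x w - M.meanJac y w‖ ≤ LF * ‖x - y‖ * ‖w‖ := by
  have := hM.isProb
  have h1 := (integrable_jac_apply hM hF hψ hx w).1
  have h2 := (integrable_jac_apply hM hF hψ hy w).1
  rw [← integral_jac_apply hM hF hψ hx hw, ← integral_jac_apply hM hF hψ hy hw,
    ← integral_sub (h1.integrable one_le_two) (h2.integrable one_le_two)]
  exact norm_integral_le_of_lintegral_sq_le (h1.1.sub h2.1)
    (by have := hF.LF_pos; positivity) (lintegral_jac_sub_apply_sq_le hF hx hy hw)

end Problem

end HybridSGD

namespace HybridSGD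

/-! ### Smoothness of `Φ₀` and the inexact proximal gradient step. -/

namespace Problem

open Filter Topology

variable {p q n : ℕ} {S : Type*} [MeasurableSpace S] {M : Problem p q n S}
  {LF σF σJ MF Mψ : ℝ}

lemma norm_K_dualPoint_le (hψ : M.BoundedDualDomain Mψ) (z : Euc n) :
    ‖M.K (dualPoint M.ψ z)‖ ≤ ‖M.K‖ * Mψ :=
  (M.K.le_opNorm _).trans (mul_le_mul_of_nonneg_left
    (hψ.bounded _ ((hψ.ψ_convex.isDualSolution_dualPoint hψ.bounded z).mem_dom hψ.ψ_convex))
    (norm_nonneg _))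

lemma norm_K_dualPoint_sub_le (hψ : M.BoundedDualDomain Mψ)
    (hs : StrongConvexOn (dom M.ψ) 1 (fun y => (M.ψ y).toReal)) (u u' : Euc q) :
    ‖M.K (dualPoint M.ψ (M.K.adjoint u)) - M.K (dualPoint M.ψ (M.K.adjoint u'))‖
      ≤ ‖M.K‖ ^ 2 * ‖u - u'‖ := by
  rw [← map_sub]
  refine (M.K.le_opNorm _).trans ?_
  rw [pow_two, mul_assoc]
  refine mul_le_mul_of_nonneg_left ?_ (norm_nonneg _)
  refine (hψ.ψ_convex.norm_dualPoint_sub_le hs hψ.bounded _ _).trans ?_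
  rw [← map_sub, ← LinearIsometryEquiv.norm_map ContinuousLinearMap.adjoint M.K]
  exact ContinuousLinearMap.le_opNorm _ _

lemma hasFDerivAt_phi (hψ : M.BoundedDualDomain Mψ)
    (hs : StrongConvexOn (dom M.ψ) 1 (fun y => (M.ψ y).toReal)) (u : Euc q) :
    HasFDerivAt (fun u => (M.phi u).toReal)
      ((innerSL ℝ (dualPoint M.ψ (M.K.adjoint u))).comp M.K.adjoint) u :=
  (hψ.ψ_convex.hasFDerivAt_conjugate hs hψ.bounded (M.K.adjoint u)).comp u
    M.K.adjoint.hasFDerivAt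

lemma hasFDerivAt_Phi (hM : M.Standing) (hψ : M.BoundedDualDomain Mψ)
    (hs : StrongConvexOn (dom M.ψ) 1 (fun y => (M.ψ y).toReal)) {x : Euc p}
    (hx : x ∈ dom M.Psi) :
    HasFDerivAt M.Phi (((innerSL ℝ (dualPoint M.ψ (M.K.adjoint (M.mean x)))).comp
      M.K.adjoint).comp (M.meanJac x)) x :=
  (hasFDerivAt_phi hψ hs (M.mean x)).comp x (hM.differentiable_mean x hx).hasFDerivAt

lemma inner_gradient_Phi (hM : M.Standing) (hψ : M.BoundedDualDomain Mψ)
    (hs : StrongConvexOn (dom M.ψ) 1 (fun y => (M.ψ y).toReal)) {x : Euc p}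
    (hx : x ∈ dom M.Psi) (w : Euc p) :
    inner ℝ (gradient M.Phi x) w =
      inner ℝ (M.K (dualPoint M.ψ (M.K.adjoint (M.mean x)))) (M.meanJac x w) := by
  rw [gradient, InnerProductSpace.toDual_symm_apply, (hasFDerivAt_Phi hM hψ hs hx).fderiv]
  simp [ContinuousLinearMap.adjoint_inner_right]

/-- The gradient pairs `K y(x)` with `F'(x) w`. Varying one factor at a time gives the two summands
of `constL`: Lipschitz Jacobian times bounded dual, and Lipschitz dual times bounded Jacobian. -/
lemma abs_inner_gradient_sub_le (hM : M.Standing) (hF : M.SmoothBoundedVariance LF σF σJ MF)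
    (hψ : M.BoundedDualDomain Mψ)
    (hs : StrongConvexOn (dom M.ψ) 1 (fun y => (M.ψ y).toReal)) {x y w : Euc p}
    (hx : x ∈ dom M.Psi) (hy : y ∈ dom M.Psi) (hw : w ∈ M.tangent) :
    |inner ℝ (gradient M.Phi x) w - inner ℝ (gradient M.Phi y) w| ≤
      constL ‖M.K‖ LF MF Mψ * ‖x - y‖ * ‖w‖ := by
  rw [inner_gradient_Phi hM hψ hs hx, inner_gradient_Phi hM hψ hs hy]
  set kx := M.K (dualPoint M.ψ (M.K.adjoint (M.mean x)))
  set ky := M.K (dualPoint M.ψ (M.K.adjoint (M.mean y)))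
  have e : (inner ℝ kx (M.meanJac x w) : ℝ) - inner ℝ ky (M.meanJac y w) =
      inner ℝ kx (M.meanJac x w - M.meanJac y w) + inner ℝ (kx - ky) (M.meanJac y w) := by
    simp only [inner_sub_left, inner_sub_right]; ring
  have hMF := hF.MF_pos
  have hLF := hF.LF_pos
  have hMψ := hψ.Mψ_pos
  have h1 : |(inner ℝ kx (M.meanJac x w - M.meanJac y w) : ℝ)| ≤
      (‖M.K‖ * Mψ) * (LF * ‖x - y‖ * ‖w‖) :=
    (abs_real_inner_le_norm _ _).trans (mul_le_mul (norm_K_dualPoint_le hψ _)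
      (norm_meanJac_sub_apply_le hM hF hψ hx hy hw) (norm_nonneg _) (by positivity))
  have h2 : |(inner ℝ (kx - ky) (M.meanJac y w) : ℝ)| ≤
      (‖M.K‖ ^ 2 * (MF * ‖x - y‖)) * (MF * ‖w‖) :=
    (abs_real_inner_le_norm _ _).trans (mul_le_mul ((norm_K_dualPoint_sub_le hψ hs _ _).trans
      (mul_le_mul_of_nonneg_left (norm_mean_sub_le hM hF hψ hy hx) (by positivity)))
      (norm_meanJac_apply_le hM hF hψ hy hw) (norm_nonneg _) (by positivity))
  rw [e]
  refine (abs_add_le _ _).trans ((add_le_add h1 h2).trans (le_of_eq ?_))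
  rw [constL]
  ring

/-- The descent lemma along a segment of the domain, obtained from monotonicity: subtracting the
quadratic model leaves a function of `s` with nonpositive derivative. -/
lemma Phi_le (hM : M.Standing) (hF : M.SmoothBoundedVariance LF σF σJ MF)
    (hψ : M.BoundedDualDomain Mψ)
    (hs : StrongConvexOn (dom M.ψ) 1 (fun y => (M.ψ y).toReal)) {x z : Euc p}
    (hx : x ∈ dom M.Psi) (hz : z ∈ dom M.Psi) :
    M.Phi z ≤ M.Phi x + inner ℝ (gradient M.Phi x) (z - x) +
      constL ‖M.K‖ LF MF Mψ / 2 * ‖z - x‖ ^ 2 := by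
  set L := constL ‖M.K‖ LF MF Mψ with hL
  set h := z - x with hh
  have hmem : ∀ s ∈ Set.Icc (0 : ℝ) 1, x + s • h ∈ dom M.Psi := fun s hs =>
    segment_mem hM hψ hx hz hs
  have hd : ∀ s ∈ Set.Icc (0 : ℝ) 1, HasDerivAt
      (fun s : ℝ => M.Phi (x + s • h) - s * inner ℝ (gradient M.Phi x) h - s ^ 2 * (L / 2 * ‖h‖ ^ 2))
      (inner ℝ (gradient M.Phi (x + s • h)) h - inner ℝ (gradient M.Phi x) h
        - 2 * s * (L / 2 * ‖h‖ ^ 2)) s := by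
    intro s hs'
    have h1 : HasDerivAt (fun s : ℝ => x + s • h) h s := by
      simpa using ((hasDerivAt_id s).smul_const h).const_add x
    have h2 : HasDerivAt (fun s : ℝ => M.Phi (x + s • h))
        (inner ℝ (gradient M.Phi (x + s • h)) h) s := by
      have h3 := hasFDerivAt_Phi hM hψ hs (hmem s hs')
      have := h3.differentiableAt.hasFDerivAt.comp_hasDerivAt s h1
      rw [gradient, InnerProductSpace.toDual_symm_apply]
      exact this
    have h4 : HasDerivAt (fun s : ℝ => s * (inner ℝ (gradient M.Phi x) h : ℝ))
        (inner ℝ (gradient M.Phi x) h) s := by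
      simpa using (hasDerivAt_id s).mul_const (inner ℝ (gradient M.Phi x) h : ℝ)
    have h5 : HasDerivAt (fun s : ℝ => s ^ 2 * (L / 2 * ‖h‖ ^ 2)) (2 * s * (L / 2 * ‖h‖ ^ 2)) s := by
      simpa using (hasDerivAt_pow 2 s).mul_const (L / 2 * ‖h‖ ^ 2)
    exact (h2.sub h4).sub h5
  have hanti := antitoneOn_of_deriv_nonpos (convex_Icc (0 : ℝ) 1)
    (fun s hs' => (hd s hs').continuousAt.continuousWithinAt)
    (fun s hs' => (hd s (interior_subset hs')).differentiableAt.differentiableWithinAt)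
    (fun s hs' => by
      have hs'' := interior_subset hs'
      rw [(hd s hs'').deriv]
      have h1 := (abs_le.1 (abs_inner_gradient_sub_le hM hF hψ hs (hmem s hs'') hx
        (sub_mem_tangent hz hx))).2
      rw [add_sub_cancel_left, norm_smul, Real.norm_eq_abs, abs_of_nonneg hs''.1, ← hL, ← hh] at h1
      nlinarith)
  have := hanti (Set.left_mem_Icc.2 zero_le_one) (Set.right_mem_Icc.2 zero_le_one) zero_le_one
  simp only [one_smul, zero_smul, add_zero] at this
  rw [hh, add_sub_cancel, ← hh] at this
  linarith

/-- The error of the gradient estimate, tested against tangent directions. -/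
lemma abs_inner_estimate_sub_gradient_le (hM : M.Standing)
    (hF : M.SmoothBoundedVariance LF σF σJ MF) (hψ : M.BoundedDualDomain Mψ)
    (hs : StrongConvexOn (dom M.ψ) 1 (fun y => (M.ψ y).toReal)) {x w : Euc p}
    (hx : x ∈ dom M.Psi) (hw : w ∈ M.tangent) (u : Euc q) (J : Euc p →L[ℝ] Euc q) :
    |inner ℝ (J.adjoint (M.K (dualPoint M.ψ (M.K.adjoint u)))) w - inner ℝ (gradient M.Phi x) w| ≤
      (‖M.K‖ * Mψ * ‖restrictVec M.tangent J - restrictVec M.tangent (M.meanJac x)‖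
        + MF * ‖M.K‖ ^ 2 * ‖u - M.mean x‖) * ‖w‖ := by
  rw [inner_gradient_Phi hM hψ hs hx, ContinuousLinearMap.adjoint_inner_left]
  set ku := M.K (dualPoint M.ψ (M.K.adjoint u))
  set kx := M.K (dualPoint M.ψ (M.K.adjoint (M.mean x)))
  -- The Jacobian error is paired with the bounded vector `ku`, and the error of the dual point with
  -- the exact Jacobian, so no bound on `J` itself is required.
  have e : (inner ℝ ku (J w) : ℝ) - inner ℝ kx (M.meanJac x w) =
      inner ℝ ku ((J - M.meanJac x) w) + inner ℝ (ku - kx) (M.meanJac x w) := by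
    simp only [inner_sub_left, inner_sub_right, sub_apply]; ring
  have hMF := hF.MF_pos
  have hMψ := hψ.Mψ_pos
  have h1 : |(inner ℝ ku ((J - M.meanJac x) w) : ℝ)| ≤ (‖M.K‖ * Mψ) *
      (‖restrictVec M.tangent J - restrictVec M.tangent (M.meanJac x)‖ * ‖w‖) := by
    rw [← map_sub]
    exact (abs_real_inner_le_norm _ _).trans (mul_le_mul (norm_K_dualPoint_le hψ _)
      (norm_apply_le_restrictVec _ _ hw) (norm_nonneg _) (by positivity))
  have h2 : |(inner ℝ (ku - kx) (M.meanJac x w) : ℝ)| ≤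
      (‖M.K‖ ^ 2 * ‖u - M.mean x‖) * (MF * ‖w‖) :=
    (abs_real_inner_le_norm _ _).trans (mul_le_mul (norm_K_dualPoint_sub_le hψ hs _ _)
      (norm_meanJac_apply_le hM hF hψ hx hw) (norm_nonneg _) (by positivity))
  rw [e]
  refine (abs_add_le _ _).trans ((add_le_add h1 h2).trans (le_of_eq ?_))
  ring

variable (M) in
/-- A bound for the squared error of the gradient estimate, in terms of the errors of the estimates
of the function value and of the Jacobian. -/
noncomputable def errBound (MF Mψ : ℝ) (x : Euc p) (u : Euc q) (J : Euc p →L[ℝ] Euc q) : ℝ :=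
  2 * ‖M.K‖ ^ 2 * Mψ ^ 2 * ‖restrictVec M.tangent J - restrictVec M.tangent (M.meanJac x)‖ ^ 2
    + 2 * MF ^ 2 * ‖M.K‖ ^ 4 * ‖u - M.mean x‖ ^ 2

lemma errBound_nonneg (MF Mψ : ℝ) (x : Euc p) (u : Euc q) (J : Euc p →L[ℝ] Euc q) :
    0 ≤ M.errBound MF Mψ x u J := by
  rw [errBound]; positivity

/-- The gradient mapping is controlled by an inexact proximal gradient step. -/
lemma norm_gradMap_le (hM : M.Standing) (hψ : M.BoundedDualDomain Mψ) {η ε : ℝ} (hη : 0 < η)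
    (hε : 0 ≤ ε) {x v : Euc p}
    (herr : ∀ w ∈ M.tangent, |inner ℝ v w - inner ℝ (gradient M.Phi x) w| ≤ ε * ‖w‖) :
    ‖M.gradMap η x‖ ≤ η⁻¹ * ‖prox M.R η (x - η • v) - x‖ + ε := by
  set xhat := prox M.R η (x - η • v) with hxhat
  set w := prox M.R η (x - η • gradient M.Phi x) with hw
  have hwm : xhat - w ∈ M.tangent := sub_mem_tangent
    (by rw [dom_Psi hψ]; exact hM.R_convex.prox_mem_dom hη _)
    (by rw [dom_Psi hψ]; exact hM.R_convex.prox_mem_dom hη _)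
  -- Firm nonexpansiveness tests `∇Φ₀ - v` against the difference of two prox points, which is
  -- tangent; plain nonexpansiveness would need its full norm.
  have h1 : ‖xhat - w‖ ≤ η * ε := by
    have h2 := hM.R_convex.norm_prox_sub_sq_le hη (x - η • v) (x - η • gradient M.Phi x)
    rw [← hxhat, ← hw] at h2
    have h3 : (x - η • v) - (x - η • gradient M.Phi x) = η • (gradient M.Phi x - v) := by module
    rw [h3, inner_smul_right, inner_sub_right, real_inner_comm, real_inner_comm v] at h2
    have h4 := (abs_le.1 (herr _ hwm)).1
    have h5 : ‖xhat - w‖ ^ 2 ≤ η * (ε * ‖xhat - w‖) :=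
      h2.trans (mul_le_mul_of_nonneg_left (by linarith) hη.le)
    by_contra! h6
    have h7 : 0 < ‖xhat - w‖ := lt_of_le_of_lt (by positivity) h6
    nlinarith
  have h8 : ‖x - w‖ ≤ ‖xhat - x‖ + η * ε := by
    have h9 : x - w = -(xhat - x) + (xhat - w) := by abel
    rw [h9]
    exact (norm_add_le _ _).trans (by rw [norm_neg]; linarith)
  rw [gradMap, norm_smul, Real.norm_eq_abs, abs_of_pos (inv_pos.2 hη)]
  calc η⁻¹ * ‖x - w‖ ≤ η⁻¹ * (‖xhat - x‖ + η * ε) :=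
        mul_le_mul_of_nonneg_left h8 (inv_pos.2 hη).le
    _ = η⁻¹ * ‖xhat - x‖ + ε := by field_simp

/-- The prox inequality compared with `w = x`. The prox term and the growth term each give half of
the coefficient `η⁻¹`. -/
lemma _root_.HybridSGD.IsProperClosedConvex.prox_gradient_le {d : ℕ} {f : Euc d → EReal}
    (hf : IsProperClosedConvex f) {η : ℝ} (hη : 0 < η) {x : Euc d} (hx : x ∈ dom f) (v : Euc d) :
    (f (prox f η (x - η • v))).toReal ≤ (f x).toReal - inner ℝ v (prox f η (x - η • v) - x)
      - η⁻¹ * ‖prox f η (x - η • v) - x‖ ^ 2 := by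
  have h1 := hf.prox_le hη (x - η • v) hx
  set xhat := prox f η (x - η • v)
  have h2 : ‖xhat - (x - η • v)‖ ^ 2 =
      ‖xhat - x‖ ^ 2 + 2 * η * inner ℝ v (xhat - x) + ‖η • v‖ ^ 2 := by
    have : xhat - (x - η • v) = (xhat - x) + η • v := by abel
    rw [this, norm_add_sq_real, inner_smul_right, real_inner_comm]; ring
  rw [h2, sub_sub_cancel] at h1
  have h3 : (‖xhat - x‖ ^ 2 + 2 * η * inner ℝ v (xhat - x) + ‖η • v‖ ^ 2) / (2 * η) =
      ‖xhat - x‖ ^ 2 / (2 * η) + inner ℝ v (xhat - x) + ‖η • v‖ ^ 2 / (2 * η) := by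
    field_simp
  have h4 : η⁻¹ * ‖xhat - x‖ ^ 2 =
      ‖xhat - x‖ ^ 2 / (2 * η) + ‖xhat - x‖ ^ 2 / (2 * η) := by field_simp; ring
  rw [h3] at h1
  rw [h4]
  linarith

/-- The scalar inequality behind one step of the inexact proximal gradient method. -/
lemma step_arith {L θ d ε E g A B Φ Φ' R R' Rh : ℝ} (hL : 0 < L) (hθ : 0 < θ)
    (hE : ε ^ 2 ≤ E) (hg0 : 0 ≤ g) (hg : g ≤ 2 * L * d + ε)
    (hΦ : Φ' ≤ Φ + θ * A + L / 2 * (θ * d) ^ 2) (hR' : R' ≤ (1 - θ) * R + θ * Rh)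
    (hRh : Rh ≤ R - B - L * (3 + θ) / 2 * d ^ 2) (hAB : A - B ≤ ε * d) :
    Φ' + R' + θ / (16 * L) * g ^ 2 + L * θ / 2 * d ^ 2 ≤ Φ + R + 5 * θ / (8 * L) * E := by
  -- Budget: the prox step offers `θL(3+θ)/2 · d²`. Its `θ²` part cancels the smoothness term, and
  -- the rest is three portions `Lθ/2 · d²`: one for this Young inequality, one for the gradient
  -- mapping, one kept for the Lyapunov argument. The `ε²` terms add up to `θ/(2L) + θ/(8L) =
  -- 5θ/(8L)`.
  have hyoung : ε * d ≤ ε ^ 2 / (2 * L) + L * d ^ 2 / 2 := by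
    have : ε ^ 2 / (2 * L) + L * d ^ 2 / 2 - ε * d = (ε - L * d) ^ 2 / (2 * L) := by
      field_simp; ring
    have h2 : 0 ≤ (ε - L * d) ^ 2 / (2 * L) := by positivity
    linarith
  have hG2 : g ^ 2 ≤ 8 * L ^ 2 * d ^ 2 + 2 * ε ^ 2 := by
    have := pow_le_pow_left₀ hg0 hg 2
    nlinarith [sq_nonneg (2 * L * d - ε)]
  have hGs : θ / (16 * L) * g ^ 2 ≤ L * θ / 2 * d ^ 2 + θ / (8 * L) * ε ^ 2 := by
    refine (mul_le_mul_of_nonneg_left hG2 (by positivity)).trans (le_of_eq ?_)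
    field_simp
    ring
  have hEs : θ * (ε ^ 2 / (2 * L)) + θ / (8 * L) * ε ^ 2 ≤ 5 * θ / (8 * L) * E := by
    have : θ * (ε ^ 2 / (2 * L)) + θ / (8 * L) * ε ^ 2 = 5 * θ / (8 * L) * ε ^ 2 := by
      field_simp; ring
    rw [this]
    exact mul_le_mul_of_nonneg_left hE (by positivity)
  have h1 := mul_le_mul_of_nonneg_left hRh hθ.le
  have h2 := mul_le_mul_of_nonneg_left (hAB.trans hyoung) hθ.le
  linarith

/-- One step of the inexact proximal gradient method. -/
lemma Psi_step_le (hM : M.Standing) (hF : M.SmoothBoundedVariance LF σF σJ MF)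
    (hψ : M.BoundedDualDomain Mψ)
    (hs : StrongConvexOn (dom M.ψ) 1 (fun y => (M.ψ y).toReal)) {L θ η : ℝ}
    (hL : L = constL ‖M.K‖ LF MF Mψ) (hL0 : 0 < L) (hθ : θ ∈ Set.Ioc (0 : ℝ) 1)
    (hη : η = 2 / (L * (3 + θ))) {x xhat x' : Euc p} (hx : x ∈ dom M.Psi) (u : Euc q)
    (J : Euc p →L[ℝ] Euc q)
    (hxhat : xhat = prox M.R η (x - η • J.adjoint (M.K (dualPoint M.ψ (M.K.adjoint u)))))
    (hx' : x' = (1 - θ) • x + θ • xhat) :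
    x' ∈ dom M.Psi ∧ (M.Psi x').toReal + θ / (16 * L) * ‖M.gradMap η x‖ ^ 2
        + L * θ / 2 * ‖xhat - x‖ ^ 2
      ≤ (M.Psi x).toReal + 5 * θ / (8 * L) * M.errBound MF Mψ x u J := by
  have hθ0 := hθ.1
  have hη0 : 0 < η := by rw [hη]; positivity
  have hxR : x ∈ dom M.R := by rwa [← dom_Psi hψ]
  have hxhR : xhat ∈ dom M.R := by rw [hxhat]; exact hM.R_convex.prox_mem_dom hη0 _
  have hxhat_mem : xhat ∈ dom M.Psi := by rwa [dom_Psi hψ]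
  have hx'm : x' ∈ dom M.Psi := by
    rw [hx']
    exact convex_dom hM hψ hx hxhat_mem (sub_nonneg.2 hθ.2) hθ0.le (by ring)
  refine ⟨hx'm, ?_⟩
  set v := J.adjoint (M.K (dualPoint M.ψ (M.K.adjoint u))) with hv
  have hMF := hF.MF_pos
  have hMψ := hψ.Mψ_pos
  obtain ⟨ε, hε0, herr, hεE⟩ : ∃ ε : ℝ, 0 ≤ ε ∧
      (∀ w ∈ M.tangent, |inner ℝ v w - inner ℝ (gradient M.Phi x) w| ≤ ε * ‖w‖) ∧
      ε ^ 2 ≤ M.errBound MF Mψ x u J := by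
    refine ⟨_, ?_, fun w hw => abs_inner_estimate_sub_gradient_le hM hF hψ hs hx hw u J, ?_⟩
    · positivity
    · rw [errBound]
      generalize ‖restrictVec M.tangent J - restrictVec M.tangent (M.meanJac x)‖ = a
      generalize ‖u - M.mean x‖ = c
      nlinarith [sq_nonneg (‖M.K‖ * Mψ * a - MF * ‖M.K‖ ^ 2 * c)]
  have hηi : η⁻¹ = L * (3 + θ) / 2 := by rw [hη, inv_div]
  -- Here `θ ≤ 1` enters; this bounds the gradient mapping by `2L` times the step length plus the
  -- error.
  have hη2 : η⁻¹ ≤ 2 * L := by rw [hηi]; nlinarith [hθ.2]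
  rw [Psi_toReal hM hψ hx, Psi_toReal hM hψ hx'm]
  have hx'x : x' - x = θ • (xhat - x) := by rw [hx']; module
  refine step_arith (A := inner ℝ (gradient M.Phi x) (xhat - x)) (B := inner ℝ v (xhat - x))
    (Rh := (M.R xhat).toReal) (ε := ε) hL0 hθ0 hεE (norm_nonneg _) ?_ ?_ ?_ ?_ ?_
  · refine (norm_gradMap_le hM hψ hη0 hε0 herr).trans ?_
    rw [← hxhat]
    gcongr
  · have hPhi := Phi_le hM hF hψ hs hx hx'm
    rwa [hx'x, inner_smul_right, norm_smul, Real.norm_eq_abs, abs_of_pos hθ0, ← hL] at hPhi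
  · rw [hx']
    simpa using hM.R_convex.convex.2 hxR hxhR (sub_nonneg.2 hθ.2) hθ0.le (by ring)
  · have := hM.R_convex.prox_gradient_le hη0 hxR v
    rwa [← hxhat, hηi] at this
  · have := (abs_le.1 (herr _ (sub_mem_tangent hxhat_mem hx))).1
    linarith

end Problem

end HybridSGD

namespace HybridSGD

/-! ### Moments of mini-batch averages and of the hybrid estimator. -/

section Sampling

set_option linter.unusedSectionVars false

open Filter Topology

variable {Ω S H : Type*} [MeasurableSpace Ω] [MeasurableSpace S]
  [NormedAddCommGroup H] [InnerProductSpace ℝ H] [CompleteSpace H] [SecondCountableTopology H]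
  [MeasurableSpace H] [BorelSpace H] {μ : Measure Ω} [IsProbabilityMeasure μ]

lemma integral_inner_eq_zero_of_indepFun {X Y : Ω → H} (hXY : IndepFun X Y μ)
    (hX : Integrable X μ) (hY : Integrable Y μ) (h0 : ∫ ω, X ω ∂μ = 0) :
    ∫ ω, (inner ℝ (X ω) (Y ω) : ℝ) ∂μ = 0 := by
  have h := hXY.integral_bilin hX hY
    (isBoundedBilinearMap_inner (𝕜 := ℝ) (E := H)).toContinuousLinearMap
  rw [h0, map_zero] at h
  exact h

lemma integrable_inner_of_memLp {X Y : Ω → H} (hX : MemLp X 2 μ) (hY : MemLp Y 2 μ) :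
    Integrable (fun ω => (inner ℝ (X ω) (Y ω) : ℝ)) μ := by
  refine Integrable.mono' ((hX.integrable_norm_pow two_ne_zero).add
    (hY.integrable_norm_pow two_ne_zero)) (hX.1.inner hY.1) (ae_of_all _ fun ω => ?_)
  have h1 := norm_inner_le_norm (𝕜 := ℝ) (X ω) (Y ω)
  simp only [Pi.add_apply]
  nlinarith [sq_nonneg (‖X ω‖ - ‖Y ω‖), sq_nonneg (‖X ω‖), sq_nonneg (‖Y ω‖)]

/-- Variance is the second moment minus the squared norm of the mean. It allows sampled increments
to be centered without worsening their Lipschitz bound. -/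
lemma integral_norm_sub_integral_sq_le {X : Ω → H} (hX : MemLp X 2 μ) :
    ∫ ω, ‖X ω - ∫ ω', X ω' ∂μ‖ ^ 2 ∂μ ≤ ∫ ω, ‖X ω‖ ^ 2 ∂μ := by
  set m := ∫ ω', X ω' ∂μ with hm
  have hI := hX.integrable one_le_two
  have h2 := hX.integrable_norm_pow two_ne_zero
  have h3 : Integrable (fun ω => (inner ℝ (X ω) m : ℝ)) μ :=
    integrable_inner_of_memLp hX (memLp_const m)
  have h4 : ∫ ω, (inner ℝ (X ω) m : ℝ) ∂μ = ‖m‖ ^ 2 := by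
    simp_rw [real_inner_comm m]
    rw [integral_inner hI, ← hm, real_inner_self_eq_norm_sq]
  simp_rw [norm_sub_sq_real]
  rw [integral_add (f := fun ω => ‖X ω‖ ^ 2 - 2 * inner ℝ (X ω) m) (h2.sub (h3.const_mul 2))
    (integrable_const _), integral_sub h2 (h3.const_mul 2), integral_const_mul, h4]
  simp
  nlinarith [sq_nonneg ‖m‖]

lemma lintegral_enorm_sq_eq {X : Ω → H} (hX : MemLp X 2 μ) :
    ∫⁻ ω, ‖X ω‖ₑ ^ 2 ∂μ = ENNReal.ofReal (∫ ω, ‖X ω‖ ^ 2 ∂μ) := by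
  rw [ofReal_integral_eq_lintegral_ofReal (hX.integrable_norm_pow two_ne_zero)
    (ae_of_all _ fun ω => by positivity)]
  exact lintegral_congr fun ω => enorm_sq_eq_ofReal _

lemma integral_norm_sq_le_of_lintegral_le {X : Ω → H} (hX : MemLp X 2 μ) {c : ℝ} (hc : 0 ≤ c)
    (h : ∫⁻ ω, ‖X ω‖ₑ ^ 2 ∂μ ≤ ENNReal.ofReal c) : ∫ ω, ‖X ω‖ ^ 2 ∂μ ≤ c := by
  rwa [lintegral_enorm_sq_eq hX, ENNReal.ofReal_le_ofReal_iff hc] at h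

variable {P : Measure S} [IsProbabilityMeasure P] {N : ℕ}

/-- The average of a function over a mini-batch. -/
noncomputable def batchMean (g : S → H) (u : Fin N → S) : H := (1 / (N : ℝ)) • ∑ i, g (u i)

lemma measurable_batchMean {g : S → H} (hg : Measurable g) :
    Measurable (batchMean g : (Fin N → S) → H) := by
  exact (Finset.measurable_sum _ fun i _ => hg.comp (measurable_pi_apply i)).const_smul
    (1 / (N : ℝ))

/-- The average of a centered function over a mini-batch is centered, and its variance is
reduced by the size of the mini-batch. -/
lemma batchMean_moments {g : S → H} (hgm : Measurable g) (hg : MemLp g 2 P)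
    (h0 : ∫ ξ, g ξ ∂P = 0) {c : ℝ} (hc : ∫ ξ, ‖g ξ‖ ^ 2 ∂P ≤ c) {U : Ω → Fin N → S}
    (hU : Measurable U) (hlaw : μ.map U = Measure.pi (fun _ => P)) :
    MemLp (fun ω => batchMean g (U ω)) 2 μ ∧ ∫ ω, batchMean g (U ω) ∂μ = 0 ∧
      ∫ ω, ‖batchMean g (U ω)‖ ^ 2 ∂μ ≤ c / N := by
  have hUi : ∀ i, Measurable fun ω => U ω i := fun i => (measurable_pi_apply i).comp hU
  have hlawi : ∀ i, μ.map (fun ω => U ω i) = P := fun i => by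
    have h1 : μ.map (fun ω => U ω i) = (μ.map U).map (Function.eval i) :=
      (Measure.map_map (measurable_pi_apply i) hU).symm
    rw [h1, hlaw, (measurePreserving_eval _ i).map_eq]
  -- The product law of the batch encodes both independence of the entries and their common law `P`.
  have hindep : iIndepFun (fun i ω => U ω i) μ := by
    rw [iIndepFun_iff_map_fun_eq_pi_map fun i => (hUi i).aemeasurable]
    simp_rw [hlawi]
    exact hlaw
  have hX : ∀ i, MemLp (fun ω => g (U ω i)) 2 μ := fun i => by
    have : MemLp g 2 (μ.map fun ω => U ω i) := by rwa [hlawi i]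
    exact this.comp_measurePreserving ⟨hUi i, rfl⟩
  have hX0 : ∀ i, ∫ ω, g (U ω i) ∂μ = 0 := fun i => by
    rw [← h0, ← hlawi i, integral_map (hUi i).aemeasurable hgm.aestronglyMeasurable]
  have hXc : ∀ i, ∫ ω, ‖g (U ω i)‖ ^ 2 ∂μ ≤ c := fun i => by
    refine le_of_eq_of_le ?_ hc
    rw [← hlawi i, integral_map (hUi i).aemeasurable (hgm.norm.pow_const 2).aestronglyMeasurable]
  have hsum : MemLp (fun ω => ∑ i, g (U ω i)) 2 μ := memLp_finsetSum _ fun i _ => hX i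
  refine ⟨hsum.const_smul _, ?_, ?_⟩
  · simp only [batchMean]
    rw [integral_smul, integral_finsetSum _ fun i _ => (hX i).integrable one_le_two]
    simp [hX0]
  · have h1 : ∫ ω, ‖∑ i, g (U ω i)‖ ^ 2 ∂μ ≤ N * c := by
      -- In the double sum the off-diagonal terms have mean zero, which leaves `N` diagonal terms
      -- instead of `N²`.
      have h2 : ∀ ω, ‖∑ i, g (U ω i)‖ ^ 2 = ∑ i, ∑ j, (inner ℝ (g (U ω i)) (g (U ω j)) : ℝ) :=
        fun ω => by rw [← real_inner_self_eq_norm_sq, sum_inner]; simp_rw [inner_sum]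
      simp_rw [h2]
      rw [integral_finsetSum _ fun i _ => integrable_finsetSum _ fun j _ =>
        integrable_inner_of_memLp (hX i) (hX j)]
      have h3 : ∀ i, ∫ ω, ∑ j, (inner ℝ (g (U ω i)) (g (U ω j)) : ℝ) ∂μ ≤ c := fun i => by
        rw [integral_finsetSum _ fun j _ => integrable_inner_of_memLp (hX i) (hX j),
          Finset.sum_eq_single i]
        · simp_rw [real_inner_self_eq_norm_sq]
          exact hXc i
        · intro j _ hj
          exact integral_inner_eq_zero_of_indepFun ((hindep.indepFun hj.symm).comp hgm hgm)
            ((hX i).integrable one_le_two) ((hX j).integrable one_le_two) (hX0 i)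
        · simp
      refine (Finset.sum_le_sum fun i _ => h3 i).trans (by simp)
    simp only [batchMean, norm_smul, mul_pow]
    rw [integral_const_mul]
    rcases Nat.eq_zero_or_pos N with rfl | hN
    · simp
    · have hN' : (0 : ℝ) < N := by exact_mod_cast hN
      rw [Real.norm_eq_abs, sq_abs]
      refine (mul_le_mul_of_nonneg_left h1 (by positivity)).trans (le_of_eq ?_)
      field_simp

lemma norm_smul_add_smul_sq (x y : H) (a b : ℝ) :
    ‖a • x + b • y‖ ^ 2 = a ^ 2 * ‖x‖ ^ 2 + 2 * a * b * inner ℝ x y + b ^ 2 * ‖y‖ ^ 2 := by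
  rw [norm_add_sq_real, norm_smul, norm_smul, real_inner_smul_left, real_inner_smul_right, mul_pow,
    mul_pow, Real.norm_eq_abs, Real.norm_eq_abs, sq_abs, sq_abs]
  ring

lemma integral_norm_smul_add_smul_sq {A B : Ω → H} (hA : MemLp A 2 μ) (hB : MemLp B 2 μ)
    (a b : ℝ) : ∫ ω, ‖a • A ω + b • B ω‖ ^ 2 ∂μ = a ^ 2 * ∫ ω, ‖A ω‖ ^ 2 ∂μ +
      2 * a * b * ∫ ω, (inner ℝ (A ω) (B ω) : ℝ) ∂μ + b ^ 2 * ∫ ω, ‖B ω‖ ^ 2 ∂μ := by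
  have h1 := (hA.integrable_norm_pow two_ne_zero).const_mul (a ^ 2)
  have h2 := (integrable_inner_of_memLp hA hB).const_mul (2 * a * b)
  have h3 := (hB.integrable_norm_pow two_ne_zero).const_mul (b ^ 2)
  simp_rw [norm_smul_add_smul_sq]
  rw [integral_add (f := fun ω => a ^ 2 * ‖A ω‖ ^ 2 + 2 * a * b * inner ℝ (A ω) (B ω)) (h1.add h2)
    h3, integral_add h1 h2, integral_const_mul, integral_const_mul, integral_const_mul]

/-- Parallelogram law: the second moment of `a • A - b • B` is nonnegative. No independence is used,
and the factor two is the case `κ = 2`. -/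
lemma integral_norm_smul_add_smul_sq_le {A B : Ω → H} (hA : MemLp A 2 μ) (hB : MemLp B 2 μ)
    (a b : ℝ) : ∫ ω, ‖a • A ω + b • B ω‖ ^ 2 ∂μ ≤
      2 * (a ^ 2 * ∫ ω, ‖A ω‖ ^ 2 ∂μ + b ^ 2 * ∫ ω, ‖B ω‖ ^ 2 ∂μ) := by
  have h1 := integral_norm_smul_add_smul_sq hA hB a b
  have h2 := integral_norm_smul_add_smul_sq hA hB a (-b)
  have h3 : 0 ≤ ∫ ω, ‖a • A ω + (-b) • B ω‖ ^ 2 ∂μ := integral_nonneg fun ω => sq_nonneg _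
  linarith

/-- The second moment of a hybrid of two centered random vectors, shifted by a constant. -/
lemma integral_hybrid_sq_le {A B : Ω → H} (hA : MemLp A 2 μ) (hB : MemLp B 2 μ)
    (hA0 : ∫ ω, A ω ∂μ = 0) (hB0 : ∫ ω, B ω ∂μ = 0) {a b κ : ℝ} (ha : ∫ ω, ‖A ω‖ ^ 2 ∂μ ≤ a)
    (hb : ∫ ω, ‖B ω‖ ^ 2 ∂μ ≤ b) (hκ : (κ = 1 ∧ IndepFun A B μ) ∨ κ = 2) (f : H) (β : ℝ) :
    MemLp (fun ω => β • f + (β • A ω + (1 - β) • B ω)) 2 μ ∧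
    ∫ ω, ‖β • f + (β • A ω + (1 - β) • B ω)‖ ^ 2 ∂μ ≤
      β ^ 2 * ‖f‖ ^ 2 + κ * (β ^ 2 * a + (1 - β) ^ 2 * b) := by
  have hA' : MemLp (fun ω => β • A ω) 2 μ := hA.const_smul β
  have hB' : MemLp (fun ω => (1 - β) • B ω) 2 μ := hB.const_smul (1 - β)
  have hN : MemLp (fun ω => β • A ω + (1 - β) • B ω) 2 μ := hA'.add hB'
  have hN0 : ∫ ω, (β • A ω + (1 - β) • B ω) ∂μ = 0 := by
    rw [integral_add (hA'.integrable one_le_two) (hB'.integrable one_le_two),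
      integral_smul, integral_smul, hA0, hB0]
    simp
  have ha' := mul_le_mul_of_nonneg_left ha (sq_nonneg β)
  have hb' := mul_le_mul_of_nonneg_left hb (sq_nonneg (1 - β))
  have hN2 : ∫ ω, ‖β • A ω + (1 - β) • B ω‖ ^ 2 ∂μ ≤ κ * (β ^ 2 * a + (1 - β) ^ 2 * b) := by
    rcases hκ with ⟨rfl, hi⟩ | rfl
    · rw [integral_norm_smul_add_smul_sq hA hB, integral_inner_eq_zero_of_indepFun hi
        (hA.integrable one_le_two) (hB.integrable one_le_two) hA0]
      linarith
    · exact (integral_norm_smul_add_smul_sq_le hA hB _ _).trans (by linarith)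
  have hf : MemLp (fun _ : Ω => f) 2 μ := memLp_const f
  refine ⟨(memLp_const (β • f)).add hN, ?_⟩
  -- The constant part is orthogonal to centered noise, so the old error keeps the factor `β²`
  -- whether or not the two batches are independent.
  have h := integral_norm_smul_add_smul_sq hf hN β 1
  rw [integral_inner (hN.integrable one_le_two), hN0] at h
  simp only [one_smul, inner_zero_right, mul_zero, add_zero, one_pow, one_mul, integral_const,
    probReal_univ] at h
  rw [h]
  linarith

/-- Freezing the past: the inner integral plays the role of a conditional expectation given `X`. In
the nonnegative form no integrability has to be known beforehand. -/
lemma lintegral_comp_prod_of_indepFun {𝓧 𝓤 : Type*} [MeasurableSpace 𝓧] [MeasurableSpace 𝓤]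
    {X : Ω → 𝓧} {U : Ω → 𝓤} (hX : Measurable X) (hU : Measurable U) (hXU : IndepFun X U μ)
    {h : 𝓧 × 𝓤 → ENNReal} (hh : Measurable h) :
    ∫⁻ ω, h (X ω, U ω) ∂μ = ∫⁻ ω, ∫⁻ ω', h (X ω, U ω') ∂μ ∂μ := by
  have h1 := (indepFun_iff_map_prod_eq_prod_map_map hX.aemeasurable hU.aemeasurable).1 hXU
  rw [← lintegral_map hh (hX.prodMk hU), h1, lintegral_prod _ hh.aemeasurable,
    lintegral_map hh.lintegral_prod_right' hX]
  exact lintegral_congr fun ω => lintegral_map (hh.comp measurable_prodMk_left) hU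

/-- A family of random vectors `G x ξ`, `x ∈ s`, with mean `m x`, variance at most `σ²` and
mean-square Lipschitz constant `ℓ`. -/
structure IsOracle {p : ℕ} (P : Measure S) (s : Set (Euc p)) (G : Euc p → S → H) (m : Euc p → H)
    (ℓ σ : ℝ) : Prop where
  measurable : Measurable (fun z : Euc p × S => G z.1 z.2)
  measurable_mean : Measurable m
  memLp : ∀ x ∈ s, MemLp (G x) 2 P
  mean_eq : ∀ x ∈ s, ∫ ξ, G x ξ ∂P = m x
  variance : ∀ x ∈ s, ∫ ξ, ‖G x ξ - m x‖ ^ 2 ∂P ≤ σ ^ 2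
  lipschitz : ∀ x ∈ s, ∀ x' ∈ s, ∫ ξ, ‖G x' ξ - G x ξ‖ ^ 2 ∂P ≤ ℓ ^ 2 * ‖x' - x‖ ^ 2

variable {p : ℕ} {s : Set (Euc p)} {G : Euc p → S → H} {m : Euc p → H} {ℓ σ : ℝ}

lemma IsOracle.measurable_apply (hG : IsOracle P s G m ℓ σ) (x : Euc p) : Measurable (G x) :=
  hG.measurable.comp measurable_prodMk_left

/-- The initial estimate. -/
lemma IsOracle.lintegral_initial_le (hG : IsOracle P s G m ℓ σ) {x : Euc p} (hx : x ∈ s)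
    (hN : 0 < N) {U : Ω → Fin N → S} (hU : Measurable U)
    (hlaw : μ.map U = Measure.pi (fun _ => P)) :
    ∫⁻ ω, ‖(1 / (N : ℝ)) • ∑ i, G x (U ω i) - m x‖ₑ ^ 2 ∂μ ≤ ENNReal.ofReal (σ ^ 2 / N) := by
  have hN' : (N : ℝ) ≠ 0 := by exact_mod_cast hN.ne'
  have hg : MemLp (fun ξ => G x ξ - m x) 2 P := (hG.memLp x hx).sub (memLp_const _)
  have h0 : ∫ ξ, (G x ξ - m x) ∂P = 0 := by
    rw [integral_sub ((hG.memLp x hx).integrable one_le_two) (integrable_const _), hG.mean_eq x hx]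
    simp
  obtain ⟨h1, -, h3⟩ := batchMean_moments ((hG.measurable_apply x).sub_const _) hg h0
    (hG.variance x hx) hU hlaw
  have e : ∀ ω, (1 / (N : ℝ)) • ∑ i, G x (U ω i) - m x = batchMean (fun ξ => G x ξ - m x) (U ω) :=
    fun ω => by
      simp only [batchMean, Finset.sum_sub_distrib, smul_sub, Finset.sum_const, Finset.card_univ,
        Fintype.card_fin, ← Nat.cast_smul_eq_nsmul ℝ, smul_smul]
      rw [one_div_mul_cancel hN', one_smul]
  simp_rw [e]
  rw [lintegral_enorm_sq_eq h1]
  exact ENNReal.ofReal_le_ofReal h3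

/-- The hybrid estimator, as a function of the previous state and of two mini-batches. -/
noncomputable def hybridUpdate (G : Euc p → S → H) (β : ℝ) (z : H) (x x' : Euc p)
    (u₁ u₂ : Fin N → S) : H :=
  β • z + (β / (N : ℝ)) • ∑ i, (G x' (u₁ i) - G x (u₁ i)) + ((1 - β) / (N : ℝ)) • ∑ i, G x' (u₂ i)

lemma measurable_hybridUpdate (hG : Measurable (fun z : Euc p × S => G z.1 z.2)) (β : ℝ) :
    Measurable (fun w : (H × Euc p × Euc p) × ((Fin N → S) × (Fin N → S)) =>
      hybridUpdate G β w.1.1 w.1.2.1 w.1.2.2 w.2.1 w.2.2) := by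
  simp only [hybridUpdate]
  refine Measurable.add (Measurable.add ?_ ?_) ?_
  · exact (measurable_fst.comp measurable_fst).const_smul β
  · refine Measurable.const_smul (Finset.measurable_sum _ fun i _ => Measurable.sub ?_ ?_) _
    · exact hG.comp (Measurable.prodMk (by fun_prop) (by fun_prop))
    · exact hG.comp (Measurable.prodMk (by fun_prop) (by fun_prop))
  · refine Measurable.const_smul (Finset.measurable_sum _ fun i _ => ?_) _
    exact hG.comp (Measurable.prodMk (by fun_prop) (by fun_prop))

lemma IsOracle.lintegral_hybridUpdate_const_le (hG : IsOracle P s G m ℓ σ) (hN : 0 < N)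
    {U₁ U₂ : Ω → Fin N → S} (hU₁ : Measurable U₁) (hU₂ : Measurable U₂)
    (hlaw₁ : μ.map U₁ = Measure.pi (fun _ => P)) (hlaw₂ : μ.map U₂ = Measure.pi (fun _ => P))
    {κ : ℝ} (hκ : (κ = 1 ∧ IndepFun U₁ U₂ μ) ∨ κ = 2) (β : ℝ) (z : H) {x x' : Euc p}
    (hx : x ∈ s) (hx' : x' ∈ s) :
    ∫⁻ ω, ‖hybridUpdate G β z x x' (U₁ ω) (U₂ ω) - m x'‖ₑ ^ 2 ∂μ ≤ ENNReal.ofReal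
      (β ^ 2 * ‖z - m x‖ ^ 2 + κ * (β ^ 2 * (ℓ ^ 2 * ‖x' - x‖ ^ 2 / N)
        + (1 - β) ^ 2 * (σ ^ 2 / N))) := by
  have hN' : (N : ℝ) ≠ 0 := by exact_mod_cast hN.ne'
  have hI := fun x hx => (hG.memLp x hx).integrable one_le_two
  set g₁ : S → H := fun ξ => G x' ξ - G x ξ - (m x' - m x) with hg₁
  set g₂ : S → H := fun ξ => G x' ξ - m x' with hg₂
  have hd : MemLp (fun ξ => G x' ξ - G x ξ) 2 P := (hG.memLp x' hx').sub (hG.memLp x hx)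
  have hdm : ∫ ξ, (G x' ξ - G x ξ) ∂P = m x' - m x := by
    rw [integral_sub (hI x' hx') (hI x hx), hG.mean_eq x hx, hG.mean_eq x' hx']
  have hg₁L : MemLp g₁ 2 P := hd.sub (memLp_const _)
  have hg₂L : MemLp g₂ 2 P := (hG.memLp x' hx').sub (memLp_const _)
  have hg₁m : Measurable g₁ := ((hG.measurable_apply x').sub (hG.measurable_apply x)).sub_const _
  have hg₂m : Measurable g₂ := (hG.measurable_apply x').sub_const _
  have hg₁0 : ∫ ξ, g₁ ξ ∂P = 0 := by
    rw [hg₁, integral_sub (hd.integrable one_le_two) (integrable_const _), hdm]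
    simp
  have hg₂0 : ∫ ξ, g₂ ξ ∂P = 0 := by
    rw [hg₂, integral_sub (hI x' hx') (integrable_const _), hG.mean_eq x' hx']
    simp
  have hg₁c : ∫ ξ, ‖g₁ ξ‖ ^ 2 ∂P ≤ ℓ ^ 2 * ‖x' - x‖ ^ 2 := by
    have := integral_norm_sub_integral_sq_le hd
    rw [hdm] at this
    exact this.trans (hG.lipschitz x hx x' hx')
  obtain ⟨a1, a2, a3⟩ := batchMean_moments hg₁m hg₁L hg₁0 hg₁c hU₁ hlaw₁
  obtain ⟨b1, b2, b3⟩ := batchMean_moments hg₂m hg₂L hg₂0 (hG.variance x' hx') hU₂ hlaw₂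
  obtain ⟨c1, c2⟩ := integral_hybrid_sq_le a1 b1 a2 b2 a3 b3
    (hκ.imp_left fun h => ⟨h.1, h.2.comp (measurable_batchMean hg₁m) (measurable_batchMean hg₂m)⟩)
    (z - m x) β
  -- Subtracting `m x'` centers both batches: the increments by `m x' - m x`, the fresh values by `m
  -- x'`; what is left is `β` times the old error.
  have e : ∀ ω, hybridUpdate G β z x x' (U₁ ω) (U₂ ω) - m x' = β • (z - m x) +
      (β • batchMean g₁ (U₁ ω) + (1 - β) • batchMean g₂ (U₂ ω)) := fun ω => by
    simp only [hybridUpdate, batchMean, hg₁, hg₂, Finset.sum_sub_distrib, Finset.sum_const,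
      Finset.card_univ, Fintype.card_fin, ← Nat.cast_smul_eq_nsmul ℝ]
    match_scalars <;> field_simp <;> ring
  simp_rw [e]
  rw [lintegral_enorm_sq_eq c1]
  exact ENNReal.ofReal_le_ofReal c2

/-- The recursion for the mean-square error of the hybrid estimator. -/
lemma IsOracle.lintegral_hybridUpdate_le (hG : IsOracle P s G m ℓ σ) (hN : 0 < N)
    {U₁ U₂ : Ω → Fin N → S} (hU₁ : Measurable U₁) (hU₂ : Measurable U₂)
    (hlaw₁ : μ.map U₁ = Measure.pi (fun _ => P)) (hlaw₂ : μ.map U₂ = Measure.pi (fun _ => P))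
    {κ : ℝ} (hκ : (κ = 1 ∧ IndepFun U₁ U₂ μ) ∨ κ = 2) (β : ℝ) {Z : Ω → H} {X X' : Ω → Euc p}
    (hZ : Measurable Z) (hX : Measurable X) (hX' : Measurable X')
    (hind : IndepFun (fun ω => (Z ω, X ω, X' ω)) (fun ω => (U₁ ω, U₂ ω)) μ)
    (hXs : ∀ ω, X ω ∈ s) (hX's : ∀ ω, X' ω ∈ s) :
    ∫⁻ ω, ‖hybridUpdate G β (Z ω) (X ω) (X' ω) (U₁ ω) (U₂ ω) - m (X' ω)‖ₑ ^ 2 ∂μ ≤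
      ∫⁻ ω, ENNReal.ofReal (β ^ 2 * ‖Z ω - m (X ω)‖ ^ 2 +
        κ * (β ^ 2 * (ℓ ^ 2 * ‖X' ω - X ω‖ ^ 2 / N) + (1 - β) ^ 2 * (σ ^ 2 / N))) ∂μ := by
  have hm : Measurable (fun w : (H × Euc p × Euc p) × ((Fin N → S) × (Fin N → S)) =>
      ‖hybridUpdate G β w.1.1 w.1.2.1 w.1.2.2 w.2.1 w.2.2 - m w.1.2.2‖ₑ ^ 2) :=
    (((measurable_hybridUpdate hG.measurable β).sub
      (hG.measurable_mean.comp (by fun_prop))).enorm).pow_const 2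
  have h := lintegral_comp_prod_of_indepFun (hZ.prodMk (hX.prodMk hX')) (hU₁.prodMk hU₂) hind hm
  simp only at h
  rw [h]
  exact lintegral_mono fun ω =>
    hG.lintegral_hybridUpdate_const_le hN hU₁ hU₂ hlaw₁ hlaw₂ hκ β (Z ω) (hXs ω) (hX's ω)

end Sampling

end HybridSGD

namespace HybridSGD

open Filter Topology

/-! ### Square-integrable errors; `F` and its restricted Jacobian as oracles. -/

section Oracle

variable {Ω S H : Type*} [MeasurableSpace Ω] [MeasurableSpace S]
  [NormedAddCommGroup H] [InnerProductSpace ℝ H] [CompleteSpace H] [SecondCountableTopology H]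
  [MeasurableSpace H] [BorelSpace H] {μ : Measure Ω} [IsProbabilityMeasure μ]
  {P : Measure S} [IsProbabilityMeasure P] {N p : ℕ}
  {s : Set (Euc p)} {G : Euc p → S → H} {m : Euc p → H} {ℓ σ : ℝ}

lemma IsOracle.memLp_initial (hG : IsOracle P s G m ℓ σ) {x : Euc p} (hx : x ∈ s)
    (hN : 0 < N) {U : Ω → Fin N → S} (hU : Measurable U)
    (hlaw : μ.map U = Measure.pi (fun _ => P)) :
    MemLp (fun ω => (1 / (N : ℝ)) • ∑ i, G x (U ω i) - m x) 2 μ ∧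
      ∫ ω, ‖(1 / (N : ℝ)) • ∑ i, G x (U ω i) - m x‖ ^ 2 ∂μ ≤ σ ^ 2 / N := by
  have hm : Measurable (fun ω => (1 / (N : ℝ)) • ∑ i, G x (U ω i) - m x) :=
    (((measurable_batchMean (hG.measurable_apply x)).comp hU)).sub_const (m x)
  have h := hG.lintegral_initial_le hx hN hU hlaw
  have hL := memLp_two_of_lintegral_le hm.aestronglyMeasurable h
  exact ⟨hL, integral_norm_sq_le_of_lintegral_le hL (by positivity) h⟩

/-- The bound between nonnegative integrals has an integrable right side, which yields
square-integrability of the new error and the recursion for real integrals together. -/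
lemma IsOracle.memLp_hybridUpdate (hG : IsOracle P s G m ℓ σ) (hN : 0 < N)
    {U₁ U₂ : Ω → Fin N → S} (hU₁ : Measurable U₁) (hU₂ : Measurable U₂)
    (hlaw₁ : μ.map U₁ = Measure.pi (fun _ => P)) (hlaw₂ : μ.map U₂ = Measure.pi (fun _ => P))
    {κ : ℝ} (hκ : (κ = 1 ∧ IndepFun U₁ U₂ μ) ∨ κ = 2) (β : ℝ) {Z : Ω → H} {X X' : Ω → Euc p}
    (hZ : Measurable Z) (hX : Measurable X) (hX' : Measurable X')
    (hind : IndepFun (fun ω => (Z ω, X ω, X' ω)) (fun ω => (U₁ ω, U₂ ω)) μ)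
    (hXs : ∀ ω, X ω ∈ s) (hX's : ∀ ω, X' ω ∈ s) (hZL : MemLp (fun ω => Z ω - m (X ω)) 2 μ)
    (hXL : Integrable (fun ω => ‖X' ω - X ω‖ ^ 2) μ) :
    MemLp (fun ω => hybridUpdate G β (Z ω) (X ω) (X' ω) (U₁ ω) (U₂ ω) - m (X' ω)) 2 μ ∧
      ∫ ω, ‖hybridUpdate G β (Z ω) (X ω) (X' ω) (U₁ ω) (U₂ ω) - m (X' ω)‖ ^ 2 ∂μ ≤
        β ^ 2 * ∫ ω, ‖Z ω - m (X ω)‖ ^ 2 ∂μ +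
          κ * (β ^ 2 * (ℓ ^ 2 * (∫ ω, ‖X' ω - X ω‖ ^ 2 ∂μ) / N) + (1 - β) ^ 2 * (σ ^ 2 / N)) := by
  have hκ0 : 0 ≤ κ := by rcases hκ with ⟨rfl, -⟩ | rfl <;> norm_num
  have hm : Measurable
      (fun ω => hybridUpdate G β (Z ω) (X ω) (X' ω) (U₁ ω) (U₂ ω) - m (X' ω)) :=
    ((measurable_hybridUpdate hG.measurable β).comp
      ((hZ.prodMk (hX.prodMk hX')).prodMk (hU₁.prodMk hU₂))).sub (hG.measurable_mean.comp hX')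
  have h := hG.lintegral_hybridUpdate_le hN hU₁ hU₂ hlaw₁ hlaw₂ hκ β hZ hX hX' hind hXs hX's
  have i1 := (hZL.integrable_norm_pow two_ne_zero).const_mul (β ^ 2)
  have i2 : Integrable (fun ω => β ^ 2 * (ℓ ^ 2 * ‖X' ω - X ω‖ ^ 2 / N)) μ :=
    ((hXL.const_mul (ℓ ^ 2)).div_const _).const_mul _
  have i3 : Integrable (fun ω => κ * (β ^ 2 * (ℓ ^ 2 * ‖X' ω - X ω‖ ^ 2 / N) +
      (1 - β) ^ 2 * (σ ^ 2 / N))) μ := (i2.add (integrable_const _)).const_mul κ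
  have i4 : Integrable (fun ω => β ^ 2 * ‖Z ω - m (X ω)‖ ^ 2 +
      κ * (β ^ 2 * (ℓ ^ 2 * ‖X' ω - X ω‖ ^ 2 / N) + (1 - β) ^ 2 * (σ ^ 2 / N))) μ := i1.add i3
  rw [← ofReal_integral_eq_lintegral_ofReal i4
    (ae_of_all _ fun ω => by simp only [Pi.zero_apply]; positivity)] at h
  have hL := memLp_two_of_lintegral_le hm.aestronglyMeasurable h
  refine ⟨hL, (integral_norm_sq_le_of_lintegral_le hL ?_ h).trans (le_of_eq ?_)⟩
  · exact integral_nonneg fun ω => by simp only [Pi.zero_apply]; positivity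
  · rw [integral_add i1 i3, integral_const_mul, integral_const_mul,
      integral_add i2 (integrable_const _), integral_const_mul, integral_div, integral_const_mul]
    simp [mul_div_assoc]

end Oracle

namespace Problem

variable {p q n : ℕ} {S : Type*} [MeasurableSpace S] {M : Problem p q n S}
  {LF σF σJ MF Mψ : ℝ}

lemma measurable_mean (hM : M.Standing) : Measurable M.mean := by
  have := hM.isProb
  exact hM.measurable_F.stronglyMeasurable.integral_prod_right'.measurable

lemma isOracle_F (hM : M.Standing) (hF : M.SmoothBoundedVariance LF σF σJ MF)
    (hψ : M.BoundedDualDomain Mψ) : IsOracle M.P (dom M.Psi) M.F M.mean MF σF := by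
  have := hM.isProb
  have hL : ∀ x ∈ dom M.Psi, MemLp (M.F x) 2 M.P := fun x hx => by
    have h1 : MemLp (fun ξ => M.F x ξ - M.mean x) 2 M.P :=
      (memLp_two_iff_integrable_sq_norm
        ((measurable_F_of hM x).sub_const _).aestronglyMeasurable).2 (hF.variance_F x hx).1
    have h2 := h1.add (memLp_const (M.mean x))
    refine h2.ae_eq (ae_of_all _ fun ξ => ?_)
    simp
  refine ⟨hM.measurable_F, measurable_mean hM, hL, fun x _ => rfl,
    fun x hx => (hF.variance_F x hx).2, fun x hx x' hx' => ?_⟩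
  exact integral_norm_sq_le_of_lintegral_le ((hL x' hx').sub (hL x hx)) (by positivity)
    (lintegral_F_sub_sq_le hM hF hψ hx hx')

variable (M) in
/-- The sampled Jacobian, restricted to the tangent directions of the domain. -/
noncomputable def jacVec (x : Euc p) (ξ : S) :
    EuclideanSpace ℝ (Fin (Module.finrank ℝ M.tangent) × Fin q) :=
  (dom M.Psi).indicator (fun x => restrictVec M.tangent (M.jac x ξ)) x

lemma jacVec_of_mem {x : Euc p} (hx : x ∈ dom M.Psi) (ξ : S) :
    M.jacVec x ξ = restrictVec M.tangent (M.jac x ξ) := Set.indicator_of_mem hx _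

lemma measurable_jacVec (hM : M.Standing) (hψ : M.BoundedDualDomain Mψ) :
    Measurable (fun z : Euc p × S => M.jacVec z.1 z.2) := by
  have h : Measurable (fun z : Euc p × S => (WithLp.toLp 2
      fun kj : Fin (Module.finrank ℝ M.tangent) × Fin q =>
      (Prod.fst ⁻¹' dom M.Psi).indicator (fun z : Euc p × S =>
        M.jac z.1 z.2 (stdOrthonormalBasis ℝ M.tangent kj.1 : Euc p)) z kj.2 :
      EuclideanSpace ℝ (Fin (Module.finrank ℝ M.tangent) × Fin q))) := by
    refine (WithLp.measurable_toLp 2 _).comp (measurable_pi_iff.2 fun kj => ?_)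
    have h1 := measurable_jac_apply hM hψ (stdOrthonormalBasis ℝ M.tangent kj.1 : Euc p)
    have h2 : Measurable fun v : Euc q => v kj.2 := by fun_prop
    exact h2.comp h1
  convert h using 2 with z
  ext kj
  by_cases hz : z.1 ∈ dom M.Psi
  · rw [jacVec_of_mem hz, restrictVec_apply]
    simp [hz]
  · simp [jacVec, hz]

lemma measurable_jacVec_apply (hM : M.Standing) (hψ : M.BoundedDualDomain Mψ) (x : Euc p) :
    Measurable (M.jacVec x) := Measurable.of_uncurry_left (f := M.jacVec) (measurable_jacVec hM hψ)

lemma lintegral_jacVec_sub_sq_le (hF : M.SmoothBoundedVariance LF σF σJ MF) {x : Euc p}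
    (hx : x ∈ dom M.Psi) :
    ∫⁻ ξ, ‖M.jacVec x ξ - restrictVec M.tangent (M.meanJac x)‖ₑ ^ 2 ∂M.P
      ≤ ENNReal.ofReal (σJ ^ 2) := by
  obtain ⟨h1, h2⟩ := hF.variance_jac x hx
  refine lintegral_enorm_sq_le_of_integral_le h1 (fun ξ => ?_) h2
  rw [jacVec_of_mem hx, ← map_sub]
  exact norm_restrictVec_sq_le_frobSq _ _

lemma memLp_jacVec_sub (hM : M.Standing) (hF : M.SmoothBoundedVariance LF σF σJ MF)
    (hψ : M.BoundedDualDomain Mψ) {x : Euc p} (hx : x ∈ dom M.Psi) :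
    MemLp (fun ξ => M.jacVec x ξ - restrictVec M.tangent (M.meanJac x)) 2 M.P :=
  memLp_two_of_lintegral_le ((measurable_jacVec_apply hM hψ x).sub_const _).aestronglyMeasurable
    (lintegral_jacVec_sub_sq_le hF hx)

lemma memLp_jacVec (hM : M.Standing) (hF : M.SmoothBoundedVariance LF σF σJ MF)
    (hψ : M.BoundedDualDomain Mψ) {x : Euc p} (hx : x ∈ dom M.Psi) :
    MemLp (M.jacVec x) 2 M.P := by
  have := hM.isProb
  have h2 := (memLp_jacVec_sub hM hF hψ hx).add
    (memLp_const (restrictVec M.tangent (M.meanJac x)))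
  refine h2.ae_eq (ae_of_all _ fun ξ => ?_)
  simp

lemma _root_.HybridSGD.integral_euclidean_apply {ι Ω : Type*} [Fintype ι] [MeasurableSpace Ω]
    {μ : Measure Ω} {X : Ω → EuclideanSpace ℝ ι} (hX : Integrable X μ) (i : ι) :
    (∫ ω, X ω ∂μ) i = ∫ ω, X ω i ∂μ :=
  ((EuclideanSpace.proj i : EuclideanSpace ℝ ι →L[ℝ] ℝ).integral_comp_comm hX).symm

lemma integral_jacVec (hM : M.Standing) (hF : M.SmoothBoundedVariance LF σF σJ MF)
    (hψ : M.BoundedDualDomain Mψ) {x : Euc p} (hx : x ∈ dom M.Psi) :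
    ∫ ξ, M.jacVec x ξ ∂M.P = restrictVec M.tangent (M.meanJac x) := by
  have := hM.isProb
  ext kj
  rw [integral_euclidean_apply ((memLp_jacVec hM hF hψ hx).integrable one_le_two),
    restrictVec_apply,
    ← integral_jac_apply hM hF hψ hx (stdOrthonormalBasis ℝ M.tangent kj.1).2,
    integral_euclidean_apply ((integrable_jac_apply hM hF hψ hx _).1.integrable one_le_two)]
  refine integral_congr_ae (ae_of_all _ fun ξ => ?_)
  simp only
  rw [jacVec_of_mem hx, restrictVec_apply]

variable (M) in
/-- The expectation of the sampled Jacobian, restricted to the tangent directions. -/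
noncomputable def meanJacVec (x : Euc p) :
    EuclideanSpace ℝ (Fin (Module.finrank ℝ M.tangent) × Fin q) := ∫ ξ, M.jacVec x ξ ∂M.P

/-- The mean is taken to be the integral, which is measurable in `x` everywhere. On the domain it is
the restriction of `meanJac`, so the Frobenius assumptions supply the variance and Lipschitz bounds.
-/
lemma isOracle_jacVec (hM : M.Standing) (hF : M.SmoothBoundedVariance LF σF σJ MF)
    (hψ : M.BoundedDualDomain Mψ) :
    IsOracle M.P (dom M.Psi) M.jacVec M.meanJacVec LF σJ := by
  have := hM.isProb
  have hm := measurable_jacVec hM hψ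
  refine ⟨hm, hm.stronglyMeasurable.integral_prod_right'.measurable,
    fun x hx => memLp_jacVec hM hF hψ hx, fun x _ => rfl, fun x hx => ?_, fun x hx x' hx' => ?_⟩
  · rw [meanJacVec, integral_jacVec hM hF hψ hx]
    exact integral_norm_sq_le_of_lintegral_le (memLp_jacVec_sub hM hF hψ hx) (sq_nonneg _)
      (lintegral_jacVec_sub_sq_le hF hx)
  · refine integral_norm_sq_le_of_lintegral_le
      ((memLp_jacVec hM hF hψ hx').sub (memLp_jacVec hM hF hψ hx)) (by positivity) ?_
    simp_rw [Pi.sub_apply, jacVec_of_mem hx, jacVec_of_mem hx']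
    exact lintegral_restrictVec_jac_sub_sq_le hF M.tangent hx' hx

lemma measurable_Phi (hM : M.Standing) (hψ : M.BoundedDualDomain Mψ)
    (hs : StrongConvexOn (dom M.ψ) 1 (fun y => (M.ψ y).toReal)) : Measurable M.Phi := by
  have h : Continuous (fun u => (M.phi u).toReal) :=
    continuous_iff_continuousAt.2 fun u => (hasFDerivAt_phi hψ hs u).continuousAt
  exact h.measurable.comp (measurable_mean hM)

/-- The generic statement on directional derivatives, used with a one-point sample space. -/
lemma measurable_indicator_fderiv_Phi (hM : M.Standing) (hψ : M.BoundedDualDomain Mψ)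
    (hs : StrongConvexOn (dom M.ψ) 1 (fun y => (M.ψ y).toReal)) (v : Euc p) :
    Measurable ((dom M.Psi).indicator fun x => fderiv ℝ M.Phi x v) := by
  have h := measurable_indicator_fderiv_apply (S := Unit) (F := fun x _ => M.Phi x)
    ((measurable_Phi hM hψ hs).comp measurable_fst) (measurableSet_dom hM hψ)
    (fun _ x hx => (hasFDerivAt_Phi hM hψ hs hx).differentiableAt) v
  have h' := h.comp (measurable_id.prodMk (measurable_const (a := ())))
  convert h' using 1
  ext x
  by_cases hx : x ∈ dom M.Psi <;> simp [hx]

lemma gradient_apply_eq_fderiv (f : Euc p → ℝ) (x : Euc p) (i : Fin p) :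
    gradient f x i = fderiv ℝ f x (EuclideanSpace.single i 1) := by
  rw [← InnerProductSpace.toDual_symm_apply (𝕜 := ℝ) (y := fderiv ℝ f x),
    EuclideanSpace.inner_single_right]
  simp [gradient]

lemma measurable_indicator_gradient_Phi (hM : M.Standing) (hψ : M.BoundedDualDomain Mψ)
    (hs : StrongConvexOn (dom M.ψ) 1 (fun y => (M.ψ y).toReal)) :
    Measurable ((dom M.Psi).indicator (gradient M.Phi)) := by
  have h2 : Measurable (fun x => (WithLp.toLp 2 fun i : Fin p => (dom M.Psi).indicator
      (fun x => fderiv ℝ M.Phi x (EuclideanSpace.single i 1)) x : Euc p)) :=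
    (WithLp.measurable_toLp 2 _).comp
      (measurable_pi_iff.2 fun i => measurable_indicator_fderiv_Phi hM hψ hs _)
  convert h2 using 1
  ext x i
  by_cases hx : x ∈ dom M.Psi
  · simp only [Set.indicator_of_mem hx, gradient_apply_eq_fderiv]
  · simp [hx]

lemma measurable_gradMap_comp {Ω : Type*} {mΩ : MeasurableSpace Ω} (hM : M.Standing)
    (hψ : M.BoundedDualDomain Mψ)
    (hs : StrongConvexOn (dom M.ψ) 1 (fun y => (M.ψ y).toReal)) {η : ℝ} (hη : 0 < η)
    {X : Ω → Euc p} (hX : Measurable X) (hXd : ∀ ω, X ω ∈ dom M.Psi) :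
    Measurable (fun ω => M.gradMap η (X ω)) := by
  have h1 : Measurable (fun ω => gradient M.Phi (X ω)) := by
    convert (measurable_indicator_gradient_Phi hM hψ hs).comp hX using 2 with ω
    simp [hXd ω]
  have h2 : Measurable (fun ω => prox M.R η (X ω - η • gradient M.Phi (X ω))) :=
    (hM.R_convex.continuous_prox hη).measurable.comp (hX.sub (h1.const_smul η))
  exact (hX.sub h2).const_smul η⁻¹

lemma measurable_Psi_toReal_comp {Ω : Type*} [MeasurableSpace Ω] (hM : M.Standing)
    (hψ : M.BoundedDualDomain Mψ)
    (hs : StrongConvexOn (dom M.ψ) 1 (fun y => (M.ψ y).toReal))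
    {X : Ω → Euc p} (hX : Measurable X) (hXd : ∀ ω, X ω ∈ dom M.Psi) :
    Measurable (fun ω => (M.Psi (X ω)).toReal) := by
  simp_rw [fun ω => Psi_toReal hM hψ (hXd ω)]
  exact ((measurable_Phi hM hψ hs).comp hX).add
    ((hM.R_convex.closed.measurable.comp hX).ereal_toReal)

end Problem

end HybridSGD

namespace HybridSGD

open Filter Topology

/-! ### The filtration of the samples and the freshness of each round. -/

namespace Batches

variable {Ω S : Type*} [MeasurableSpace S] {b₀ b₀' b₁ b₂ b₁' b₂' : ℕ}
  {B : Batches Ω S b₀ b₀' b₁ b₂ b₁' b₂'}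

lemma round_le_history {s t : ℕ} (hs : s ∈ Set.Icc 1 t) : B.round s ≤ B.history t :=
  le_sup_of_le_right (le_iSup₂ (f := fun s (_ : s ∈ Set.Icc 1 t) => B.round s) s hs)

lemma history_mono {s t : ℕ} (h : s ≤ t) : B.history s ≤ B.history t :=
  sup_le_sup_left (iSup₂_le fun r hr =>
    le_iSup₂ (f := fun s (_ : s ∈ Set.Icc 1 t) => B.round s) r ⟨hr.1, hr.2.trans h⟩) _

lemma measurable_F0_history (t : ℕ) : Measurable[B.history t] B.F0 :=
  (comap_measurable B.F0).mono (le_sup_of_le_left le_sup_left) le_rfl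

lemma measurable_J0_history (t : ℕ) : Measurable[B.history t] B.J0 :=
  (comap_measurable B.J0).mono (le_sup_of_le_left le_sup_right) le_rfl

lemma measurable_F1_round (t : ℕ) : Measurable[B.round t] (B.F1 t) :=
  (comap_measurable (B.F1 t)).mono (le_sup_of_le_left (le_sup_of_le_left le_sup_left)) le_rfl

lemma measurable_F2_round (t : ℕ) : Measurable[B.round t] (B.F2 t) :=
  (comap_measurable (B.F2 t)).mono (le_sup_of_le_left (le_sup_of_le_left le_sup_right)) le_rfl

lemma measurable_J1_round (t : ℕ) : Measurable[B.round t] (B.J1 t) :=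
  (comap_measurable (B.J1 t)).mono (le_sup_of_le_left le_sup_right) le_rfl

lemma measurable_J2_round (t : ℕ) : Measurable[B.round t] (B.J2 t) :=
  (comap_measurable (B.J2 t)).mono le_sup_right le_rfl

lemma IsSampling.round_le [mΩ : MeasurableSpace Ω] {P : Measure S} {μ : Measure Ω}
    (hB : B.IsSampling P μ) {t : ℕ} (ht : 1 ≤ t) : B.round t ≤ mΩ :=
  sup_le (sup_le (sup_le (hB.measurable_F1 t ht).comap_le (hB.measurable_F2 t ht).comap_le)
    (hB.measurable_J1 t ht).comap_le) (hB.measurable_J2 t ht).comap_le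

lemma IsSampling.history_le [mΩ : MeasurableSpace Ω] {P : Measure S} {μ : Measure Ω}
    (hB : B.IsSampling P μ) (t : ℕ) : B.history t ≤ mΩ :=
  sup_le (sup_le hB.measurable_F0.comap_le hB.measurable_J0.comap_le)
    (iSup₂_le fun _ hs => hB.round_le hs.1)

lemma IsSampling.indepFun [mΩ : MeasurableSpace Ω] {P : Measure S} {μ : Measure Ω}
    (hB : B.IsSampling P μ) {t : ℕ} {𝓧 𝓤 : Type*} [MeasurableSpace 𝓧] [MeasurableSpace 𝓤]
    {X : Ω → 𝓧} {U : Ω → 𝓤} (hX : Measurable[B.history t] X)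
    (hU : Measurable[B.round (t + 1)] U) : IndepFun X U μ := by
  rw [IndepFun_iff_Indep]
  exact indep_of_indep_of_le_left (indep_of_indep_of_le_right (hB.fresh t).symm hU.comap_le)
    hX.comap_le

lemma kappaF_spec [MeasurableSpace Ω] (μ : Measure Ω) {t : ℕ} (ht : 1 ≤ t) :
    (B.kappaF μ = 1 ∧ IndepFun (B.F1 t) (B.F2 t) μ) ∨ B.kappaF μ = 2 := by
  rw [kappaF]
  split_ifs with h
  · exact Or.inl ⟨rfl, h t ht⟩
  · exact Or.inr rfl

lemma kappaJ_spec [MeasurableSpace Ω] (μ : Measure Ω) {t : ℕ} (ht : 1 ≤ t) :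
    (B.kappaJ μ = 1 ∧ IndepFun (B.J1 t) (B.J2 t) μ) ∨ B.kappaJ μ = 2 := by
  rw [kappaJ]
  split_ifs with h
  · exact Or.inl ⟨rfl, h t ht⟩
  · exact Or.inr rfl

lemma one_le_kappaF [MeasurableSpace Ω] (μ : Measure Ω) : 1 ≤ B.kappaF μ := by
  rw [kappaF]; split_ifs <;> norm_num

lemma one_le_kappaJ [MeasurableSpace Ω] (μ : Measure Ω) : 1 ≤ B.kappaJ μ := by
  rw [kappaJ]; split_ifs <;> norm_num

end Batches

/-! ### Adaptedness of the run and the error recursions. -/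

section Run

variable {p q n : ℕ} {S : Type*} [MeasurableSpace S] {M : Problem p q n S}
  {LF σF σJ MF Mψ : ℝ}

namespace Problem

variable (M) in
/-- The sampled Jacobian in a given direction. -/
noncomputable def jacAt (v : Euc p) (x : Euc p) (ξ : S) : Euc q :=
  (dom M.Psi).indicator (fun x => M.jac x ξ v) x

lemma jacAt_of_mem {x : Euc p} (hx : x ∈ dom M.Psi) (v : Euc p) (ξ : S) :
    M.jacAt v x ξ = M.jac x ξ v := Set.indicator_of_mem hx _

lemma measurable_jacAt (hM : M.Standing) (hψ : M.BoundedDualDomain Mψ) (v : Euc p) :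
    Measurable (fun z : Euc p × S => M.jacAt v z.1 z.2) := by
  convert measurable_jac_apply hM hψ v using 1
  ext1 z
  by_cases hz : z.1 ∈ dom M.Psi <;> simp [jacAt, hz]

/-- The operator `J` is only known to be measurable vector by vector; the coordinates of its adjoint
are inner products with `J e_i`, so this suffices. -/
lemma measurable_proxStep {Ω : Type*} {mΩ : MeasurableSpace Ω} (hM : M.Standing)
    (hψ : M.BoundedDualDomain Mψ)
    (hs : StrongConvexOn (dom M.ψ) 1 (fun y => (M.ψ y).toReal)) {η : ℝ} (hη : 0 < η)
    {X : Ω → Euc p} {U : Ω → Euc q} {J : Ω → Euc p →L[ℝ] Euc q} (hX : Measurable X)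
    (hU : Measurable U) (hJ : ∀ v, Measurable (fun ω => J ω v)) :
    Measurable (fun ω => prox M.R η
      (X ω - η • (J ω).adjoint (M.K (dualPoint M.ψ (M.K.adjoint (U ω)))))) := by
  have h1 : Measurable (fun ω => M.K (dualPoint M.ψ (M.K.adjoint (U ω)))) :=
    M.K.continuous.measurable.comp ((hψ.ψ_convex.continuous_dualPoint hs hψ.bounded).measurable.comp
      (M.K.adjoint.continuous.measurable.comp hU))
  have h2 : Measurable
      (fun ω => (J ω).adjoint (M.K (dualPoint M.ψ (M.K.adjoint (U ω))))) := by
    have h3 : Measurable (fun ω => (WithLp.toLp 2 fun i : Fin p =>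
        (inner ℝ (J ω (EuclideanSpace.single i 1))
          (M.K (dualPoint M.ψ (M.K.adjoint (U ω)))) : ℝ) : Euc p)) :=
      (WithLp.measurable_toLp 2 _).comp (measurable_pi_iff.2 fun i => (hJ _).inner h1)
    convert h3 using 1
    ext ω i
    change _ = (inner ℝ (J ω (EuclideanSpace.single i 1)) _ : ℝ)
    rw [← ContinuousLinearMap.adjoint_inner_right, EuclideanSpace.inner_single_left]
    simp
  exact (hM.R_convex.continuous_prox hη).measurable.comp (hX.sub (h2.const_smul η))

end Problem

lemma measurable_hybridUpdate_comp {H Ω : Type*} {mΩ : MeasurableSpace Ω}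
    [NormedAddCommGroup H] [InnerProductSpace ℝ H] [CompleteSpace H] [SecondCountableTopology H]
    [MeasurableSpace H] [BorelSpace H] {N : ℕ} {G : Euc p → S → H}
    (hG : Measurable (fun z : Euc p × S => G z.1 z.2)) (β : ℝ) {Z : Ω → H} {X X' : Ω → Euc p}
    {U₁ U₂ : Ω → Fin N → S} (hZ : Measurable Z) (hX : Measurable X) (hX' : Measurable X')
    (hU₁ : Measurable U₁) (hU₂ : Measurable U₂) :
    Measurable (fun ω => hybridUpdate G β (Z ω) (X ω) (X' ω) (U₁ ω) (U₂ ω)) :=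
  (measurable_hybridUpdate hG β).comp ((hZ.prodMk (hX.prodMk hX')).prodMk (hU₁.prodMk hU₂))

lemma measurable_average_comp {H Ω : Type*} {mΩ : MeasurableSpace Ω}
    [NormedAddCommGroup H] [InnerProductSpace ℝ H] [CompleteSpace H] [SecondCountableTopology H]
    [MeasurableSpace H] [BorelSpace H] {N : ℕ} {G : Euc p → S → H}
    (hG : Measurable (fun z : Euc p × S => G z.1 z.2)) (x : Euc p)
    {U : Ω → Fin N → S} (hU : Measurable U) :
    Measurable (fun ω => (1 / (N : ℝ)) • ∑ i, G x (U ω i)) :=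
  (measurable_batchMean (Measurable.of_uncurry_left (f := G) hG)).comp hU

namespace IsRun

variable {Ω : Type*} {b₀ b₀' bF bJ : ℕ} {B : Batches Ω S b₀ b₀' bF bF bJ bJ}
  {β βJ θ η : ℕ → ℝ} {x₀ : Euc p} {x xhat : ℕ → Ω → Euc p} {Ft : ℕ → Ω → Euc q}
  {Jt : ℕ → Ω → Euc p →L[ℝ] Euc q} {y : ℕ → Ω → Euc n}

lemma xhat_eq (hrun : IsRun M B β βJ θ η x₀ x xhat Ft Jt y) (hψ : M.BoundedDualDomain Mψ)
    (hs : StrongConvexOn (dom M.ψ) 1 (fun y => (M.ψ y).toReal)) (t : ℕ) (ω : Ω) :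
    xhat (t + 1) ω = prox M.R (η t) (x t ω - η t •
      (Jt t ω).adjoint (M.K (dualPoint M.ψ (M.K.adjoint (Ft t ω))))) := by
  rw [hrun.xhat_succ, (hrun.dual t ω).eq_dualPoint hψ.ψ_convex hs hψ.bounded]

lemma mem_dom (hrun : IsRun M B β βJ θ η x₀ x xhat Ft Jt y) (hM : M.Standing)
    (hψ : M.BoundedDualDomain Mψ) (hx₀ : x₀ ∈ dom M.Psi) (hθ : ∀ t, θ t ∈ Set.Ioc (0 : ℝ) 1)
    (hη : ∀ t, 0 < η t) (t : ℕ) (ω : Ω) : x t ω ∈ dom M.Psi := by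
  induction t with
  | zero => rwa [hrun.x_zero]
  | succ t ih =>
    rw [hrun.x_succ]
    refine Problem.convex_dom hM hψ ih ?_ (sub_nonneg.2 (hθ t).2) (hθ t).1.le (by ring)
    rw [Problem.dom_Psi hψ, hrun.xhat_succ]
    exact hM.R_convex.prox_mem_dom (hη t) _

lemma Ft_succ_eq (hrun : IsRun M B β βJ θ η x₀ x xhat Ft Jt y) (t : ℕ) (ω : Ω) :
    Ft (t + 1) ω = hybridUpdate M.F (β t) (Ft t ω) (x t ω) (x (t + 1) ω) (B.F1 (t + 1) ω)
      (B.F2 (t + 1) ω) := hrun.Ft_succ t ω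

lemma Jt_succ_apply (hrun : IsRun M B β βJ θ η x₀ x xhat Ft Jt y)
    (hmem : ∀ t ω, x t ω ∈ dom M.Psi) (v : Euc p) (t : ℕ) (ω : Ω) :
    Jt (t + 1) ω v = hybridUpdate (M.jacAt v) (βJ t) (Jt t ω v) (x t ω) (x (t + 1) ω)
      (B.J1 (t + 1) ω) (B.J2 (t + 1) ω) := by
  rw [hrun.Jt_succ, hybridUpdate]
  simp [Problem.jacAt_of_mem (hmem t ω), Problem.jacAt_of_mem (hmem (t + 1) ω)]

/-- `restrictVec` is linear, so the restricted Jacobian estimate obeys the same recursion in a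
Euclidean space, where the variance bound applies. -/
lemma restrictVec_Jt_succ (hrun : IsRun M B β βJ θ η x₀ x xhat Ft Jt y)
    (hmem : ∀ t ω, x t ω ∈ dom M.Psi) (t : ℕ) (ω : Ω) :
    restrictVec M.tangent (Jt (t + 1) ω) = hybridUpdate M.jacVec (βJ t)
      (restrictVec M.tangent (Jt t ω)) (x t ω) (x (t + 1) ω)
      (B.J1 (t + 1) ω) (B.J2 (t + 1) ω) := by
  rw [hrun.Jt_succ, hybridUpdate]
  simp only [map_add, map_smul, map_sum, map_sub, Problem.jacVec_of_mem (hmem t ω),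
    Problem.jacVec_of_mem (hmem (t + 1) ω)]

/-- The iterates and the estimates of iteration `t` are determined by the samples drawn up to
iteration `t`. -/
lemma measurable_history (hrun : IsRun M B β βJ θ η x₀ x xhat Ft Jt y) (hM : M.Standing)
    (hψ : M.BoundedDualDomain Mψ)
    (hs : StrongConvexOn (dom M.ψ) 1 (fun y => (M.ψ y).toReal))
    (hmem : ∀ t ω, x t ω ∈ dom M.Psi) (hη : ∀ t, 0 < η t) (t : ℕ) :
    Measurable[B.history t] (x t) ∧ Measurable[B.history t] (Ft t) ∧
      (∀ v, Measurable[B.history t] (fun ω => Jt t ω v)) ∧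
      Measurable[B.history t] (xhat (t + 1)) ∧ Measurable[B.history t] (x (t + 1)) := by
  -- The next iterate is already determined at time `t`. Hence round `t + 1` is independent of the
  -- old estimate and of both points used in the update.
  have hnext : ∀ t, Measurable[B.history t] (x t) → Measurable[B.history t] (Ft t) →
      (∀ v, Measurable[B.history t] (fun ω => Jt t ω v)) →
      Measurable[B.history t] (xhat (t + 1)) ∧ Measurable[B.history t] (x (t + 1)) := by
    intro t h1 h2 h3
    have h4 : Measurable[B.history t] (xhat (t + 1)) := by
      rw [funext (hrun.xhat_eq hψ hs t)]
      exact Problem.measurable_proxStep hM hψ hs (hη t) h1 h2 h3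
    refine ⟨h4, ?_⟩
    rw [funext (hrun.x_succ t)]
    exact (h1.const_smul (1 - θ t)).add (h4.const_smul (θ t))
  induction t with
  | zero =>
    have h1 : Measurable[B.history 0] (x 0) := by
      rw [funext hrun.x_zero]; exact measurable_const
    have h2 : Measurable[B.history 0] (Ft 0) := by
      rw [funext hrun.Ft_zero]
      simp_rw [hrun.x_zero]
      exact measurable_average_comp hM.measurable_F x₀ (Batches.measurable_F0_history 0)
    have h3 : ∀ v, Measurable[B.history 0] (fun ω => Jt 0 ω v) := fun v => by
      have e : ∀ ω, Jt 0 ω v = (1 / (b₀' : ℝ)) • ∑ i, M.jacAt v x₀ (B.J0 ω i) := fun ω => by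
        have hx := hmem 0 ω
        rw [hrun.x_zero] at hx
        rw [hrun.Jt_zero, hrun.x_zero]
        simp [Problem.jacAt_of_mem hx]
      rw [funext e]
      exact measurable_average_comp (Problem.measurable_jacAt hM hψ v) x₀
        (Batches.measurable_J0_history 0)
    exact ⟨h1, h2, h3, hnext 0 h1 h2 h3⟩
  | succ t ih =>
    obtain ⟨i1, i2, i3, -, i5⟩ := ih
    have hle : B.history t ≤ B.history (t + 1) := Batches.history_mono t.le_succ
    have hr : B.round (t + 1) ≤ B.history (t + 1) :=
      Batches.round_le_history ⟨Nat.le_add_left 1 t, le_rfl⟩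
    have h1 := i5.mono hle le_rfl
    have h2 : Measurable[B.history (t + 1)] (Ft (t + 1)) := by
      rw [funext (hrun.Ft_succ_eq t)]
      exact measurable_hybridUpdate_comp hM.measurable_F _ (i2.mono hle le_rfl)
        (i1.mono hle le_rfl) h1 ((Batches.measurable_F1_round _).mono hr le_rfl)
        ((Batches.measurable_F2_round _).mono hr le_rfl)
    have h3 : ∀ v, Measurable[B.history (t + 1)] (fun ω => Jt (t + 1) ω v) := fun v => by
      rw [funext (hrun.Jt_succ_apply hmem v t)]
      exact measurable_hybridUpdate_comp (Problem.measurable_jacAt hM hψ v) _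
        ((i3 v).mono hle le_rfl) (i1.mono hle le_rfl) h1
        ((Batches.measurable_J1_round _).mono hr le_rfl)
        ((Batches.measurable_J2_round _).mono hr le_rfl)
    exact ⟨h1, h2, h3, hnext (t + 1) h1 h2 h3⟩

lemma measurable_restrictVec {mΩ : MeasurableSpace Ω} {J : Ω → Euc p →L[ℝ] Euc q}
    (V : Submodule ℝ (Euc p)) (hJ : ∀ v, Measurable (fun ω => J ω v)) :
    Measurable (fun ω => restrictVec V (J ω)) := by
  refine (WithLp.measurable_toLp 2 _).comp (measurable_pi_iff.2 fun kj => ?_)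
  have h2 : Measurable fun v : Euc q => v kj.2 := by fun_prop
  exact h2.comp (hJ _)

variable [mΩ : MeasurableSpace Ω] {μ : Measure Ω} [IsProbabilityMeasure μ]

/-- The mean-square error of the estimate of the function value. -/
lemma Ft_error (hrun : IsRun M B β βJ θ η x₀ x xhat Ft Jt y) (hM : M.Standing)
    (hF : M.SmoothBoundedVariance LF σF σJ MF) (hψ : M.BoundedDualDomain Mψ)
    (hs : StrongConvexOn (dom M.ψ) 1 (fun y => (M.ψ y).toReal))
    (hmem : ∀ t ω, x t ω ∈ dom M.Psi) (hη : ∀ t, 0 < η t) (hB : B.IsSampling M.P μ)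
    (hbF : 0 < bF) (t : ℕ) (hL : MemLp (fun ω => Ft t ω - M.mean (x t ω)) 2 μ)
    (hd : Integrable (fun ω => ‖x (t + 1) ω - x t ω‖ ^ 2) μ) :
    MemLp (fun ω => Ft (t + 1) ω - M.mean (x (t + 1) ω)) 2 μ ∧
      ∫ ω, ‖Ft (t + 1) ω - M.mean (x (t + 1) ω)‖ ^ 2 ∂μ ≤
        β t ^ 2 * ∫ ω, ‖Ft t ω - M.mean (x t ω)‖ ^ 2 ∂μ + B.kappaF μ *
          (β t ^ 2 * (MF ^ 2 * (∫ ω, ‖x (t + 1) ω - x t ω‖ ^ 2 ∂μ) / bF)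
            + (1 - β t) ^ 2 * (σF ^ 2 / bF)) := by
  have := hM.isProb
  obtain ⟨h1, h2, -, -, h5⟩ := hrun.measurable_history hM hψ hs hmem hη t
  have ht : 1 ≤ t + 1 := Nat.le_add_left 1 t
  have hle := hB.history_le t
  simp_rw [fun ω => hrun.Ft_succ_eq t ω]
  exact (Problem.isOracle_F hM hF hψ).memLp_hybridUpdate hbF (hB.measurable_F1 _ ht)
    (hB.measurable_F2 _ ht) (hB.law_F1 _ ht) (hB.law_F2 _ ht) (Batches.kappaF_spec μ ht) (β t)
    (h2.mono hle le_rfl) (h1.mono hle le_rfl) (h5.mono hle le_rfl)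
    (hB.indepFun (h2.prodMk (h1.prodMk h5))
      ((Batches.measurable_F1_round _).prodMk (Batches.measurable_F2_round _)))
    (hmem t) (hmem (t + 1)) hL hd

/-- The mean-square error of the estimate of the Jacobian. -/
lemma Jt_error (hrun : IsRun M B β βJ θ η x₀ x xhat Ft Jt y) (hM : M.Standing)
    (hF : M.SmoothBoundedVariance LF σF σJ MF) (hψ : M.BoundedDualDomain Mψ)
    (hs : StrongConvexOn (dom M.ψ) 1 (fun y => (M.ψ y).toReal))
    (hmem : ∀ t ω, x t ω ∈ dom M.Psi) (hη : ∀ t, 0 < η t) (hB : B.IsSampling M.P μ)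
    (hbJ : 0 < bJ) (t : ℕ)
    (hL : MemLp (fun ω => restrictVec M.tangent (Jt t ω) - M.meanJacVec (x t ω)) 2 μ)
    (hd : Integrable (fun ω => ‖x (t + 1) ω - x t ω‖ ^ 2) μ) :
    MemLp (fun ω => restrictVec M.tangent (Jt (t + 1) ω) - M.meanJacVec (x (t + 1) ω)) 2 μ ∧
      ∫ ω, ‖restrictVec M.tangent (Jt (t + 1) ω) - M.meanJacVec (x (t + 1) ω)‖ ^ 2 ∂μ ≤
        βJ t ^ 2 * ∫ ω, ‖restrictVec M.tangent (Jt t ω) - M.meanJacVec (x t ω)‖ ^ 2 ∂μ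
          + B.kappaJ μ *
          (βJ t ^ 2 * (LF ^ 2 * (∫ ω, ‖x (t + 1) ω - x t ω‖ ^ 2 ∂μ) / bJ)
            + (1 - βJ t) ^ 2 * (σJ ^ 2 / bJ)) := by
  have := hM.isProb
  obtain ⟨h1, -, h3, -, h5⟩ := hrun.measurable_history hM hψ hs hmem hη t
  have h2 := measurable_restrictVec M.tangent h3
  have ht : 1 ≤ t + 1 := Nat.le_add_left 1 t
  have hle := hB.history_le t
  simp_rw [fun ω => hrun.restrictVec_Jt_succ hmem t ω]
  exact (Problem.isOracle_jacVec hM hF hψ).memLp_hybridUpdate hbJ (hB.measurable_J1 _ ht)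
    (hB.measurable_J2 _ ht) (hB.law_J1 _ ht) (hB.law_J2 _ ht) (Batches.kappaJ_spec μ ht) (βJ t)
    (h2.mono hle le_rfl) (h1.mono hle le_rfl) (h5.mono hle le_rfl)
    (hB.indepFun (h2.prodMk (h1.prodMk h5))
      ((Batches.measurable_J1_round _).prodMk (Batches.measurable_J2_round _)))
    (hmem t) (hmem (t + 1)) hL hd

lemma Ft_error_zero (hrun : IsRun M B β βJ θ η x₀ x xhat Ft Jt y) (hM : M.Standing)
    (hF : M.SmoothBoundedVariance LF σF σJ MF) (hψ : M.BoundedDualDomain Mψ)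
    (hx₀ : x₀ ∈ dom M.Psi) (hB : B.IsSampling M.P μ) (hb₀ : 0 < b₀) :
    MemLp (fun ω => Ft 0 ω - M.mean (x 0 ω)) 2 μ ∧
      ∫ ω, ‖Ft 0 ω - M.mean (x 0 ω)‖ ^ 2 ∂μ ≤ σF ^ 2 / b₀ := by
  have := hM.isProb
  simp_rw [hrun.Ft_zero, hrun.x_zero]
  exact (Problem.isOracle_F hM hF hψ).memLp_initial hx₀ hb₀ hB.measurable_F0 hB.law_F0

lemma Jt_error_zero (hrun : IsRun M B β βJ θ η x₀ x xhat Ft Jt y) (hM : M.Standing)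
    (hF : M.SmoothBoundedVariance LF σF σJ MF) (hψ : M.BoundedDualDomain Mψ)
    (hx₀ : x₀ ∈ dom M.Psi) (hB : B.IsSampling M.P μ) (hb₀ : 0 < b₀') :
    MemLp (fun ω => restrictVec M.tangent (Jt 0 ω) - M.meanJacVec (x 0 ω)) 2 μ ∧
      ∫ ω, ‖restrictVec M.tangent (Jt 0 ω) - M.meanJacVec (x 0 ω)‖ ^ 2 ∂μ ≤ σJ ^ 2 / b₀' := by
  have := hM.isProb
  have e : ∀ ω, restrictVec M.tangent (Jt 0 ω) = (1 / (b₀' : ℝ)) • ∑ i, M.jacVec x₀ (B.J0 ω i) :=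
    fun ω => by
      rw [hrun.Jt_zero, hrun.x_zero]
      simp only [map_smul, map_sum, Problem.jacVec_of_mem hx₀]
  simp_rw [e, hrun.x_zero]
  exact (Problem.isOracle_jacVec hM hF hψ).memLp_initial hx₀ hb₀ hB.measurable_J0 hB.law_J0

end IsRun

end Run

end HybridSGD

namespace HybridSGD

/-! ### The scalar Lyapunov recursion with cube-root weights. -/

section Recursion

/-- The cube root of `t + 2`. -/
noncomputable def cbrtShift (t : ℕ) : ℝ := ((t : ℝ) + 2) ^ (1 / 3 : ℝ)

lemma cbrtShift_pos (t : ℕ) : 0 < cbrtShift t := Real.rpow_pos_of_pos (by positivity) _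

lemma cbrtShift_pow_three (t : ℕ) : cbrtShift t ^ 3 = t + 2 := by
  rw [cbrtShift, ← Real.rpow_natCast, ← Real.rpow_mul (by positivity)]
  norm_num

lemma cbrtShift_sq (t : ℕ) : cbrtShift t ^ 2 = ((t : ℝ) + 2) ^ (2 / 3 : ℝ) := by
  rw [cbrtShift, ← Real.rpow_natCast, ← Real.rpow_mul (by positivity)]
  norm_num

lemma cbrtShift_succ_pow_three (t : ℕ) : cbrtShift (t + 1) ^ 3 = cbrtShift t ^ 3 + 1 := by
  rw [cbrtShift_pow_three, cbrtShift_pow_three]; push_cast; ring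

lemma weight_eq (t : ℕ) : weight t = 1 - 1 / cbrtShift t ^ 2 := by
  rw [weight, cbrtShift_sq]

lemma stepTheta_eq (L P b : ℝ) (t : ℕ) :
    stepTheta L P b t = L * Real.sqrt b / (P * cbrtShift t) := rfl

lemma cbrtShift_lt_succ (t : ℕ) : cbrtShift t < cbrtShift (t + 1) := by
  have h1 := cbrtShift_succ_pow_three t
  exact lt_of_pow_lt_pow_left₀ 3 (cbrtShift_pos _).le (by linarith)

lemma cbrtShift_succ_le (t : ℕ) :
    cbrtShift (t + 1) ≤ cbrtShift t + 1 / (3 * cbrtShift t ^ 2) := by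
  have h0 := cbrtShift_pos t
  have h1 := cbrtShift_succ_pow_three t
  refine le_of_pow_le_pow_left₀ three_ne_zero (by positivity) ?_
  rw [h1]
  set s := cbrtShift t
  set e := 1 / (3 * s ^ 2) with he
  have h2 : 3 * s ^ 2 * e = 1 := by rw [he]; field_simp
  have h3 : 0 < e := by positivity
  have h4 : (s + e) ^ 3 = s ^ 3 + 3 * s ^ 2 * e + (3 * s * e ^ 2 + e ^ 3) := by ring
  rw [h4, h2]
  have : 0 ≤ 3 * s * e ^ 2 + e ^ 3 := by positivity
  linarith

/-- From `(5/4)³ = 125/64 < 2`. -/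
lemma inv_cbrtShift_le (t : ℕ) : 1 / cbrtShift t ≤ 4 / 5 := by
  have h0 := cbrtShift_pos t
  have h1 := cbrtShift_pow_three t
  rw [div_le_iff₀ h0]
  by_contra! h
  have h2 : cbrtShift t < 5 / 4 := by linarith
  have h3 := pow_lt_pow_left₀ h2 h0.le three_ne_zero
  have : (0 : ℝ) ≤ t := t.cast_nonneg
  linarith

/-- Put `r = 1/s`. With `s_{t+1} ≤ s + r²/3`, the product is at most `s - 2r + r³ + r²/3`, and `r ≤
4/5` gives `r³ + r²/3 ≤ r`. Contraction thus beats the growth of the weight, with `1/s` to spare. -/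
lemma cbrtShift_lyapunov (t : ℕ) :
    cbrtShift (t + 1) * weight t ^ 2 + 1 / cbrtShift t ≤ cbrtShift t := by
  have h0 := cbrtShift_pos t
  have h1 := cbrtShift_succ_le t
  have h2 := inv_cbrtShift_le t
  rw [weight_eq]
  set s := cbrtShift t
  set r := 1 / s with hr
  have hr0 : 0 < r := by positivity
  have hs : s = 1 / r := by rw [hr]; field_simp
  have h3 : 1 / s ^ 2 = r ^ 2 := by rw [hr]; field_simp
  have h4 : 1 / (3 * s ^ 2) = r ^ 2 / 3 := by rw [hr]; field_simp
  rw [h4] at h1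
  rw [h3]
  have h5 : cbrtShift (t + 1) * (1 - r ^ 2) ^ 2 ≤ (s + r ^ 2 / 3) * (1 - r ^ 2) ^ 2 :=
    mul_le_mul_of_nonneg_right h1 (sq_nonneg _)
  have h6 : (s + r ^ 2 / 3) * (1 - r ^ 2) ^ 2 = s - 2 * r + r ^ 3 + r ^ 2 / 3 * (1 - r ^ 2) ^ 2 := by
    rw [hs]; field_simp; ring
  have h7 : (1 - r ^ 2) ^ 2 ≤ 1 := by nlinarith
  have h8 : r ^ 2 / 3 * (1 - r ^ 2) ^ 2 ≤ r ^ 2 / 3 := mul_le_of_le_one_right (by positivity) h7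
  have h9 : r ^ 3 + r ^ 2 / 3 ≤ r := by
    have : r ^ 2 + r / 3 ≤ 1 := by nlinarith
    nlinarith
  linarith

lemma cbrtShift_succ_mul_le (t : ℕ) :
    cbrtShift (t + 1) * weight t ^ 2 ≤ cbrtShift t := by
  have h1 := cbrtShift_lyapunov t
  have h2 : 0 < 1 / cbrtShift t := one_div_pos.2 (cbrtShift_pos t)
  linarith

lemma cbrtShift_noise_le (t : ℕ) :
    cbrtShift (t + 1) / cbrtShift t ^ 4 ≤ 2 / ((t : ℝ) + 1) := by
  have h0 := cbrtShift_pos t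
  have h1 := cbrtShift_pow_three t
  have h2 : cbrtShift (t + 1) ≤ 2 * cbrtShift t := by
    refine le_of_pow_le_pow_left₀ three_ne_zero (by positivity) ?_
    rw [cbrtShift_succ_pow_three, mul_pow, h1]
    have : (0 : ℝ) ≤ t := t.cast_nonneg
    linarith
  calc cbrtShift (t + 1) / cbrtShift t ^ 4 ≤ 2 * cbrtShift t / cbrtShift t ^ 4 := by gcongr
    _ = 2 / cbrtShift t ^ 3 := by field_simp
    _ = 2 / ((t : ℝ) + 2) := by rw [h1]
    _ ≤ _ := by gcongr; norm_num

lemma sum_inv_cbrtShift_ge (T : ℕ) :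
    3 / 2 * (cbrtShift (T + 1) ^ 2 - cbrtShift 0 ^ 2) ≤
      ∑ t ∈ Finset.range (T + 1), 1 / cbrtShift t := by
  rw [← Finset.sum_range_sub (fun t => cbrtShift t ^ 2), Finset.mul_sum]
  refine Finset.sum_le_sum fun t _ => ?_
  have h0 := cbrtShift_pos t
  have h1 := cbrtShift_succ_pow_three t
  have h2 := cbrtShift_lt_succ t
  set s := cbrtShift t
  set s' := cbrtShift (t + 1)
  rw [le_div_iff₀ h0]
  have h3 : (s' - s) * (s' ^ 2 + s' * s + s ^ 2) = 1 := by linarith [h1]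
  -- The claim `3/2 · s(s'² - s²) ≤ s'³ - s³` has defect `(s' - s)²(2s' + s)/2`.
  have h4 : 0 ≤ (s' - s) * ((s' - s) * (2 * s' + s)) :=
    mul_nonneg (by linarith) (mul_nonneg (by linarith) (by linarith))
  nlinarith

lemma sum_inv_succ_le (T : ℕ) :
    ∑ t ∈ Finset.range (T + 1), 1 / ((t : ℝ) + 1) ≤ 1 + Real.log ((T : ℝ) + 1) := by
  have h := harmonic_le_one_add_log (T + 1)
  simp only [harmonic] at h
  push_cast at h
  simpa using h

variable {L P Q b b₀ : ℝ} {pr g D E : ℕ → ℝ}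

/-- With `c = √b/P` the step-size scales every coefficient: the error costs `c · 5/(8s)`, the
reserve for movement is `c · L²/(2s)`, and `P²θ²/b = L²/s²`. The weight `5/8 · s` makes the first
cost equal to the gain from `cbrtShift_lyapunov`. Movement and noise then use the fraction `2 · 5/8
· 9/13 = 45/52` of what is available. -/
lemma lyapunov_step (hL : 0 < L) (hP : 0 < P) (hQ : 0 ≤ Q) (hb : 0 < b) {t : ℕ}
    (hE : 0 ≤ E t) (hD : 0 ≤ D t)
    (h1 : pr (t + 1) + stepTheta L P b t / (16 * L) * g t + L * stepTheta L P b t / 2 * D t ≤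
      pr t + 5 * stepTheta L P b t / (8 * L) * E t)
    (h2 : E (t + 1) ≤ weight t ^ 2 * E t + 9 / 13 * (weight t ^ 2 * (P ^ 2 / b) *
      (stepTheta L P b t ^ 2 * D t) + (1 - weight t) ^ 2 * (Q / b))) :
    pr (t + 1) + Real.sqrt b / P * (5 / 8 * cbrtShift (t + 1) * E (t + 1))
        + stepTheta L P b t / (16 * L) * g t ≤
      pr t + Real.sqrt b / P * (5 / 8 * cbrtShift t * E t)
        + Real.sqrt b / P * (Q / b * (1 / ((t : ℝ) + 1))) := by
  have hs := cbrtShift_pos t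
  have hs' := cbrtShift_pos (t + 1)
  have hly := cbrtShift_lyapunov t
  have hm := cbrtShift_succ_mul_le t
  have hn := cbrtShift_noise_le t
  have hsb : 0 < Real.sqrt b := Real.sqrt_pos.2 hb
  have hsb2 : Real.sqrt b ^ 2 = b := Real.sq_sqrt hb.le
  have hw : (1 - weight t) ^ 2 = 1 / cbrtShift t ^ 4 := by rw [weight_eq]; field_simp; ring
  have e1 : 5 * stepTheta L P b t / (8 * L) = Real.sqrt b / P * (5 / 8 * (1 / cbrtShift t)) := by
    rw [stepTheta_eq]; field_simp
  have e2 : L * stepTheta L P b t / 2 = Real.sqrt b / P * (L ^ 2 / (2 * cbrtShift t)) := by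
    rw [stepTheta_eq]; field_simp
  have e3 : P ^ 2 / b * stepTheta L P b t ^ 2 = L ^ 2 / cbrtShift t ^ 2 := by
    rw [stepTheta_eq, div_pow, mul_pow, hsb2]; field_simp
  rw [hw] at h2
  rw [e1, e2] at h1
  generalize stepTheta L P b t / (16 * L) * g t = gt at *
  set W := weight t ^ 2 with hW
  have h2' : E (t + 1) ≤ W * E t + 9 / 13 * (W * (L ^ 2 / cbrtShift t ^ 2) * D t +
      1 / cbrtShift t ^ 4 * (Q / b)) := by
    refine h2.trans (le_of_eq ?_)
    rw [← e3]; ring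
  set c := Real.sqrt b / P with hc
  have hc0 : 0 < c := by positivity
  set s := cbrtShift t
  set s' := cbrtShift (t + 1)
  have key : 5 / 8 * s' * E (t + 1) ≤ 5 / 8 * s * E t - 5 / 8 * (1 / s) * E t
      + L ^ 2 / (2 * s) * D t + Q / b * (1 / ((t : ℝ) + 1)) := by
    have k1 := mul_le_mul_of_nonneg_left h2' (by positivity : 0 ≤ 5 / 8 * s')
    have k2 : s' * W * E t ≤ (s - 1 / s) * E t := mul_le_mul_of_nonneg_right (by linarith) hE
    have k3 : s' * W * (L ^ 2 / s ^ 2 * D t) ≤ s * (L ^ 2 / s ^ 2 * D t) :=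
      mul_le_mul_of_nonneg_right hm (by positivity)
    have k4 : s * (L ^ 2 / s ^ 2 * D t) = 2 * (L ^ 2 / (2 * s) * D t) := by field_simp
    have k5 : s' / s ^ 4 * (Q / b) ≤ 2 / ((t : ℝ) + 1) * (Q / b) :=
      mul_le_mul_of_nonneg_right hn (by positivity)
    have k6 : 0 ≤ L ^ 2 / (2 * s) * D t := by positivity
    have k7 : 0 ≤ Q / b * (1 / ((t : ℝ) + 1)) := by positivity
    have k8 : 2 / ((t : ℝ) + 1) * (Q / b) = 2 * (Q / b * (1 / ((t : ℝ) + 1))) := by ring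
    have k9 : 5 / 8 * s' * (W * E t + 9 / 13 * (W * (L ^ 2 / s ^ 2) * D t + 1 / s ^ 4 * (Q / b))) =
        5 / 8 * (s' * W * E t) + 45 / 104 * (s' * W * (L ^ 2 / s ^ 2 * D t))
          + 45 / 104 * (s' / s ^ 4 * (Q / b)) := by ring
    rw [k9] at k1
    linarith
  have := mul_le_mul_of_nonneg_left key hc0.le
  linarith

lemma sum_stepTheta_mul_le (hL : 0 < L) (hP : 0 < P) (hQ : 0 ≤ Q) (hb : 0 < b) (hb₀ : 0 < b₀)
    (hp : ∀ t, 0 ≤ pr t) (hE : ∀ t, 0 ≤ E t) (hD : ∀ t, 0 ≤ D t)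
    (h0 : E 0 ≤ 9 / 13 * (Q / b₀))
    (h1 : ∀ t, pr (t + 1) + stepTheta L P b t / (16 * L) * g t
      + L * stepTheta L P b t / 2 * D t ≤ pr t + 5 * stepTheta L P b t / (8 * L) * E t)
    (h2 : ∀ t, E (t + 1) ≤ weight t ^ 2 * E t + 9 / 13 * (weight t ^ 2 * (P ^ 2 / b) *
      (stepTheta L P b t ^ 2 * D t) + (1 - weight t) ^ 2 * (Q / b))) (T : ℕ) :
    ∑ t ∈ Finset.range (T + 1), stepTheta L P b t * g t ≤ 16 * L * (pr 0 + Real.sqrt b / P *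
      (Q * ((2 : ℝ) ^ (1 / 3 : ℝ) / b₀ + 2 * (1 + Real.log ((T : ℝ) + 1)) / b))) := by
  have hstep := fun t => lyapunov_step hL hP hQ hb (hE t) (hD t) (h1 t) (h2 t)
  set c := Real.sqrt b / P with hc
  have hc0 : 0 ≤ c := by positivity
  -- The potential telescopes; the accumulated noise is a harmonic sum, the source of the logarithm.
  have htel : ∀ T : ℕ, pr T + c * (5 / 8 * cbrtShift T * E T) +
      ∑ t ∈ Finset.range T, stepTheta L P b t / (16 * L) * g t ≤
      pr 0 + c * (5 / 8 * cbrtShift 0 * E 0) +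
        c * (Q / b * ∑ t ∈ Finset.range T, 1 / ((t : ℝ) + 1)) := by
    intro T
    induction T with
    | zero => simp
    | succ T ih =>
      rw [Finset.sum_range_succ, Finset.sum_range_succ]
      have := hstep T
      linarith
  have hT := htel (T + 1)
  have hs := cbrtShift_pos (T + 1)
  have k1 : 0 ≤ c * (5 / 8 * cbrtShift (T + 1) * E (T + 1)) := by
    have := hE (T + 1); positivity
  have k2 : 5 / 8 * cbrtShift 0 * E 0 ≤ Q * ((2 : ℝ) ^ (1 / 3 : ℝ) / b₀) := by
    have hs0 := cbrtShift_pos 0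
    have e0 : (2 : ℝ) ^ (1 / 3 : ℝ) = cbrtShift 0 := by simp [cbrtShift]
    rw [e0]
    calc 5 / 8 * cbrtShift 0 * E 0 ≤ 5 / 8 * cbrtShift 0 * (9 / 13 * (Q / b₀)) := by gcongr
      _ = 45 / 104 * (Q * (cbrtShift 0 / b₀)) := by ring
      _ ≤ _ := by
        have : 0 ≤ Q * (cbrtShift 0 / b₀) := by positivity
        linarith
  have k3 : Q / b * ∑ t ∈ Finset.range (T + 1), 1 / ((t : ℝ) + 1) ≤
      Q * (2 * (1 + Real.log ((T : ℝ) + 1)) / b) := by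
    have hl : 0 ≤ 1 + Real.log ((T : ℝ) + 1) := by
      have := Real.log_nonneg (by linarith [T.cast_nonneg (α := ℝ)] : (1 : ℝ) ≤ (T : ℝ) + 1)
      linarith
    calc Q / b * ∑ t ∈ Finset.range (T + 1), 1 / ((t : ℝ) + 1)
        ≤ Q / b * (1 + Real.log ((T : ℝ) + 1)) := by
          gcongr
          exact sum_inv_succ_le T
      -- The factor two is pure slack, matching the form of the stated bound.
      _ ≤ Q / b * (2 * (1 + Real.log ((T : ℝ) + 1))) := by gcongr; linarith
      _ = _ := by ring
  have k4 := mul_le_mul_of_nonneg_left (add_le_add k2 k3) hc0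
  have k5 : ∑ t ∈ Finset.range (T + 1), stepTheta L P b t * g t =
      16 * L * ∑ t ∈ Finset.range (T + 1), stepTheta L P b t / (16 * L) * g t := by
    rw [Finset.mul_sum]
    refine Finset.sum_congr rfl fun t _ => ?_
    field_simp
  rw [k5]
  refine mul_le_mul_of_nonneg_left ?_ (by positivity)
  have := hp (T + 1)
  rw [mul_add Q]
  linarith

/-- The bound for the weighted average of the squared gradient mappings. -/
lemma weighted_average_le (hL : 0 < L) (hP : 0 < P) (hQ : 0 ≤ Q) (hb : 0 < b) (hb₀ : 0 < b₀)
    (hp : ∀ t, 0 ≤ pr t) {T : ℕ}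
    (h : ∑ t ∈ Finset.range (T + 1), stepTheta L P b t * g t ≤ 16 * L * (pr 0 + Real.sqrt b / P *
      (Q * ((2 : ℝ) ^ (1 / 3 : ℝ) / b₀ + 2 * (1 + Real.log ((T : ℝ) + 1)) / b)))) :
    (∑ t ∈ Finset.range (T + 1), stepTheta L P b t * g t) /
        ∑ t ∈ Finset.range (T + 1), stepTheta L P b t ≤
      32 * P * pr 0 / (3 * Real.sqrt b * (((T : ℝ) + 3) ^ (2 / 3 : ℝ) - (2 : ℝ) ^ (2 / 3 : ℝ)))
        + 32 * Q / (3 * (((T : ℝ) + 3) ^ (2 / 3 : ℝ) - (2 : ℝ) ^ (2 / 3 : ℝ))) *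
          ((2 : ℝ) ^ (1 / 3 : ℝ) / b₀ + 2 * (1 + Real.log ((T : ℝ) + 1)) / b) := by
  set B := (2 : ℝ) ^ (1 / 3 : ℝ) / b₀ + 2 * (1 + Real.log ((T : ℝ) + 1)) / b with hB
  have hl := Real.log_nonneg (by linarith [T.cast_nonneg (α := ℝ)] : (1 : ℝ) ≤ (T : ℝ) + 1)
  have hB0 : 0 ≤ B := by positivity
  have hsb : 0 < Real.sqrt b := Real.sqrt_pos.2 hb
  have e1 : ((T : ℝ) + 3) ^ (2 / 3 : ℝ) = cbrtShift (T + 1) ^ 2 := by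
    rw [cbrtShift_sq]; push_cast; ring_nf
  have e2 : (2 : ℝ) ^ (2 / 3 : ℝ) = cbrtShift 0 ^ 2 := by rw [cbrtShift_sq]; simp
  rw [e1, e2]
  have hmono : cbrtShift 0 < cbrtShift (T + 1) :=
    strictMono_nat_of_lt_succ cbrtShift_lt_succ (Nat.succ_pos T)
  have hd : 0 < cbrtShift (T + 1) ^ 2 - cbrtShift 0 ^ 2 :=
    sub_pos.2 (pow_lt_pow_left₀ hmono (cbrtShift_pos 0).le two_ne_zero)
  have hsum : L * Real.sqrt b / P * (3 / 2 * (cbrtShift (T + 1) ^ 2 - cbrtShift 0 ^ 2)) ≤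
      ∑ t ∈ Finset.range (T + 1), stepTheta L P b t := by
    have e3 : ∑ t ∈ Finset.range (T + 1), stepTheta L P b t =
        L * Real.sqrt b / P * ∑ t ∈ Finset.range (T + 1), 1 / cbrtShift t := by
      rw [Finset.mul_sum]
      refine Finset.sum_congr rfl fun t _ => ?_
      have := cbrtShift_pos t
      rw [stepTheta_eq]; field_simp
    rw [e3]
    exact mul_le_mul_of_nonneg_left (sum_inv_cbrtShift_ge T) (by positivity)
  set dd := cbrtShift (T + 1) ^ 2 - cbrtShift 0 ^ 2
  have hden : 0 < L * Real.sqrt b / P * (3 / 2 * dd) := by positivity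
  have hp0 := hp 0
  calc _ ≤ 16 * L * (pr 0 + Real.sqrt b / P * (Q * B)) /
        ∑ t ∈ Finset.range (T + 1), stepTheta L P b t :=
        div_le_div_of_nonneg_right h (hden.le.trans hsum)
    _ ≤ 16 * L * (pr 0 + Real.sqrt b / P * (Q * B)) / (L * Real.sqrt b / P * (3 / 2 * dd)) :=
        div_le_div_of_nonneg_left (by positivity) hden hsum
    _ = _ := by field_simp; ring

end Recursion

end HybridSGD

namespace HybridSGD

/-! ### The random index and the expected descent. -/

open Filter Topology

/-- The expectation at a random index that is independent of a family of random variables. -/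
lemma integral_random_index {Ω : Type*} {m : MeasurableSpace Ω} [MeasurableSpace Ω]
    {μ : Measure Ω} [IsProbabilityMeasure μ] {τ : Ω → ℕ}
    (hτ : Measurable τ) {T : ℕ} {w : ℕ → ℝ} (hw : ∀ t, 0 ≤ w t)
    (hw1 : ∑ t ∈ Finset.range (T + 1), w t = 1)
    (hlaw : ∀ t ≤ T, μ {ω | τ ω = t} = ENNReal.ofReal (w t))
    (hind : Indep (MeasurableSpace.comap τ inferInstance) m μ) {g : ℕ → Ω → ℝ}
    (hgm : ∀ t ≤ T, Measurable[m] (g t)) (hgi : ∀ t ≤ T, Integrable (g t) μ) :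
    Integrable (fun ω => g (τ ω) ω) μ ∧
      ∫ ω, g (τ ω) ω ∂μ = ∑ t ∈ Finset.range (T + 1), w t * ∫ ω, g t ω ∂μ := by
  have hmeas : ∀ t, MeasurableSet {ω | τ ω = t} := fun t => hτ (measurableSet_singleton t)
  -- The prescribed masses already sum to one, so `τ` exceeds `T` with probability zero although it
  -- is only declared natural-valued.
  have hae : ∀ᵐ ω ∂μ, τ ω ∈ Finset.range (T + 1) := by
    have h1 : μ (⋃ t ∈ Finset.range (T + 1), {ω | τ ω = t}) = 1 := by
      rw [measure_biUnion_finset _ fun t _ => hmeas t,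
        Finset.sum_congr rfl fun t ht => hlaw t (Finset.mem_range_succ_iff.1 ht),
        ← ENNReal.ofReal_sum_of_nonneg fun t _ => hw t, hw1, ENNReal.ofReal_one]
      intro s _ t _ hst
      exact Set.disjoint_left.2 fun ω h1 h2 => hst (h1.symm.trans h2)
    have h2 := (prob_compl_eq_zero_iff
      (Finset.measurableSet_biUnion _ fun t _ => hmeas t)).2 h1
    filter_upwards [compl_mem_ae_iff.2 h2] with ω hω
    rw [compl_compl] at hω
    obtain ⟨t, ht, h⟩ := Set.mem_iUnion₂.1 hω
    exact (show τ ω = t from h) ▸ ht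
  set ind : ℕ → Ω → ℝ := fun t => {ω | τ ω = t}.indicator fun _ => 1 with hindr
  have hind_meas : ∀ t, Measurable[MeasurableSpace.comap τ inferInstance] (ind t) := fun t =>
    measurable_const.indicator ⟨{t}, measurableSet_singleton t, rfl⟩
  have hindI : ∀ t, Integrable (ind t) μ := fun t =>
    (integrable_const (1 : ℝ)).indicator (hmeas t)
  have hindep : ∀ t ≤ T, IndepFun (ind t) (g t) μ := fun t ht => by
    rw [IndepFun_iff_Indep]
    exact indep_of_indep_of_le_left (indep_of_indep_of_le_right hind (hgm t ht).comap_le)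
      (hind_meas t).comap_le
  -- Splitting over the value of the index leaves products of independent factors, whose
  -- expectations multiply.
  have heq : (fun ω => g (τ ω) ω) =ᵐ[μ]
      fun ω => ∑ t ∈ Finset.range (T + 1), ind t ω * g t ω := by
    filter_upwards [hae] with ω hω
    rw [Finset.sum_eq_single_of_mem (τ ω) hω]
    · simp [hindr]
    · intro t _ ht
      simp [hindr, Set.indicator_of_notMem (show ω ∉ {ω | τ ω = t} from fun h => ht h.symm)]
  have hI : ∀ t ∈ Finset.range (T + 1), Integrable (fun ω => ind t ω * g t ω) μ := fun t ht =>
    (hindep t (Finset.mem_range_succ_iff.1 ht)).integrable_mul (hindI t)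
      (hgi t (Finset.mem_range_succ_iff.1 ht))
  refine ⟨(integrable_finsetSum _ hI).congr heq.symm, ?_⟩
  rw [integral_congr_ae heq, integral_finsetSum _ hI]
  refine Finset.sum_congr rfl fun t ht => ?_
  have ht' := Finset.mem_range_succ_iff.1 ht
  rw [(hindep t ht').integral_fun_mul_eq_mul_integral (hindI t).1 (hgi t ht').1]
  congr 1
  change ∫ ω, {ω | τ ω = t}.indicator (fun _ => (1 : ℝ)) ω ∂μ = w t
  rw [integral_indicator (hmeas t)]
  simp [measureReal_def, hlaw t ht', hw t]

namespace IsRun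

set_option linter.unusedSectionVars false

variable {p q n : ℕ} {S : Type*} [MeasurableSpace S] {M : Problem p q n S}
  {LF σF σJ MF Mψ : ℝ} {Ω : Type*} {b₀ b₀' bF bJ : ℕ} {B : Batches Ω S b₀ b₀' bF bF bJ bJ}
  {β βJ θ η : ℕ → ℝ} {x₀ : Euc p} {x xhat : ℕ → Ω → Euc p} {Ft : ℕ → Ω → Euc q}
  {Jt : ℕ → Ω → Euc p →L[ℝ] Euc q} {y : ℕ → Ω → Euc n}
  [mΩ : MeasurableSpace Ω] {μ : Measure Ω} [IsProbabilityMeasure μ]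

lemma errBound_eq (hM : M.Standing) (hF : M.SmoothBoundedVariance LF σF σJ MF)
    (hψ : M.BoundedDualDomain Mψ) (hmem : ∀ t ω, x t ω ∈ dom M.Psi) (t : ℕ) (ω : Ω) :
    M.errBound MF Mψ (x t ω) (Ft t ω) (Jt t ω) =
      2 * ‖M.K‖ ^ 2 * Mψ ^ 2 * ‖restrictVec M.tangent (Jt t ω) - M.meanJacVec (x t ω)‖ ^ 2
        + 2 * MF ^ 2 * ‖M.K‖ ^ 4 * ‖Ft t ω - M.mean (x t ω)‖ ^ 2 := by
  rw [Problem.errBound, Problem.meanJacVec, Problem.integral_jacVec hM hF hψ (hmem t ω)]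

lemma integrable_errBound (hM : M.Standing) (hF : M.SmoothBoundedVariance LF σF σJ MF)
    (hψ : M.BoundedDualDomain Mψ) (hmem : ∀ t ω, x t ω ∈ dom M.Psi) {t : ℕ}
    (hLF : MemLp (fun ω => Ft t ω - M.mean (x t ω)) 2 μ)
    (hLJ : MemLp (fun ω => restrictVec M.tangent (Jt t ω) - M.meanJacVec (x t ω)) 2 μ) :
    Integrable (fun ω => M.errBound MF Mψ (x t ω) (Ft t ω) (Jt t ω)) μ ∧
    ∫ ω, M.errBound MF Mψ (x t ω) (Ft t ω) (Jt t ω) ∂μ = 2 * ‖M.K‖ ^ 2 * Mψ ^ 2 *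
        ∫ ω, ‖restrictVec M.tangent (Jt t ω) - M.meanJacVec (x t ω)‖ ^ 2 ∂μ
      + 2 * MF ^ 2 * ‖M.K‖ ^ 4 * ∫ ω, ‖Ft t ω - M.mean (x t ω)‖ ^ 2 ∂μ := by
  simp_rw [fun ω => errBound_eq (Ft := Ft) (Jt := Jt) hM hF hψ hmem t ω]
  have h1 := (hLJ.integrable_norm_pow two_ne_zero).const_mul (2 * ‖M.K‖ ^ 2 * Mψ ^ 2)
  have h2 := (hLF.integrable_norm_pow two_ne_zero).const_mul (2 * MF ^ 2 * ‖M.K‖ ^ 4)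
  refine ⟨h1.add h2, ?_⟩
  rw [integral_add h1 h2, integral_const_mul, integral_const_mul]

/-- The expected decrease of the objective in one iteration. -/
lemma expected_step (hrun : IsRun M B β βJ θ η x₀ x xhat Ft Jt y) (hM : M.Standing)
    (hF : M.SmoothBoundedVariance LF σF σJ MF) (hψ : M.BoundedDualDomain Mψ)
    (hs : StrongConvexOn (dom M.ψ) 1 (fun y => (M.ψ y).toReal))
    (hmem : ∀ t ω, x t ω ∈ dom M.Psi) (hB : B.IsSampling M.P μ) {L : ℝ}
    (hL : L = constL ‖M.K‖ LF MF Mψ) (hL0 : 0 < L) (hθ : ∀ t, θ t ∈ Set.Ioc (0 : ℝ) 1)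
    (hη : ∀ t, η t = 2 / (L * (3 + θ t))) (t : ℕ)
    (hE : Integrable (fun ω => M.errBound MF Mψ (x t ω) (Ft t ω) (Jt t ω)) μ)
    (hp : Integrable (fun ω => (M.Psi (x t ω)).toReal - M.PsiStar.toReal) μ) :
    Integrable (fun ω => (M.Psi (x (t + 1) ω)).toReal - M.PsiStar.toReal) μ ∧
    Integrable (fun ω => ‖M.gradMap (η t) (x t ω)‖ ^ 2) μ ∧
    Integrable (fun ω => ‖xhat (t + 1) ω - x t ω‖ ^ 2) μ ∧
    ∫ ω, ((M.Psi (x (t + 1) ω)).toReal - M.PsiStar.toReal) ∂μ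
        + θ t / (16 * L) * ∫ ω, ‖M.gradMap (η t) (x t ω)‖ ^ 2 ∂μ
        + L * θ t / 2 * ∫ ω, ‖xhat (t + 1) ω - x t ω‖ ^ 2 ∂μ ≤
      ∫ ω, ((M.Psi (x t ω)).toReal - M.PsiStar.toReal) ∂μ
        + 5 * θ t / (8 * L) * ∫ ω, M.errBound MF Mψ (x t ω) (Ft t ω) (Jt t ω) ∂μ := by
  have hθ0 := (hθ t).1
  have hη0 : ∀ t, 0 < η t := fun t => by have := (hθ t).1; rw [hη]; positivity
  obtain ⟨m1, -, -, m4, m5⟩ := hrun.measurable_history hM hψ hs hmem hη0 t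
  have hle := hB.history_le t
  replace m1 := m1.mono hle le_rfl
  replace m4 := m4.mono hle le_rfl
  replace m5 := m5.mono hle le_rfl
  have hstep : ∀ ω, ((M.Psi (x (t + 1) ω)).toReal - M.PsiStar.toReal)
      + θ t / (16 * L) * ‖M.gradMap (η t) (x t ω)‖ ^ 2
      + L * θ t / 2 * ‖xhat (t + 1) ω - x t ω‖ ^ 2 ≤
      ((M.Psi (x t ω)).toReal - M.PsiStar.toReal)
        + 5 * θ t / (8 * L) * M.errBound MF Mψ (x t ω) (Ft t ω) (Jt t ω) := fun ω => by
    have := (Problem.Psi_step_le hM hF hψ hs hL hL0 (hθ t) (hη t) (hmem t ω) (Ft t ω) (Jt t ω)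
      (hrun.xhat_eq hψ hs t ω) (hrun.x_succ t ω)).2
    linarith
  have hbound : Integrable (fun ω => ((M.Psi (x t ω)).toReal - M.PsiStar.toReal)
        + 5 * θ t / (8 * L) * M.errBound MF Mψ (x t ω) (Ft t ω) (Jt t ω)) μ :=
    hp.add (hE.const_mul _)
  have hp0 : ∀ ω, 0 ≤ (M.Psi (x (t + 1) ω)).toReal - M.PsiStar.toReal := fun ω =>
    sub_nonneg.2 (Problem.PsiStar_toReal_le hM (hmem (t + 1) ω))
  have hg0 : ∀ ω, 0 ≤ θ t / (16 * L) * ‖M.gradMap (η t) (x t ω)‖ ^ 2 := fun ω => by positivity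
  have hd0 : ∀ ω, 0 ≤ L * θ t / 2 * ‖xhat (t + 1) ω - x t ω‖ ^ 2 := fun ω => by positivity
  -- All three terms on the left of the pathwise inequality are nonnegative, so each is dominated by
  -- its integrable right side; integrability therefore passes from one iteration to the next.
  have i1 : Integrable (fun ω => (M.Psi (x (t + 1) ω)).toReal - M.PsiStar.toReal) μ := by
    refine hbound.mono' ((Problem.measurable_Psi_toReal_comp hM hψ hs m5
      (hmem (t + 1))).sub_const _).aestronglyMeasurable (ae_of_all _ fun ω => ?_)
    rw [Real.norm_of_nonneg (hp0 ω)]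
    linarith [hstep ω, hg0 ω, hd0 ω]
  have i2 : Integrable (fun ω => θ t / (16 * L) * ‖M.gradMap (η t) (x t ω)‖ ^ 2) μ := by
    refine hbound.mono' ((((Problem.measurable_gradMap_comp hM hψ hs (hη0 t) m1
      (hmem t)).norm.pow_const 2).const_mul _).aestronglyMeasurable) (ae_of_all _ fun ω => ?_)
    rw [Real.norm_of_nonneg (hg0 ω)]
    linarith [hstep ω, hp0 ω, hd0 ω]
  have i3 : Integrable (fun ω => L * θ t / 2 * ‖xhat (t + 1) ω - x t ω‖ ^ 2) μ := by
    refine hbound.mono' ((((m4.sub m1).norm.pow_const 2).const_mul _).aestronglyMeasurable)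
      (ae_of_all _ fun ω => ?_)
    rw [Real.norm_of_nonneg (hd0 ω)]
    linarith [hstep ω, hp0 ω, hg0 ω]
  have c2 : θ t / (16 * L) ≠ 0 := by positivity
  have c3 : L * θ t / 2 ≠ 0 := by positivity
  refine ⟨i1, (integrable_const_mul_iff (IsUnit.mk0 _ c2) _).1 i2,
    (integrable_const_mul_iff (IsUnit.mk0 _ c3) _).1 i3, ?_⟩
  have h := integral_mono ((i1.add i2).add i3) hbound hstep
  simp only [Pi.add_apply] at h
  rwa [integral_add (f := fun ω => ((M.Psi (x (t + 1) ω)).toReal - M.PsiStar.toReal)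
      + θ t / (16 * L) * ‖M.gradMap (η t) (x t ω)‖ ^ 2) (i1.add i2) i3, integral_add i1 i2, integral_add hp (hE.const_mul _),
    integral_const_mul, integral_const_mul, integral_const_mul] at h

end IsRun

lemma constP_sq {k κ κJ c₀ LF MF Mψ : ℝ} (hκ : 0 ≤ κ) (hκJ : 0 ≤ κJ) (hc₀ : 0 < c₀) :
    constP k κ κJ c₀ LF MF Mψ ^ 2 =
      26 * k ^ 2 / (9 * c₀) * (κ * MF ^ 4 * k ^ 2 + c₀ * κJ * LF ^ 2 * Mψ ^ 2) := by
  have h : 0 ≤ κ * MF ^ 4 * k ^ 2 + c₀ * κJ * LF ^ 2 * Mψ ^ 2 := by positivity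
  rw [constP, mul_pow, div_pow, mul_pow, mul_pow, Real.sq_sqrt h, Real.sq_sqrt (by norm_num),
    Real.sq_sqrt hc₀.le]
  norm_num

lemma constP_nonneg {k κ κJ c₀ LF MF Mψ : ℝ} (hk : 0 ≤ k) :
    0 ≤ constP k κ κJ c₀ LF MF Mψ := by
  rw [constP]; positivity

lemma constQ_nonneg {k κ κJ c₀ MF Mψ σF σJ : ℝ} (hκ : 0 ≤ κ) (hκJ : 0 ≤ κJ) (hc₀ : 0 < c₀) :
    0 ≤ constQ k κ κJ c₀ MF Mψ σF σJ := by
  rw [constQ]; positivity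

lemma constL_nonneg {k LF MF Mψ : ℝ} (hk : 0 ≤ k) (hLF : 0 ≤ LF) (hMψ : 0 ≤ Mψ) :
    0 ≤ constL k LF MF Mψ := by
  rw [constL]; positivity

/-- If `L`, `P` or `√b` vanished, the quotient defining the first step-size would be zero; its
positivity therefore rules out degenerate cases such as `K = 0`. Later step-sizes only decrease. -/
lemma stepTheta_mem {L P b : ℝ} (hL : 0 ≤ L) (hP : 0 ≤ P)
    (h0 : stepTheta L P b 0 ∈ Set.Ioc (0 : ℝ) 1) :
    0 < L ∧ 0 < P ∧ ∀ t, stepTheta L P b t ∈ Set.Ioc (0 : ℝ) 1 := by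
  rw [stepTheta_eq] at h0
  have hL0 : 0 < L := hL.lt_of_ne fun h => by simp [← h] at h0
  have hP0 : 0 < P := hP.lt_of_ne fun h => by simp [← h] at h0
  have hb : 0 < Real.sqrt b := (Real.sqrt_nonneg b).lt_of_ne fun h => by simp [← h] at h0
  refine ⟨hL0, hP0, fun t => ?_⟩
  have hs := cbrtShift_pos t
  have hs0 := cbrtShift_pos 0
  rw [stepTheta_eq]
  refine ⟨by positivity, le_trans ?_ h0.2⟩
  have := (strictMono_nat_of_lt_succ cbrtShift_lt_succ).monotone (Nat.zero_le t)
  gcongr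

end HybridSGD

namespace HybridSGD

/-! ### Matching the constants and assembling the bound. -/

namespace IsRun

variable {p q n : ℕ} {S : Type*} [MeasurableSpace S] {M : Problem p q n S}
  {Ω : Type*} {b₀ b₀' bF bJ : ℕ} {B : Batches Ω S b₀ b₀' bF bF bJ bJ}
  {β βJ θ η : ℕ → ℝ} {x₀ : Euc p} {x xhat : ℕ → Ω → Euc p} {Ft : ℕ → Ω → Euc q}
  {Jt : ℕ → Ω → Euc p →L[ℝ] Euc q} {y : ℕ → Ω → Euc n}

lemma norm_sub_sq (hrun : IsRun M B β βJ θ η x₀ x xhat Ft Jt y) (t : ℕ) (ω : Ω) :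
    ‖x (t + 1) ω - x t ω‖ ^ 2 = θ t ^ 2 * ‖xhat (t + 1) ω - x t ω‖ ^ 2 := by
  have : x (t + 1) ω - x t ω = θ t • (xhat (t + 1) ω - x t ω) := by
    rw [hrun.x_succ]; module
  rw [this, norm_smul, mul_pow, Real.norm_eq_abs, sq_abs]

lemma integral_sub_sq (hrun : IsRun M B β βJ θ η x₀ x xhat Ft Jt y) [MeasurableSpace Ω]
    (μ : Measure Ω) (t : ℕ) :
    ∫ ω, ‖x (t + 1) ω - x t ω‖ ^ 2 ∂μ =
      θ t ^ 2 * ∫ ω, ‖xhat (t + 1) ω - x t ω‖ ^ 2 ∂μ := by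
  simp_rw [fun ω => hrun.norm_sub_sq t ω]
  rw [integral_const_mul]

lemma integrable_sub_sq (hrun : IsRun M B β βJ θ η x₀ x xhat Ft Jt y) [MeasurableSpace Ω]
    {μ : Measure Ω} {t : ℕ}
    (h : Integrable (fun ω => ‖xhat (t + 1) ω - x t ω‖ ^ 2) μ) :
    Integrable (fun ω => ‖x (t + 1) ω - x t ω‖ ^ 2) μ := by
  simp_rw [fun ω => hrun.norm_sub_sq t ω]
  exact h.const_mul _

end IsRun

/-- Since `9/13 · 26/9 = 2`, the right side is the exact initial bound with extra factors `κ` and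
`κJ`, both at least one. -/
lemma error_initial_arith {A C k κ κJ c₀ MF Mψ σF σJ b₀ bF₀ : ℝ} (hA : A ≤ σF ^ 2 / bF₀)
    (hC : C ≤ σJ ^ 2 / b₀) (hκ : 1 ≤ κ) (hκJ : 1 ≤ κJ) (hc₀ : 0 < c₀) (hb₀ : 0 < b₀)
    (hbF₀ : bF₀ = c₀ * b₀) :
    2 * k ^ 2 * Mψ ^ 2 * C + 2 * MF ^ 2 * k ^ 4 * A ≤
      9 / 13 * (constQ k κ κJ c₀ MF Mψ σF σJ / b₀) := by
  have e : 9 / 13 * (constQ k κ κJ c₀ MF Mψ σF σJ / b₀) =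
      κJ * (2 * k ^ 2 * Mψ ^ 2 * (σJ ^ 2 / b₀)) +
        κ * (2 * MF ^ 2 * k ^ 4 * (σF ^ 2 / bF₀)) := by
    rw [constQ, hbF₀]; field_simp; ring
  have hbF₀' : 0 < bF₀ := by rw [hbF₀]; positivity
  have h1 : 2 * k ^ 2 * Mψ ^ 2 * C ≤ 2 * k ^ 2 * Mψ ^ 2 * (σJ ^ 2 / b₀) := by gcongr
  have h2 : 2 * MF ^ 2 * k ^ 4 * A ≤ 2 * MF ^ 2 * k ^ 4 * (σF ^ 2 / bF₀) := by gcongr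
  have h3 : 0 ≤ 2 * k ^ 2 * Mψ ^ 2 * (σJ ^ 2 / b₀) := by positivity
  have h4 : 0 ≤ 2 * MF ^ 2 * k ^ 4 * (σF ^ 2 / bF₀) := by positivity
  rw [e]
  exact add_le_add (h1.trans (le_mul_of_one_le_left h3 hκJ))
    (h2.trans (le_mul_of_one_le_left h4 hκ))

/-- Once the two recursions are inserted this is an identity: `P²` and `Q` collect the movement and
noise coefficients, and `bF = c₀ b` puts both batches over the common size `b`. -/
lemma error_recursion_arith {A A' C C' D w P k κ κJ c₀ LF MF Mψ σF σJ b bF : ℝ}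
    (hA : A' ≤ w ^ 2 * A + κ * (w ^ 2 * (MF ^ 2 * D / bF) + (1 - w) ^ 2 * (σF ^ 2 / bF)))
    (hC : C' ≤ w ^ 2 * C + κJ * (w ^ 2 * (LF ^ 2 * D / b) + (1 - w) ^ 2 * (σJ ^ 2 / b)))
    (hP : P ^ 2 = 26 * k ^ 2 / (9 * c₀) * (κ * MF ^ 4 * k ^ 2 + c₀ * κJ * LF ^ 2 * Mψ ^ 2))
    (hc₀ : 0 < c₀) (hb : 0 < b) (hbF : bF = c₀ * b) :
    2 * k ^ 2 * Mψ ^ 2 * C' + 2 * MF ^ 2 * k ^ 4 * A' ≤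
      w ^ 2 * (2 * k ^ 2 * Mψ ^ 2 * C + 2 * MF ^ 2 * k ^ 4 * A) +
        9 / 13 * (w ^ 2 * (P ^ 2 / b) * D
          + (1 - w) ^ 2 * (constQ k κ κJ c₀ MF Mψ σF σJ / b)) := by
  have h1 := mul_le_mul_of_nonneg_left hC (by positivity : 0 ≤ 2 * k ^ 2 * Mψ ^ 2)
  have h2 := mul_le_mul_of_nonneg_left hA (by positivity : 0 ≤ 2 * MF ^ 2 * k ^ 4)
  refine (add_le_add h1 h2).trans (le_of_eq ?_)
  rw [hP, constQ, hbF]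
  field_simp
  ring

end HybridSGD

theorem theorem2
    {p q n : ℕ} {S : Type*} [MeasurableSpace S] (M : Problem p q n S)
    -- the standing assumptions and the assumptions on `F` and `ψ`
    (LF σF σJ MF Mψ : ℝ)
    (hM : M.Standing)
    (hF : M.SmoothBoundedVariance LF σF σJ MF)
    (hψ : M.BoundedDualDomain Mψ)
    (hψ_strong : StrongConvexOn (dom M.ψ) 1 (fun y => (M.ψ y).toReal))
    -- the mini-batch sizes
    (c₀ : ℝ) (hc₀ : 0 < c₀) (b bJ₀ bF bF₀ : ℕ) (hb : 0 < b) (hbJ₀ : 0 < bJ₀)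
    (hbF : (bF : ℝ) = c₀ * b) (hbF₀ : (bF₀ : ℝ) = c₀ * bJ₀)
    -- the mini-batches
    {Ω : Type*} [MeasurableSpace Ω] (μ : Measure Ω) [IsProbabilityMeasure μ]
    (B : Batches Ω S bF₀ bJ₀ bF bF b b) (hB : B.IsSampling M.P μ)
    -- the constants and the step-sizes
    (P Q L : ℝ)
    (hP : P = constP ‖M.K‖ (B.kappaF μ) (B.kappaJ μ) c₀ LF MF Mψ)
    (hQ : Q = constQ ‖M.K‖ (B.kappaF μ) (B.kappaJ μ) c₀ MF Mψ σF σJ)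
    (hL : L = constL ‖M.K‖ LF MF Mψ)
    (θ η : ℕ → ℝ) (hθ : θ = stepTheta L P b) (hη : η = stepEta L θ)
    (hθ₀ : θ 0 ∈ Set.Ioc (0 : ℝ) 1)
    -- the iterates
    (x₀ : Euc p) (hx₀ : x₀ ∈ dom M.Psi)
    (x xhat : ℕ → Ω → Euc p) (Ft : ℕ → Ω → Euc q) (Jt : ℕ → Ω → Euc p →L[ℝ] Euc q)
    (y : ℕ → Ω → Euc n)
    (hrun : IsRun M B weight weight θ η x₀ x xhat Ft Jt y)
    -- the random output `(x_τ, η_τ)`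
    (T : ℕ) (τ : Ω → ℕ) (hτ : Measurable τ)
    (hτ_law : ∀ t ≤ T, μ {ω | τ ω = t} =
      ENNReal.ofReal (θ t / ∑ s ∈ Finset.range (T + 1), θ s))
    (hτ_indep : Indep (MeasurableSpace.comap τ inferInstance) (B.history T) μ) :
    Integrable (fun ω => ‖M.gradMap (η (τ ω)) (x (τ ω) ω)‖ ^ 2) μ ∧
      ∫ ω, ‖M.gradMap (η (τ ω)) (x (τ ω) ω)‖ ^ 2 ∂μ ≤
        32 * P * ((M.Psi x₀).toReal - M.PsiStar.toReal) /
            (3 * Real.sqrt b * (((T : ℝ) + 3) ^ (2 / 3 : ℝ) - (2 : ℝ) ^ (2 / 3 : ℝ)))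
          + 32 * Q / (3 * (((T : ℝ) + 3) ^ (2 / 3 : ℝ) - (2 : ℝ) ^ (2 / 3 : ℝ))) *
            ((2 : ℝ) ^ (1 / 3 : ℝ) / bJ₀ + 2 * (1 + Real.log ((T : ℝ) + 1)) / b) := by
  have hθ' : ∀ t, θ t = stepTheta L P b t := fun t => by rw [hθ]
  have hη' : ∀ t, η t = 2 / (L * (3 + θ t)) := fun t => by rw [hη, stepEta]
  have hk : 0 ≤ ‖M.K‖ := norm_nonneg _
  have hLF := hF.LF_pos
  have hMF := hF.MF_pos
  have hMψ := hψ.Mψ_pos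
  have hκ : 0 ≤ B.kappaF μ := zero_le_one.trans (B.one_le_kappaF μ)
  have hκJ : 0 ≤ B.kappaJ μ := zero_le_one.trans (B.one_le_kappaJ μ)
  have hb' : (0 : ℝ) < b := by exact_mod_cast hb
  have hbJ₀' : (0 : ℝ) < bJ₀ := by exact_mod_cast hbJ₀
  have hbF0 : 0 < bF := by
    have : (0 : ℝ) < bF := by rw [hbF]; positivity
    exact_mod_cast this
  have hbF₀0 : 0 < bF₀ := by
    have : (0 : ℝ) < bF₀ := by rw [hbF₀]; positivity
    exact_mod_cast this
  rw [hθ'] at hθ₀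
  obtain ⟨hL0, hP0, hθm⟩ := stepTheta_mem (hL ▸ constL_nonneg hk hLF.le hMψ.le)
    (hP ▸ constP_nonneg hk) hθ₀
  simp_rw [← hθ'] at hθm
  have hQ0 : 0 ≤ Q := hQ ▸ constQ_nonneg hκ hκJ hc₀
  have hη0 : ∀ t, 0 < η t := fun t => by have := (hθm t).1; rw [hη']; positivity
  have hmem : ∀ t ω, x t ω ∈ dom M.Psi := hrun.mem_dom hM hψ hx₀ hθm hη0
  -- integrability of the errors and of the objective gap
  have hint : ∀ t, MemLp (fun ω => Ft t ω - M.mean (x t ω)) 2 μ ∧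
      MemLp (fun ω => restrictVec M.tangent (Jt t ω) - M.meanJacVec (x t ω)) 2 μ ∧
      Integrable (fun ω => (M.Psi (x t ω)).toReal - M.PsiStar.toReal) μ := by
    intro t
    induction t with
    | zero =>
      refine ⟨(hrun.Ft_error_zero hM hF hψ hx₀ hB hbF₀0).1,
        (hrun.Jt_error_zero hM hF hψ hx₀ hB hbJ₀).1, ?_⟩
      simp_rw [hrun.x_zero]
      exact integrable_const _
    | succ t ih =>
      -- The three claims need each other: integrable errors and gap make the squared step
      -- integrable, which in turn is required for the errors at `t + 1`.
      obtain ⟨h1, h2, h3⟩ := ih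
      obtain ⟨i1, -, i3, -⟩ := hrun.expected_step hM hF hψ hψ_strong hmem hB hL hL0 hθm hη' t
        (IsRun.integrable_errBound hM hF hψ hmem h1 h2).1 h3
      have hd := hrun.integrable_sub_sq i3
      exact ⟨(hrun.Ft_error hM hF hψ hψ_strong hmem hη0 hB hbF0 t h1 hd).1,
        (hrun.Jt_error hM hF hψ hψ_strong hmem hη0 hB hb t h2 hd).1, i1⟩
  have hErr := fun t => IsRun.integrable_errBound (MF := MF) (Mψ := Mψ) hM hF hψ hmem (hint t).1
    (hint t).2.1
  have hstep := fun t => hrun.expected_step hM hF hψ hψ_strong hmem hB hL hL0 hθm hη' t (hErr t).1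
    (hint t).2.2
  have hp0 : ∀ t, 0 ≤ ∫ ω, ((M.Psi (x t ω)).toReal - M.PsiStar.toReal) ∂μ := fun t =>
    integral_nonneg fun ω => sub_nonneg.2 (Problem.PsiStar_toReal_le hM (hmem t ω))
  -- the recursion for the error of the gradient estimate
  have hP2 := constP_sq (k := ‖M.K‖) (LF := LF) (MF := MF) (Mψ := Mψ) hκ hκJ hc₀
  rw [← hP] at hP2
  have hrec0 : ∫ ω, M.errBound MF Mψ (x 0 ω) (Ft 0 ω) (Jt 0 ω) ∂μ ≤ 9 / 13 * (Q / bJ₀) := by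
    rw [(hErr 0).2]
    refine (error_initial_arith (hrun.Ft_error_zero hM hF hψ hx₀ hB hbF₀0).2
      (hrun.Jt_error_zero hM hF hψ hx₀ hB hbJ₀).2 (B.one_le_kappaF μ) (B.one_le_kappaJ μ) hc₀
      hbJ₀' hbF₀).trans (le_of_eq ?_)
    rw [hQ]
  have hrec : ∀ t, ∫ ω, M.errBound MF Mψ (x (t + 1) ω) (Ft (t + 1) ω) (Jt (t + 1) ω) ∂μ ≤
      weight t ^ 2 * ∫ ω, M.errBound MF Mψ (x t ω) (Ft t ω) (Jt t ω) ∂μ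
        + 9 / 13 * (weight t ^ 2 * (P ^ 2 / b) * (stepTheta L P b t ^ 2 *
          ∫ ω, ‖xhat (t + 1) ω - x t ω‖ ^ 2 ∂μ) + (1 - weight t) ^ 2 * (Q / b)) := fun t => by
    have hd := hrun.integrable_sub_sq (hstep t).2.2.1
    have e1 := (hrun.Ft_error hM hF hψ hψ_strong hmem hη0 hB hbF0 t (hint t).1 hd).2
    have e2 := (hrun.Jt_error hM hF hψ hψ_strong hmem hη0 hB hb t (hint t).2.1 hd).2
    rw [hrun.integral_sub_sq] at e1 e2
    rw [(hErr (t + 1)).2, (hErr t).2, ← hθ', hQ]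
    exact error_recursion_arith e1 e2 hP2 hc₀ hb' hbF
  -- the weighted sum of the squared gradient mappings
  have hsum := sum_stepTheta_mul_le hL0 hP0 hQ0 hb' hbJ₀' hp0
    (fun t => integral_nonneg fun ω => Problem.errBound_nonneg MF Mψ _ _ _)
    (fun t => integral_nonneg fun ω => sq_nonneg ‖xhat (t + 1) ω - x t ω‖) hrec0
    (g := fun t => ∫ ω, ‖M.gradMap (η t) (x t ω)‖ ^ 2 ∂μ)
    (fun t => by rw [← hθ']; exact (hstep t).2.2.2) hrec T
  have hfinal := weighted_average_le hL0 hP0 hQ0 hb' hbJ₀' hp0 hsum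
  have hpr0 : ∫ ω, ((M.Psi (x 0 ω)).toReal - M.PsiStar.toReal) ∂μ =
      (M.Psi x₀).toReal - M.PsiStar.toReal := by
    simp_rw [hrun.x_zero]; simp
  rw [hpr0] at hfinal
  simp_rw [← hθ'] at hfinal
  -- the random index
  have hΘ : 0 < ∑ s ∈ Finset.range (T + 1), θ s :=
    Finset.sum_pos (fun s _ => (hθm s).1) ⟨0, by simp⟩
  obtain ⟨r1, r2⟩ := integral_random_index hτ
    (fun t => div_nonneg (hθm t).1.le hΘ.le) (by rw [← Finset.sum_div, div_self hΘ.ne'])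
    hτ_law hτ_indep (g := fun t ω => ‖M.gradMap (η t) (x t ω)‖ ^ 2)
    -- Independence of `τ` is assumed only from the history up to `T`, so measurability must be with
    -- respect to that σ-field; `x t` is known at time `t ≤ T`.
    (fun t ht => (measurable_norm.comp (Problem.measurable_gradMap_comp hM hψ hψ_strong (hη0 t)
      ((hrun.measurable_history hM hψ hψ_strong hmem hη0 t).1.mono (Batches.history_mono ht)
        le_rfl) (hmem t))).pow_const 2)
    (fun t _ => (hstep t).2.1)
  refine ⟨r1, ?_⟩
  rw [r2]
  refine le_trans (le_of_eq ?_) hfinal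
  rw [Finset.sum_div]
  exact Finset.sum_congr rfl fun t _ => by ring
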